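/- Let $V\subset\mathbb R^d$ be closed and let $\Phi=\{\phi_i\}_{i\in\mathcal D}$ be an iterated function system on $V$: a finite family of maps $\phi_i:V\to V$, each satisfying $|\phi_i(x)-\phi_i(y)|\le r_i|x-y|$ on $V$ for some $r_i\in(0,1)$. Let $X\subset V$ be its attractor, i.e. the non-empty compact set with $X=\bigcup_{i\in\mathcal D}\phi_i(X)$. For a word $I=(i_1,\dots,i_n)\in\mathcal D^n$, $n\ge1$, put $|I|=n$, $\phi_I=\phi_{i_1}\circ\dots\circ\phi_{i_n}$ and $X_I=\phi_I(X)$; put $\mathcal D^*=\bigcup_{n\ge1}\mathcal D^n$. For $\Psi:\mathcal D^*\to[0,\infty)$ and $z\in X$ let $$W(\Psi,z)=\{x\in X: |x-\phi_I(z)|\le\Psi(I)\text{ for infinitely many } I\in\mathcal D^*\}.$$ Write $\mathcal H^s$ for $s$-dimensional Hausdorff measure, $\dim_H$ for Hausdorff dimension, and use the convention $0^0=1$. (1) If $\sum_{n=1}^\infty\sum_{I\in\mathcal D^n}\Psi(I)^{\dim_H(X)}<\infty$, then $\mathcal H^{\dim_H(X)}(W(\Psi,z))=0$ for every $z\in X$.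 (2) Suppose that one of the following holds. (a) $\Phi$ is a conformal iterated function system with Hölder continuous differentials, and satisfies the strong separation condition. That is: $V$ is compact; there is an open connected $U\supset V$ such that every $\phi_i$ extends to an injective $C^1$ map $\phi_i:U\to\mathbb R^d$ which satisfies $|\phi_i(x)-\phi_i(y)|\le r|x-y|$ on $U$ for some $r\in(0,1)$, $|\phi_i'(x)y|=|\phi_i'(x)||y|$ for all $x\in U$, $y\in\mathbb R^d$, $0<\inf_U|\phi_i'|\le\sup_U|\phi_i'|<1$, and $\big||\phi_i'(x)|-|\phi_i'(y)|\big|\le c|x-y|^\alpha$ on $U$ for some $c,\alpha>0$; and $\phi_i(X)\cap\phi_j(X)=\emptyset$ for $i\ne j$. (b) Every $\phi_i$ is a similarity of $\mathbb R^d$, $|\phi_i(x)-\phi_i(y)|=r_i|x-y|$ for all $x,y\in\mathbb R^d$ with $r_i\in(0,1)$, and $\Phi$ satisfies the open set condition: there is a non-empty open $O\subset\mathbb R^d$ with $\phi_i(O)\subset O$ for all $i$ and $\phi_i(O)\cap\phi_j(O)=\emptyset$ for $i\neq j$. Then for every $z\in X$ and every decreasing (i.e. non-increasing) $\theta:\mathbb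 N\to[0,\infty)$ (with $\mathbb N=\{1,2,\dots\}$) such that $$\sum_{n=1}^\infty\sum_{I\in\mathcal D^n}\big(\mathrm{Diam}(X_I)\,\theta(n)\big)^{\dim_H(X)}=\infty,$$ $\mathcal H^{\dim_H(X)}$-almost every $x\in X$ lies in $W\big(\mathrm{Diam}(X_I)\theta(|I|),z\big)$. Moreover $\Phi$ is approximation regular in the following general sense. Let $\dim_S(X)$ be the zero $s\ge0$ of the pressure $$P(s)=\lim_{n\to\infty}\tfrac1n\log\inf_{x\in X}\sum_{I\in\mathcal D^n}|\phi_I'(x)|^s=\lim_{n\to\infty}\tfrac1n\log\sup_{x\in X}\sum_{I\in\mathcal D^n}|\phi_I'(x)|^s,$$ and put $t=\dim_S(X)/\dim_H(X)$. (If $X$ is a single point, then $\dim_H(X)=\dim_S(X)=0$ and $t:=0$.) For every $z\in X$ and every decreasing $\theta:\mathbb N\to[0,\infty)$ with $\sum_{n}\sum_{I\in\mathcal D^n}(\mathrm{Diam}(X_I)^{t}\theta(n))^{\dim_H(X)}=\infty$: if $\mathcal H^{\dim_H(X)}(X)>0$, then $\mathcal H^{\dim_H(X)}$-almost every $x\in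 X$ lies in $W(\mathrm{Diam}(X_I)^{t}\theta(|I|),z)$; if $\mathcal H^{\dim_H(X)}(X)=0$, then $\dim_H W(\mathrm{Diam}(X_I)^{t}\theta(|I|),z)=\dim_H(X)$. -/

import Mathlib

open MeasureTheory Topology Filter
open scoped NNReal ENNReal

noncomputable section

/-- An iterated function system, indexed by the alphabet `D`, on a closed subset `domain` of `ℝ^d`.
The maps are total functions, but only their values on `domain` are constrained here; the values
outside `domain` play the role of an extension (see `IsConformal` and `IsSimilarity`). -/
structure IteratedFunctionSystem (d : ℕ) (D : Type*) where
  domain : Set (EuclideanSpace ℝ (Fin d))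
  isClosed_domain : IsClosed domain
  map : D → EuclideanSpace ℝ (Fin d) → EuclideanSpace ℝ (Fin d)
  mapsTo : ∀ i, Set.MapsTo (map i) domain domain
  contracting : ∀ i, ∃ r : ℝ, 0 < r ∧ r < 1 ∧
    ∀ x ∈ domain, ∀ y ∈ domain, dist (map i x) (map i y) ≤ r * dist x y

namespace IteratedFunctionSystem

variable {d : ℕ} {D : Type*}

/-- `X` is the attractor of `Φ`: the non-empty compact set with `X = ⋃ i, φ_i(X)`. -/
def IsAttractor (Φ : IteratedFunctionSystem d D) (X : Set (EuclideanSpace ℝ (Fin d))) : Prop :=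
  X.Nonempty ∧ IsCompact X ∧ X ⊆ Φ.domain ∧ X = ⋃ i, Φ.map i '' X

/-- For a word `I = [i₁, …, iₙ]`, the map `φ_I = φ_{i₁} ∘ ⋯ ∘ φ_{iₙ}`. -/
def wordMap (Φ : IteratedFunctionSystem d D) (I : List D) :
    EuclideanSpace ℝ (Fin d) → EuclideanSpace ℝ (Fin d) :=
  I.foldr (fun i f => Φ.map i ∘ f) id

/-- The cylinder set `X_I = φ_I(X)`. -/
def cylinder (Φ : IteratedFunctionSystem d D) (X : Set (EuclideanSpace ℝ (Fin d)))
    (I : List D) : Set (EuclideanSpace ℝ (Fin d)) :=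
  Φ.wordMap I '' X

/-- `W(Ψ, z)`: the points of `X` that lie in the closed ball `B(φ_I(z), Ψ(I))` for infinitely many
non-empty finite words `I`. -/
def limsupSet (Φ : IteratedFunctionSystem d D) (X : Set (EuclideanSpace ℝ (Fin d)))
    (Ψ : List D → ℝ) (z : EuclideanSpace ℝ (Fin d)) : Set (EuclideanSpace ℝ (Fin d)) :=
  {x ∈ X | {I : List D | I ≠ [] ∧ x ∈ Metric.closedBall (Φ.wordMap I z) (Ψ I)}.Infinite}

/-- The `n`-th block `∑_{I ∈ D^n} Ψ(I)^s`. -/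
def levelSum [Fintype D] (Ψ : List D → ℝ) (s : ℝ) (n : ℕ) : ℝ :=
  ∑ I : Fin n → D, Ψ (List.ofFn I) ^ s

/-- Convergence of `∑_{n ≥ 1} ∑_{I ∈ D^n} Ψ(I)^s` (for non-negative `Ψ`, its failure means that the
series is infinite). -/
def SeriesConverges [Fintype D] (Ψ : List D → ℝ) (s : ℝ) : Prop :=
  Summable fun n : ℕ => levelSum Ψ s (n + 1)

/-- `Φ` is a conformal iterated function system on the compact set `Φ.domain`, with Hölder
continuous differentials. -/
def IsConformal (Φ : IteratedFunctionSystem d D) : Prop :=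
  IsCompact Φ.domain ∧
  ∃ V : Set (EuclideanSpace ℝ (Fin d)), IsOpen V ∧ IsConnected V ∧ Φ.domain ⊆ V ∧
    ∀ i,
      Set.InjOn (Φ.map i) V ∧
      ContDiffOn ℝ 1 (Φ.map i) V ∧
      (∀ x ∈ V, ∀ y, ‖fderiv ℝ (Φ.map i) x y‖ = ‖fderiv ℝ (Φ.map i) x‖ * ‖y‖) ∧
      (∃ r : ℝ, 0 < r ∧ r < 1 ∧
        ∀ x ∈ V, ∀ y ∈ V, dist (Φ.map i x) (Φ.map i y) ≤ r * dist x y) ∧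
      (∃ a b : ℝ, 0 < a ∧ b < 1 ∧
        ∀ x ∈ V, a ≤ ‖fderiv ℝ (Φ.map i) x‖ ∧ ‖fderiv ℝ (Φ.map i) x‖ ≤ b) ∧
      (∃ α c : ℝ, 0 < α ∧ 0 < c ∧ ∀ x ∈ V, ∀ y ∈ V,
        |‖fderiv ℝ (Φ.map i) x‖ - ‖fderiv ℝ (Φ.map i) y‖| ≤ c * dist x y ^ α)

/-- Every map of `Φ` is a contracting similarity of `ℝ^d`. -/
def IsSimilarity (Φ : IteratedFunctionSystem d D) : Prop :=
  ∀ i, ∃ r : ℝ, 0 < r ∧ r < 1 ∧ ∀ x y, dist (Φ.map i x) (Φ.map i y) = r * dist x y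

/-- The strong separation condition: the sets `φ_i(X)` are pairwise disjoint. -/
def StrongSeparation (Φ : IteratedFunctionSystem d D)
    (X : Set (EuclideanSpace ℝ (Fin d))) : Prop :=
  ∀ i j, i ≠ j → Disjoint (Φ.map i '' X) (Φ.map j '' X)

/-- The open set condition, for maps defined on all of `ℝ^d`. -/
def OpenSetCondition (Φ : IteratedFunctionSystem d D) : Prop :=
  ∃ O : Set (EuclideanSpace ℝ (Fin d)), IsOpen O ∧ O.Nonempty ∧
    (∀ i, Φ.map i '' O ⊆ O) ∧ ∀ i j, i ≠ j → Disjoint (Φ.map i '' O) (Φ.map j '' O)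

/-- `∑_{I ∈ D^n} |φ_I'(x)|^s`. -/
def derivSum [Fintype D] (Φ : IteratedFunctionSystem d D) (s : ℝ) (n : ℕ)
    (x : EuclideanSpace ℝ (Fin d)) : ℝ :=
  ∑ I : Fin n → D, ‖fderiv ℝ (Φ.wordMap (List.ofFn I)) x‖ ^ s

/-- `P(s) = 0` for the pressure
`P(s) = lim (1/n) log inf_{x ∈ X} ∑_{I ∈ D^n} |φ_I'(x)|^s
      = lim (1/n) log sup_{x ∈ X} ∑_{I ∈ D^n} |φ_I'(x)|^s`. -/
def PressureZero [Fintype D] (Φ : IteratedFunctionSystem d D)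
    (X : Set (EuclideanSpace ℝ (Fin d))) (s : ℝ) : Prop :=
  Tendsto (fun n : ℕ => (1 / (n : ℝ)) * Real.log (⨅ x : X, Φ.derivSum s n x)) atTop (𝓝 0) ∧
  Tendsto (fun n : ℕ => (1 / (n : ℝ)) * Real.log (⨆ x : X, Φ.derivSum s n x)) atTop (𝓝 0)

/-- The similarity dimension `dim_S(X)`: the zero `s ≥ 0` of the pressure. The zero is unique for
conformal systems and, when `d ≥ 1`, for systems of similarities; the infimum only selects it. -/
def similarityDim [Fintype D] (Φ : IteratedFunctionSystem d D)
    (X : Set (EuclideanSpace ℝ (Fin d))) : ℝ :=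
  sInf {s : ℝ | 0 ≤ s ∧ Φ.PressureZero X s}

/-- The Hausdorff dimension of a subset of `ℝ^d`, as a real number. -/
def hausdorffDim (X : Set (EuclideanSpace ℝ (Fin d))) : ℝ := (dimH X).toReal

/-- The approximating function `I ↦ Diam(X_I)^t θ(|I|)`. -/
def approxFun (Φ : IteratedFunctionSystem d D) (X : Set (EuclideanSpace ℝ (Fin d)))
    (t : ℝ) (θ : ℕ → ℝ≥0) (I : List D) : ℝ :=
  Metric.diam (Φ.cylinder X I) ^ t * θ I.length

open Classical in
/-- `(Φ, z)` is an approximation regular pair: for every `θ : {1, 2, …} → [0, ∞)` that is decreasing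
and makes the series of `(Diam(X_I)^{dim_S / dim_H} θ(n))^{dim_H}` diverge, the set
`W(Diam(X_I)^{dim_S / dim_H} θ(|I|), z)` contains almost every point of `X` when
`H^{dim_H}(X) > 0`, and has full Hausdorff dimension in `X` when `H^{dim_H}(X) = 0`. -/
def IsApproximationRegularPair [Fintype D] (Φ : IteratedFunctionSystem d D)
    (X : Set (EuclideanSpace ℝ (Fin d))) (z : EuclideanSpace ℝ (Fin d)) : Prop :=
  ∀ θ : ℕ → ℝ≥0, AntitoneOn θ (Set.Ici 1) →
    ¬ SeriesConverges (Φ.approxFun X (Φ.similarityDim X / hausdorffDim X) θ) (hausdorffDim X) →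
    if 0 < μH[hausdorffDim X] X then
      μH[hausdorffDim X]
        (X \ Φ.limsupSet X (Φ.approxFun X (Φ.similarityDim X / hausdorffDim X) θ) z) = 0
    else
      dimH (Φ.limsupSet X (Φ.approxFun X (Φ.similarityDim X / hausdorffDim X) θ) z) = dimH X

/-- `Φ`, with attractor `X`, is an approximation regular iterated function system. -/
def IsApproximationRegular [Fintype D] (Φ : IteratedFunctionSystem d D)
    (X : Set (EuclideanSpace ℝ (Fin d))) : Prop :=
  ∀ z ∈ X, Φ.IsApproximationRegularPair X z

end IteratedFunctionSystem

end

/-!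
The convergence part is the covering argument of the Borel–Cantelli lemma
(`hausdorffMeasure_limsupSet_eq_zero`). For the exponent `0` the convention `0 ^ 0 = 1` makes the
series diverge.

The divergence part is trivial if `X` is a single point, since every `φ_I` then fixes it. Otherwise
both classes of systems are reduced to `IsQuasiSelfSimilar`: up to a constant, `φ_I` scales
distances in `X` by `Diam(X_I)`, and `|φ_I'|` is `Diam(X_I)`. For similarities this is immediate.
For conformal systems it follows from bounded distortion
(`IsConformalOn.exists_bounded_distortion`), the mean value inequality for the upper bound, and a
quantitative surjectivity statement together with injectivity for the lower bound
(`exists_eq_of_le_norm_fderiv`).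

Quasi-self-similarity makes the partition functions `∑_{I ∈ D^n} Diam(X_I)^s` quasi-multiplicative,
so for some exponent `s > 0` they are bounded away from `0` and `∞`
(`IsQuasiSelfSimilar.exists_exponent`). This `s` is the similarity dimension. Covers by cylinders
show `H^s(X) < ∞`. The separation conditions limit the number of cylinders of comparable size that
meet a given set (`HasFiniteClustering`), so that any cover can be replaced by one made of
cylinders, which gives `H^s(X) > 0`. Hence `s` is also the Hausdorff dimension, `t = 1`, and the
restriction of `H^s` to `X` is a measure with `ν(X_{IJ}) ≍ ν(X_I) ν(X_J)` and null overlaps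
(`IsConformalMeasure`).

Let `z` be coded by `ω`. The ball `B(φ_I(z), Diam(X_I) θ(n))` with `|I| = n` contains the cylinder
of `I` followed by the first `k(n)` letters of `ω`, of relative measure comparable with
`min(θ(n), 1)^s`. The events that the coding of a point shows these `k(n)` letters after time `n`
are quasi-independent, except for a correlation between times `m < n` that is bounded by the measure
of the cylinder of the first `n - m` letters of `ω` and is therefore summable
(`IsConformalMeasure.wordSum_wordSum_inter_le`). A second moment argument shows that infinitely many
of the events occur on a set of measure bounded below, independently of the targets. By the scaling
property the same holds inside every cylinder, and a set that occupies a fixed proportion of every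
cylinder has full measure (`IsConformalMeasure.measure_diff_eq_zero_of_cylinder`).
-/

noncomputable section

namespace IteratedFunctionSystem

variable {d : ℕ} {D : Type*}

/-! ### Words, cylinders and the attractor -/

/-- The word consisting of the first `k` letters of the infinite word `ω`. -/
def prefixWord (ω : ℕ → D) (k : ℕ) : List D := (List.range k).map ω

@[simp]
theorem length_prefixWord (ω : ℕ → D) (k : ℕ) : (prefixWord ω k).length = k := by
  simp [prefixWord]

theorem prefixWord_succ (ω : ℕ → D) (k : ℕ) : prefixWord ω (k + 1) = prefixWord ω k ++ [ω k] := by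
  simp [prefixWord, List.range_succ]

theorem prefixWord_prefix (ω : ℕ → D) {j k : ℕ} (h : j ≤ k) :
    prefixWord ω j <+: prefixWord ω k := by
  obtain ⟨l, rfl⟩ := Nat.exists_eq_add_of_le h
  rw [prefixWord, prefixWord, List.range_add, List.map_append]
  exact List.prefix_append _ _

/-- The sum of `g` over all words of length `n`. -/
def wordSum [Fintype D] {M : Type*} [AddCommMonoid M] (n : ℕ) (g : List D → M) : M :=
  ∑ I : Fin n → D, g (List.ofFn I)

theorem exists_ofFn_of_length {n : ℕ} {I : List D} (h : I.length = n) :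
    ∃ f : Fin n → D, List.ofFn f = I := by
  subst h
  exact ⟨I.get, List.ofFn_get I⟩

section wordSum

variable [Fintype D]

theorem wordSum_add {M : Type*} [AddCommMonoid M] (m n : ℕ) (g : List D → M) :
    wordSum (m + n) g = wordSum m fun I => wordSum n fun J => g (I ++ J) := by
  unfold wordSum
  rw [← Fintype.sum_prod_type', ← (Fin.appendEquiv m n).sum_comp]
  refine Finset.sum_congr rfl fun p _ => ?_
  simp [Fin.appendEquiv, List.ofFn_fin_append]

@[simp]
theorem wordSum_zero {M : Type*} [AddCommMonoid M] (g : List D → M) :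
    wordSum 0 g = g [] := by
  simp [wordSum]

theorem wordSum_congr {M : Type*} [AddCommMonoid M] {n : ℕ} {g h : List D → M}
    (H : ∀ I, List.length I = n → g I = h I) : wordSum n g = wordSum n h :=
  Finset.sum_congr rfl fun _ _ => H _ (by simp)

theorem wordSum_le {n : ℕ} {g h : List D → ℝ}
    (H : ∀ I : List D, I.length = n → g I ≤ h I) : wordSum n g ≤ wordSum n h :=
  Finset.sum_le_sum fun I _ => H _ (by simp)

theorem wordSum_mul_left (n : ℕ) (c : ℝ) (g : List D → ℝ) :
    wordSum n (fun I => c * g I) = c * wordSum n g := by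
  simp [wordSum, Finset.mul_sum]

theorem wordSum_mul_right (n : ℕ) (c : ℝ) (g : List D → ℝ) :
    wordSum n (fun I => g I * c) = wordSum n g * c := by
  simp [wordSum, Finset.sum_mul]

theorem wordSum_const_one (n : ℕ) :
    wordSum n (fun _ : List D => (1 : ℝ)) = (Fintype.card D : ℝ) ^ n := by
  simp [wordSum]

/-- A function of words of length `N` that vanishes off the extensions of `A` is summed over the
extensions only. -/
theorem wordSum_eq_of_prefix {N : ℕ} {A : List D} (hA : A.length ≤ N) {g : List D → ℝ}
    (h : ∀ I : List D, I.length = N → ¬ A <+: I → g I = 0) :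
    wordSum N g = wordSum (N - A.length) fun J => g (A ++ J) := by
  obtain ⟨k, rfl⟩ := Nat.exists_eq_add_of_le hA
  obtain ⟨a, ha⟩ := exists_ofFn_of_length (rfl : A.length = A.length)
  rw [wordSum_add, Nat.add_sub_cancel_left]
  conv_lhs => unfold wordSum
  rw [Finset.sum_eq_single a, ha]
  · rfl
  · intro b _ hb
    refine Finset.sum_eq_zero fun J _ => h _ (by simp) fun hp => hb ?_
    have h2 := (List.prefix_of_prefix_length_le hp (List.prefix_append _ _)
      (by simp)).eq_of_length (by simp)
    exact List.ofFn_injective (h2.symm.trans ha.symm)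
  · simp

end wordSum

section words

variable (Φ : IteratedFunctionSystem d D) {X : Set (EuclideanSpace ℝ (Fin d))}

@[simp]
theorem wordMap_nil : Φ.wordMap [] = id := rfl

theorem wordMap_cons (i : D) (I : List D) : Φ.wordMap (i :: I) = Φ.map i ∘ Φ.wordMap I := rfl

theorem wordMap_append (I J : List D) : Φ.wordMap (I ++ J) = Φ.wordMap I ∘ Φ.wordMap J := by
  induction I with
  | nil => rfl
  | cons i I ih => simp [wordMap_cons, ih, Function.comp_assoc]

@[simp]
theorem cylinder_nil : Φ.cylinder X [] = X := by simp [cylinder]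

theorem cylinder_append (I J : List D) :
    Φ.cylinder X (I ++ J) = Φ.wordMap I '' Φ.cylinder X J := by
  rw [cylinder, wordMap_append, Set.image_comp, cylinder]

theorem cylinder_cons (i : D) (J : List D) :
    Φ.cylinder X (i :: J) = Φ.map i '' Φ.cylinder X J := by
  rw [cylinder, wordMap_cons, Set.image_comp, cylinder]

end words

namespace IsAttractor

variable {Φ : IteratedFunctionSystem d D} {X : Set (EuclideanSpace ℝ (Fin d))}

theorem map_mem (hX : Φ.IsAttractor X) (i : D) {x : EuclideanSpace ℝ (Fin d)} (hx : x ∈ X) :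
    Φ.map i x ∈ X := by
  rw [hX.2.2.2]
  exact Set.mem_iUnion_of_mem i ⟨x, hx, rfl⟩

theorem wordMap_mem (hX : Φ.IsAttractor X) (I : List D) {x : EuclideanSpace ℝ (Fin d)}
    (hx : x ∈ X) :
    Φ.wordMap I x ∈ X := by
  induction I with
  | nil => exact hx
  | cons i I ih => exact hX.map_mem i ih

theorem cylinder_subset (hX : Φ.IsAttractor X) (I : List D) : Φ.cylinder X I ⊆ X := by
  rintro _ ⟨x, hx, rfl⟩
  exact hX.wordMap_mem I hx

theorem cylinder_append_subset (hX : Φ.IsAttractor X) (I J : List D) :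
    Φ.cylinder X (I ++ J) ⊆ Φ.cylinder X I := by
  rw [cylinder_append]
  exact Set.image_mono (hX.cylinder_subset J)

theorem cylinder_subset_of_prefix (hX : Φ.IsAttractor X) {I J : List D} (h : I <+: J) :
    Φ.cylinder X J ⊆ Φ.cylinder X I := by
  obtain ⟨K, rfl⟩ := h
  exact hX.cylinder_append_subset I K

theorem cylinder_nonempty (hX : Φ.IsAttractor X) (I : List D) :
    (Φ.cylinder X I).Nonempty := hX.1.image _

theorem nonempty_alphabet (hX : Φ.IsAttractor X) : Nonempty D := by
  obtain ⟨x, hx⟩ := hX.1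
  rw [hX.2.2.2] at hx
  obtain ⟨i, -⟩ := Set.mem_iUnion.1 hx
  exact ⟨i⟩

theorem exists_map_eq (hX : Φ.IsAttractor X) {x : EuclideanSpace ℝ (Fin d)} (hx : x ∈ X) :
    ∃ i, ∃ y ∈ X, Φ.map i y = x := by
  rw [hX.2.2.2] at hx
  obtain ⟨i, y, hy, rfl⟩ := Set.mem_iUnion.1 hx
  exact ⟨i, y, hy, rfl⟩

theorem exists_mem_cylinder (hX : Φ.IsAttractor X) (n : ℕ) {x : EuclideanSpace ℝ (Fin d)}
    (hx : x ∈ X) :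
    ∃ I : List D, I.length = n ∧ x ∈ Φ.cylinder X I := by
  induction n generalizing x with
  | zero => exact ⟨[], rfl, by simpa using hx⟩
  | succ n ih =>
    obtain ⟨i, y, hy, rfl⟩ := hX.exists_map_eq hx
    obtain ⟨I, rfl, hI⟩ := ih hy
    exact ⟨i :: I, rfl, by rw [cylinder_cons]; exact ⟨y, hI, rfl⟩⟩

theorem eq_iUnion_cylinder (hX : Φ.IsAttractor X) (n : ℕ) :
    X = ⋃ I : Fin n → D, Φ.cylinder X (List.ofFn I) := by
  refine Set.Subset.antisymm (fun x hx => ?_) (Set.iUnion_subset fun I => hX.cylinder_subset _)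
  obtain ⟨I, rfl, hI⟩ := hX.exists_mem_cylinder n hx
  exact Set.mem_iUnion_of_mem I.get (by rwa [List.ofFn_get])

/-- Every point of the attractor has a coding `ω`. -/
theorem exists_coding (hX : Φ.IsAttractor X) {z : EuclideanSpace ℝ (Fin d)} (hz : z ∈ X) :
    ∃ ω : ℕ → D, ∀ k, z ∈ Φ.cylinder X (prefixWord ω k) := by
  have := hX.nonempty_alphabet
  choose! f g hg hfg using fun x (hx : x ∈ X) => hX.exists_map_eq hx
  have hmem : ∀ k, g^[k] z ∈ X := fun k => by
    induction k with
    | zero => exact hz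
    | succ k ih => rw [Function.iterate_succ_apply']; exact hg _ ih
  refine ⟨fun k => f (g^[k] z), fun k => ⟨g^[k] z, hmem k, ?_⟩⟩
  induction k with
  | zero => simp [prefixWord]
  | succ k ih =>
    rw [prefixWord_succ, wordMap_append, Function.comp_apply, wordMap_cons, wordMap_nil,
      Function.comp_id, Function.iterate_succ_apply', hfg _ (hmem k), ih]

theorem exists_uniform_ratio [Fintype D] (hX : Φ.IsAttractor X) :
    ∃ ρ : ℝ, 0 < ρ ∧ ρ < 1 ∧ ∀ I : List D, ∀ x ∈ X, ∀ y ∈ X,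
    dist (Φ.wordMap I x) (Φ.wordMap I y) ≤ ρ ^ I.length * dist x y := by
  have := hX.nonempty_alphabet
  choose r hr0 hr1 hr using Φ.contracting
  obtain ⟨i₀, hi₀⟩ := Finite.exists_max r
  refine ⟨r i₀, hr0 _, hr1 _, fun I => ?_⟩
  induction I with
  | nil => simp
  | cons i I ih =>
    intro x hx y hy
    calc dist (Φ.map i (Φ.wordMap I x)) (Φ.map i (Φ.wordMap I y))
        ≤ r i * dist (Φ.wordMap I x) (Φ.wordMap I y) :=
          hr i _ (hX.2.2.1 (hX.wordMap_mem I hx)) _ (hX.2.2.1 (hX.wordMap_mem I hy))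
      _ ≤ r i₀ * (r i₀ ^ I.length * dist x y) :=
          mul_le_mul (hi₀ i) (ih x hx y hy) dist_nonneg (hr0 _).le
      _ = _ := by rw [List.length_cons]; ring

theorem continuousOn_wordMap (hX : Φ.IsAttractor X) (I : List D) :
    ContinuousOn (Φ.wordMap I) X := by
  induction I with
  | nil => exact continuousOn_id
  | cons i I ih =>
    obtain ⟨r, hr0, -, hr⟩ := Φ.contracting i
    have : LipschitzOnWith ⟨r, hr0.le⟩ (Φ.map i) Φ.domain :=
      LipschitzOnWith.of_dist_le_mul hr
    exact this.continuousOn.comp ih fun x hx => hX.2.2.1 (hX.wordMap_mem I hx)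

theorem isCompact_cylinder (hX : Φ.IsAttractor X) (I : List D) : IsCompact (Φ.cylinder X I) :=
  hX.2.1.image_of_continuousOn (hX.continuousOn_wordMap I)

theorem measurableSet_cylinder (hX : Φ.IsAttractor X) (I : List D) :
    MeasurableSet (Φ.cylinder X I) :=
  (hX.isCompact_cylinder I).measurableSet

theorem dist_le_diam_cylinder (hX : Φ.IsAttractor X) (I : List D) {x y : EuclideanSpace ℝ (Fin d)}
    (hx : x ∈ Φ.cylinder X I) (hy : y ∈ Φ.cylinder X I) :
    dist x y ≤ Metric.diam (Φ.cylinder X I) :=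
  Metric.dist_le_diam_of_mem (hX.isCompact_cylinder I).isBounded hx hy

end IsAttractor

/-! ### The convergence part -/

theorem levelSum_eq_wordSum [Fintype D] (Ψ : List D → ℝ) (s : ℝ) (n : ℕ) :
    levelSum Ψ s n = wordSum n fun I => Ψ I ^ s := rfl

/-- With the convention `0 ^ 0 = 1` the series diverges for the exponent `0`. -/
theorem not_seriesConverges_zero [Fintype D] [Nonempty D] (Ψ : List D → ℝ) :
    ¬ SeriesConverges Ψ 0 := by
  intro h
  have h0 := h.tendsto_atTop_zero
  have h1 : ∀ n : ℕ, (1 : ℝ) ≤ levelSum Ψ 0 (n + 1) := fun n => by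
    simp only [levelSum, Real.rpow_zero, Finset.sum_const, nsmul_eq_mul, mul_one]
    exact_mod_cast Finset.card_pos.2 Finset.univ_nonempty
  have := ge_of_tendsto' h0 h1
  linarith

theorem exists_length_gt_of_mem_limsupSet [Fintype D] {Φ : IteratedFunctionSystem d D}
    {X : Set (EuclideanSpace ℝ (Fin d))} {Ψ : List D → ℝ} {z x : EuclideanSpace ℝ (Fin d)}
    (hx : x ∈ Φ.limsupSet X Ψ z) (N : ℕ) :
    ∃ I : List D, N < I.length ∧ x ∈ Metric.closedBall (Φ.wordMap I z) (Ψ I) := by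
  by_contra! H
  refine hx.2 ((List.finite_length_le D N).subset fun I hI => ?_)
  by_contra hlt
  exact H I (not_le.1 hlt) hI.2

theorem hausdorffMeasure_limsupSet_eq_zero [Fintype D] [Nonempty D]
    (Φ : IteratedFunctionSystem d D) (X : Set (EuclideanSpace ℝ (Fin d))) {s : ℝ} (hs : 0 ≤ s)
    (Ψ : List D → ℝ≥0) (hΨ : SeriesConverges (fun I => (Ψ I : ℝ)) s)
    (z : EuclideanSpace ℝ (Fin d)) :
    μH[s] (Φ.limsupSet X (fun I => (Ψ I : ℝ)) z) = 0 := by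
  rcases hs.eq_or_lt with rfl | hs
  · exact absurd hΨ (not_seriesConverges_zero _)
  let ι : ℕ → Type _ := fun N => Σ n : ℕ, Fin (N + n + 1) → D
  -- the sums of `Ψ ^ s` over all words of length greater than `N`, in `ℝ≥0`
  let G : ℕ → ℝ≥0 := fun n => ∑ I : Fin (n + 1) → D, Ψ (List.ofFn I) ^ s
  have hGs : Summable G := by
    rw [← NNReal.summable_coe]
    refine hΨ.congr fun n => ?_
    simp [G, levelSum]
  have hGt : Tendsto (fun N => ∑' n, (G (N + n) : ℝ≥0∞)) atTop (𝓝 0) := by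
    have h1 := ENNReal.tendsto_sum_nat_add (fun n => (G n : ℝ≥0∞))
      (ENNReal.tsum_coe_ne_top_iff_summable.2 hGs)
    simpa only [add_comm] using h1
  have hle : ∀ N, ∀ p : ι N, (Ψ (List.ofFn p.2) : ℝ≥0∞) ^ s ≤ ∑' n, (G (N + n) : ℝ≥0∞) := by
    intro N p
    refine le_trans ?_ (ENNReal.le_tsum p.1)
    rw [← ENNReal.coe_rpow_of_nonneg _ hs.le]
    exact_mod_cast Finset.single_le_sum (f := fun I : Fin (N + p.1 + 1) → D =>
      Ψ (List.ofFn I) ^ s) (fun _ _ => zero_le) (Finset.mem_univ p.2)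
  let r : ℕ → ℝ≥0∞ := fun N => 2 * (∑' n, (G (N + n) : ℝ≥0∞)) ^ (1 / s)
  have hr : Tendsto r atTop (𝓝 0) := by
    have h := (hGt.ennrpow_const (1 / s))
    rw [ENNReal.zero_rpow_of_pos (by positivity)] at h
    simpa only [mul_zero] using ENNReal.Tendsto.const_mul h (Or.inr (by simp : (2 : ℝ≥0∞) ≠ ⊤))
  have hdiam : ∀ N, ∀ p : ι N,
      Metric.ediam (Metric.closedBall (Φ.wordMap (List.ofFn p.2) z) (Ψ (List.ofFn p.2) : ℝ)) ≤
        2 * (Ψ (List.ofFn p.2) : ℝ≥0∞) := fun N p => by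
    rw [← Metric.closedEBall_coe]
    exact Metric.ediam_closedEBall_le
  have key := Measure.hausdorffMeasure_le_liminf_tsum s
    (Φ.limsupSet X (fun I => (Ψ I : ℝ)) z) (l := atTop) (ι := ι) r hr
    (fun N p => Metric.closedBall (Φ.wordMap (List.ofFn p.2) z) (Ψ (List.ofFn p.2) : ℝ))
    (Eventually.of_forall fun N p => ?_) (Eventually.of_forall fun N x hx => ?_)
  · refine le_antisymm (key.trans ?_) zero_le
    have hb : Tendsto (fun N => (2 : ℝ≥0∞) ^ s * ∑' n, (G (N + n) : ℝ≥0∞)) atTop (𝓝 0) := by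
      simpa using ENNReal.Tendsto.const_mul hGt
        (Or.inr (ENNReal.rpow_ne_top_of_nonneg hs.le (by simp : (2 : ℝ≥0∞) ≠ ⊤)))
    rw [← hb.liminf_eq]
    refine liminf_le_liminf (Eventually.of_forall fun N => ?_)
    rw [← ENNReal.tsum_mul_left, ENNReal.tsum_sigma']
    refine ENNReal.tsum_le_tsum fun n => ?_
    rw [tsum_fintype]
    simp only [G, ENNReal.ofNNReal_finsetSum, Finset.mul_sum]
    refine Finset.sum_le_sum fun I _ => ?_
    refine (ENNReal.rpow_le_rpow (hdiam N ⟨n, I⟩) hs.le).trans ?_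
    rw [ENNReal.mul_rpow_of_nonneg _ _ hs.le, ENNReal.coe_rpow_of_nonneg _ hs.le]
  · refine (hdiam N p).trans (mul_le_mul_right ?_ _)
    rw [one_div, ENNReal.le_rpow_inv_iff hs]
    exact hle N p
  · obtain ⟨I, hI, hxI⟩ := exists_length_gt_of_mem_limsupSet hx N
    obtain ⟨n, hn⟩ := Nat.exists_eq_add_of_lt hI
    obtain ⟨f, rfl⟩ := exists_ofFn_of_length hn
    exact Set.mem_iUnion_of_mem (⟨n, f⟩ : ι N) hxI

/-! ### Quasi-self-similarity, partition functions and the pressure -/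

/-- The diameter of the cylinder `X_I`. -/
def cylDiam (Φ : IteratedFunctionSystem d D) (X : Set (EuclideanSpace ℝ (Fin d)))
    (I : List D) : ℝ :=
  Metric.diam (Φ.cylinder X I)

/-- The geometric property shared by similarities and conformal maps on which everything after it
rests: up to the multiplicative constant `C`, each `φ_I` scales distances in `X` by
`Diam(X_I)`, and `|φ_I'|` is `Diam(X_I)` on `X`. In particular `X` is not a single point. -/
structure IsQuasiSelfSimilar (Φ : IteratedFunctionSystem d D)
    (X : Set (EuclideanSpace ℝ (Fin d))) (C : ℝ) : Prop where
  one_le : 1 ≤ C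
  diam_pos : ∀ I, 0 < Φ.cylDiam X I
  lower : ∀ I, ∀ x ∈ X, ∀ y ∈ X,
    Φ.cylDiam X I * dist x y ≤ C * dist (Φ.wordMap I x) (Φ.wordMap I y)
  upper : ∀ I, ∀ x ∈ X, ∀ y ∈ X,
    dist (Φ.wordMap I x) (Φ.wordMap I y) ≤ C * Φ.cylDiam X I * dist x y
  deriv_lower : ∀ I, ∀ x ∈ X, Φ.cylDiam X I ≤ C * ‖fderiv ℝ (Φ.wordMap I) x‖
  deriv_upper : ∀ I, ∀ x ∈ X, ‖fderiv ℝ (Φ.wordMap I) x‖ ≤ C * Φ.cylDiam X I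

/-- The partition function `∑_{I ∈ D^n} Diam(X_I)^s`. -/
def partitionSum [Fintype D] (Φ : IteratedFunctionSystem d D)
    (X : Set (EuclideanSpace ℝ (Fin d))) (s : ℝ) (n : ℕ) : ℝ :=
  wordSum n fun I => Φ.cylDiam X I ^ s

theorem IsAttractor.exists_uniform_cylDiam_le [Fintype D] {Φ : IteratedFunctionSystem d D}
    {X : Set (EuclideanSpace ℝ (Fin d))} (hX : Φ.IsAttractor X) :
    ∃ ρ : ℝ, 0 < ρ ∧ ρ < 1 ∧ ∀ I : List D,
      Φ.cylDiam X I ≤ ρ ^ I.length * Φ.cylDiam X [] := by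
  obtain ⟨ρ, h0, h1, hρ⟩ := hX.exists_uniform_ratio
  refine ⟨ρ, h0, h1, fun I => ?_⟩
  have hd : 0 ≤ Φ.cylDiam X [] := Metric.diam_nonneg
  refine Metric.diam_le_of_forall_dist_le (by positivity) ?_
  rintro _ ⟨x, hx, rfl⟩ _ ⟨y, hy, rfl⟩
  refine (hρ I x hx y hy).trans (mul_le_mul_of_nonneg_left ?_ (by positivity))
  exact hX.dist_le_diam_cylinder [] (by simpa using hx) (by simpa using hy)

/-- A sequence bounded away from `0` and `∞` has exponential growth rate `0`. -/
theorem tendsto_inv_mul_log_of_bounded {u : ℕ → ℝ} {c K : ℝ} (hc : 0 < c)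
    (h1 : ∀ n, c ≤ u n) (h2 : ∀ n, u n ≤ K) :
    Tendsto (fun n : ℕ => (1 / (n : ℝ)) * Real.log (u n)) atTop (𝓝 0) := by
  have h : ∀ a : ℝ, Tendsto (fun n : ℕ => (1 / (n : ℝ)) * a) atTop (𝓝 0) := fun a => by
    simpa using tendsto_one_div_atTop_nhds_zero_nat.mul_const a
  refine tendsto_of_tendsto_of_tendsto_of_le_of_le (h (Real.log c)) (h (Real.log K)) ?_ ?_
  · intro n
    exact mul_le_mul_of_nonneg_left (Real.log_le_log hc (h1 n)) (by positivity)
  · intro n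
    exact mul_le_mul_of_nonneg_left (Real.log_le_log (hc.trans_le (h1 n)) (h2 n)) (by positivity)

namespace IsQuasiSelfSimilar

variable {Φ : IteratedFunctionSystem d D} {X : Set (EuclideanSpace ℝ (Fin d))} {C : ℝ}

theorem pos (h : Φ.IsQuasiSelfSimilar X C) : 0 < C := zero_lt_one.trans_le h.one_le

theorem diam_append_le (h : Φ.IsQuasiSelfSimilar X C) (hX : Φ.IsAttractor X) (I J : List D) :
    Φ.cylDiam X (I ++ J) ≤ C * Φ.cylDiam X I * Φ.cylDiam X J := by
  have hC := h.pos
  have h1 := h.diam_pos I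
  have h2 := h.diam_pos J
  rw [cylDiam, cylinder_append]
  refine Metric.diam_le_of_forall_dist_le (by positivity) ?_
  rintro _ ⟨x, hx, rfl⟩ _ ⟨y, hy, rfl⟩
  refine (h.upper I x (hX.cylinder_subset J hx) y (hX.cylinder_subset J hy)).trans ?_
  exact mul_le_mul_of_nonneg_left (hX.dist_le_diam_cylinder J hx hy) (by positivity)

theorem diam_mul_le (h : Φ.IsQuasiSelfSimilar X C) (hX : Φ.IsAttractor X) (I J : List D) :
    Φ.cylDiam X I * Φ.cylDiam X J ≤ C * Φ.cylDiam X (I ++ J) := by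
  have hC := h.pos
  have h1 := h.diam_pos I
  have h2 := h.diam_pos (I ++ J)
  rw [mul_comm, ← le_div_iff₀ h1]
  refine Metric.diam_le_of_forall_dist_le (by positivity) fun x hx y hy => ?_
  rw [le_div_iff₀ h1, mul_comm]
  refine (h.lower I x (hX.cylinder_subset J hx) y (hX.cylinder_subset J hy)).trans ?_
  refine mul_le_mul_of_nonneg_left (hX.dist_le_diam_cylinder _ ?_ ?_) hC.le
  · rw [cylinder_append]; exact ⟨x, hx, rfl⟩
  · rw [cylinder_append]; exact ⟨y, hy, rfl⟩

theorem injOn_wordMap (h : Φ.IsQuasiSelfSimilar X C) (I : List D) :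
    Set.InjOn (Φ.wordMap I) X := by
  intro x hx y hy hxy
  have := h.lower I x hx y hy
  rw [hxy, dist_self, mul_zero] at this
  exact dist_le_zero.1 (nonpos_of_mul_nonpos_right this (h.diam_pos I))

theorem one_lt_card [Fintype D] (h : Φ.IsQuasiSelfSimilar X C) (hX : Φ.IsAttractor X) :
    1 < Fintype.card D := by
  have := hX.nonempty_alphabet
  by_contra hle
  have hsub : Subsingleton D := Fintype.card_le_one_iff_subsingleton.1 (not_lt.1 hle)
  obtain ⟨ρ, h0, h1, hρ⟩ := hX.exists_uniform_cylDiam_le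
  have i := Classical.arbitrary D
  have h2 : X = Φ.cylinder X [i] := by
    conv_lhs => rw [hX.2.2.2]
    rw [cylinder_cons, cylinder_nil]
    ext x
    simp only [Set.mem_iUnion]
    exact ⟨fun ⟨j, hj⟩ => Subsingleton.elim j i ▸ hj, fun hj => ⟨i, hj⟩⟩
  have h3 := hρ [i]
  rw [cylDiam, cylDiam, cylinder_nil, ← h2] at h3
  have h4 : 0 < Metric.diam X := by simpa [cylDiam] using h.diam_pos []
  simp only [List.length_singleton, pow_one] at h3
  nlinarith

section partitionSum

variable [Fintype D]

theorem partitionSum_pos (h : Φ.IsQuasiSelfSimilar X C) (hX : Φ.IsAttractor X) (s : ℝ) (n : ℕ) :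
    0 < Φ.partitionSum X s n := by
  have := hX.nonempty_alphabet
  exact Finset.sum_pos (fun I _ => Real.rpow_pos_of_pos (h.diam_pos _) _) Finset.univ_nonempty

theorem partitionSum_add_le (h : Φ.IsQuasiSelfSimilar X C) (hX : Φ.IsAttractor X) {s : ℝ}
    (hs : 0 ≤ s) (m n : ℕ) :
    Φ.partitionSum X s (m + n) ≤ C ^ s * Φ.partitionSum X s m * Φ.partitionSum X s n := by
  rw [partitionSum, wordSum_add, mul_assoc, partitionSum, ← wordSum_mul_right, ← wordSum_mul_left]
  refine wordSum_le fun I _ => ?_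
  rw [partitionSum, ← wordSum_mul_left, ← wordSum_mul_left]
  refine wordSum_le fun J _ => ?_
  rw [← mul_assoc, ← Real.mul_rpow h.pos.le (h.diam_pos I).le,
    ← Real.mul_rpow (mul_nonneg h.pos.le (h.diam_pos I).le) (h.diam_pos J).le]
  exact Real.rpow_le_rpow (h.diam_pos _).le (h.diam_append_le hX I J) hs

theorem partitionSum_mul_le (h : Φ.IsQuasiSelfSimilar X C) (hX : Φ.IsAttractor X) {s : ℝ}
    (hs : 0 ≤ s) (m n : ℕ) :
    Φ.partitionSum X s m * Φ.partitionSum X s n ≤ C ^ s * Φ.partitionSum X s (m + n) := by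
  rw [show Φ.partitionSum X s (m + n) = _ from wordSum_add m n _, partitionSum,
    ← wordSum_mul_right, ← wordSum_mul_left]
  refine wordSum_le fun I _ => ?_
  rw [partitionSum, ← wordSum_mul_left, ← wordSum_mul_left]
  refine wordSum_le fun J _ => ?_
  rw [← Real.mul_rpow h.pos.le (h.diam_pos _).le,
    ← Real.mul_rpow (h.diam_pos I).le (h.diam_pos J).le]
  exact Real.rpow_le_rpow (mul_nonneg (h.diam_pos I).le (h.diam_pos J).le)
    (h.diam_mul_le hX I J) hs

theorem continuous_partitionSum (h : Φ.IsQuasiSelfSimilar X C) (n : ℕ) :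
    Continuous fun s => Φ.partitionSum X s n := by
  unfold partitionSum wordSum
  exact continuous_finsetSum _ fun I _ =>
    continuous_const.rpow continuous_id fun _ => Or.inl (h.diam_pos _).ne'

/-- If one term of the normalised partition function is small, then so are all its multiples. -/
theorem partitionSum_mul_pow_le (h : Φ.IsQuasiSelfSimilar X C) (hX : Φ.IsAttractor X) {s : ℝ}
    (hs : 0 ≤ s) (n k : ℕ) :
    C ^ s * Φ.partitionSum X s (n * (k + 1)) ≤ (C ^ s * Φ.partitionSum X s n) ^ (k + 1) := by
  have hC := Real.rpow_pos_of_pos h.pos s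
  have hZ := h.partitionSum_pos hX s n
  induction k with
  | zero => simp
  | succ k ih =>
    rw [Nat.mul_add_one, pow_succ]
    calc C ^ s * Φ.partitionSum X s (n * (k + 1) + n)
        ≤ C ^ s * (C ^ s * Φ.partitionSum X s (n * (k + 1)) * Φ.partitionSum X s n) :=
          mul_le_mul_of_nonneg_left (h.partitionSum_add_le hX hs _ _) hC.le
      _ = (C ^ s * Φ.partitionSum X s (n * (k + 1))) * (C ^ s * Φ.partitionSum X s n) := by ring
      _ ≤ _ := mul_le_mul_of_nonneg_right ih (by positivity)

theorem pow_le_partitionSum_mul (h : Φ.IsQuasiSelfSimilar X C) (hX : Φ.IsAttractor X) {s : ℝ}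
    (hs : 0 ≤ s) (n k : ℕ) :
    (Φ.partitionSum X s n / C ^ s) ^ (k + 1) ≤ Φ.partitionSum X s (n * (k + 1)) / C ^ s := by
  have hC := Real.rpow_pos_of_pos h.pos s
  have hZ := h.partitionSum_pos hX s n
  induction k with
  | zero => simp
  | succ k ih =>
    rw [Nat.mul_add_one, pow_succ]
    calc (Φ.partitionSum X s n / C ^ s) ^ (k + 1) * (Φ.partitionSum X s n / C ^ s)
        ≤ (Φ.partitionSum X s (n * (k + 1)) / C ^ s) * (Φ.partitionSum X s n / C ^ s) :=
          mul_le_mul_of_nonneg_right ih (by positivity)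
      _ = (Φ.partitionSum X s (n * (k + 1)) * Φ.partitionSum X s n) / C ^ s / C ^ s := by
          field_simp
      _ ≤ (C ^ s * Φ.partitionSum X s (n * (k + 1) + n)) / C ^ s / C ^ s := by
          refine div_le_div_of_nonneg_right (div_le_div_of_nonneg_right ?_ hC.le) hC.le
          exact h.partitionSum_mul_le hX hs _ _
      _ = _ := by field_simp

/-- There is an exponent at which the partition functions neither grow nor decay. The exponents of
exponential decay and those of exponential growth form disjoint non-empty open subsets of `[0, ∞)`,
so by connectedness they do not cover it. -/
theorem exists_exponent (h : Φ.IsQuasiSelfSimilar X C) (hX : Φ.IsAttractor X) :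
    ∃ s : ℝ, 0 < s ∧ ∃ K : ℝ, 1 ≤ K ∧
      ∀ n, Φ.partitionSum X s n ≤ K ∧ 1 ≤ K * Φ.partitionSum X s n := by
  have hcard := h.one_lt_card hX
  have hcC : Continuous fun s : ℝ => C ^ s :=
    continuous_const.rpow continuous_id fun _ => Or.inl h.pos.ne'
  let S : Set ℝ := ⋃ n : ℕ, {s | C ^ s * Φ.partitionSum X s (n + 1) < 1}
  let T : Set ℝ := ⋃ n : ℕ, {s | C ^ s < Φ.partitionSum X s (n + 1)}
  have hS : IsOpen S := isOpen_iUnion fun n =>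
    isOpen_lt (hcC.mul (h.continuous_partitionSum _)) continuous_const
  have hT : IsOpen T := isOpen_iUnion fun n =>
    isOpen_lt hcC (h.continuous_partitionSum _)
  have hT0 : (0 : ℝ) ∈ T := by
    refine Set.mem_iUnion_of_mem 0 ?_
    simp only [Set.mem_ofPred_eq, Real.rpow_zero, partitionSum, wordSum_const_one, zero_add,
      pow_one]
    exact_mod_cast hcard
  have hSne : (Set.Ici (0 : ℝ) ∩ S).Nonempty := by
    obtain ⟨ρ, h0, h1, hρ⟩ := hX.exists_uniform_cylDiam_le
    have hΔ := h.diam_pos []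
    have hC := h.pos
    have ht : Tendsto (fun n : ℕ => C * (ρ ^ (n + 1) * Φ.cylDiam X [])) atTop (𝓝 0) := by
      simpa using (((tendsto_pow_atTop_nhds_zero_of_lt_one h0.le h1).comp
        (tendsto_add_atTop_nat 1)).mul_const (Φ.cylDiam X [])).const_mul C
    obtain ⟨n, hn⟩ := (ht.eventually_lt_const zero_lt_one).exists
    set q := C * (ρ ^ (n + 1) * Φ.cylDiam X []) with hq
    have hq0 : 0 < q := by positivity
    have ht2 : Tendsto (fun s : ℝ => q ^ s * (Fintype.card D : ℝ) ^ (n + 1)) atTop (𝓝 0) := by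
      simpa using (tendsto_rpow_atTop_of_base_lt_one q (by linarith) hn).mul_const
        ((Fintype.card D : ℝ) ^ (n + 1))
    obtain ⟨s, hs1, hs0⟩ := ((ht2.eventually_lt_const zero_lt_one).and
      (eventually_ge_atTop 0)).exists
    refine ⟨s, hs0, Set.mem_iUnion_of_mem n (lt_of_le_of_lt ?_ hs1)⟩
    rw [← wordSum_const_one, ← wordSum_mul_left, partitionSum, ← wordSum_mul_left]
    refine wordSum_le fun I hI => ?_
    rw [mul_one, ← Real.mul_rpow hC.le (h.diam_pos I).le]
    refine Real.rpow_le_rpow (mul_nonneg hC.le (h.diam_pos I).le) ?_ hs0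
    have := hρ I
    rw [hI] at this
    exact mul_le_mul_of_nonneg_left this hC.le
  have hdisj : ∀ s : ℝ, 0 ≤ s → s ∈ S → s ∉ T := by
    intro s hs hsS hsT
    obtain ⟨m, hm⟩ := Set.mem_iUnion.1 hsS
    obtain ⟨n, hn⟩ := Set.mem_iUnion.1 hsT
    simp only [Set.mem_ofPred_eq] at hm hn
    have hC1 : 1 ≤ C ^ s := Real.one_le_rpow h.one_le hs
    have e1 := h.partitionSum_mul_pow_le hX hs (m + 1) n
    have e2 := h.pow_le_partitionSum_mul hX hs (n + 1) m
    have e3 : (C ^ s * Φ.partitionSum X s (m + 1)) ^ (n + 1) ≤ 1 :=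
      pow_le_one₀ (mul_nonneg (by linarith) (h.partitionSum_pos hX s _).le) hm.le
    have e4 : 1 < (Φ.partitionSum X s (n + 1) / C ^ s) ^ (m + 1) :=
      one_lt_pow₀ ((one_lt_div (by linarith)).2 hn) (by simp)
    rw [mul_comm (n + 1) (m + 1)] at e2
    have e5 := (one_lt_div (by linarith)).1 (e4.trans_le e2)
    nlinarith [h.partitionSum_pos hX s ((m + 1) * (n + 1))]
  have hex : ∃ s, 0 ≤ s ∧ s ∉ S ∧ s ∉ T := by
    by_contra! H
    obtain ⟨s, hs, hsS, hsT⟩ := isPreconnected_Ici S T hS hT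
      (fun s hs => or_iff_not_imp_left.2 (H s hs)) hSne ⟨0, Set.self_mem_Ici, hT0⟩
    exact hdisj s hs hsS hsT
  obtain ⟨s, hs, hsS, hsT⟩ := hex
  simp only [S, T, Set.mem_iUnion, Set.mem_ofPred_eq, not_exists, not_lt] at hsS hsT
  have hs0 : 0 < s := lt_of_le_of_ne hs fun h0 => by
    rw [← h0] at hsT
    simp only [T, Set.mem_iUnion, Set.mem_ofPred_eq] at hT0
    obtain ⟨n, hn⟩ := hT0
    exact absurd (hsT n) (not_le.2 hn)
  have hZ0 := h.partitionSum_pos hX s 0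
  refine ⟨s, hs0, max (C ^ s) (max (Φ.partitionSum X s 0) (Φ.partitionSum X s 0)⁻¹),
    le_max_of_le_left (Real.one_le_rpow h.one_le hs), fun n => ?_⟩
  cases n with
  | zero =>
    refine ⟨le_max_of_le_right (le_max_left _ _), ?_⟩
    rw [← inv_mul_cancel₀ hZ0.ne']
    exact mul_le_mul_of_nonneg_right (le_max_of_le_right (le_max_right _ _)) hZ0.le
  | succ n =>
    refine ⟨le_max_of_le_left (hsT n), (hsS n).trans ?_⟩
    exact mul_le_mul_of_nonneg_right (le_max_left _ _) (h.partitionSum_pos hX s _).le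

theorem derivSum_le (h : Φ.IsQuasiSelfSimilar X C) {s : ℝ} (hs : 0 ≤ s) (n : ℕ)
    {x : EuclideanSpace ℝ (Fin d)} (hx : x ∈ X) :
    Φ.derivSum s n x ≤ C ^ s * Φ.partitionSum X s n := by
  rw [partitionSum, ← wordSum_mul_left]
  refine Finset.sum_le_sum fun I _ => ?_
  beta_reduce
  rw [← Real.mul_rpow h.pos.le (h.diam_pos _).le]
  exact Real.rpow_le_rpow (norm_nonneg _) (h.deriv_upper _ x hx) hs

theorem partitionSum_le_derivSum (h : Φ.IsQuasiSelfSimilar X C) {s : ℝ} (hs : 0 ≤ s) (n : ℕ)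
    {x : EuclideanSpace ℝ (Fin d)} (hx : x ∈ X) :
    Φ.partitionSum X s n ≤ C ^ s * Φ.derivSum s n x := by
  rw [derivSum, Finset.mul_sum]
  refine Finset.sum_le_sum fun I _ => ?_
  rw [← Real.mul_rpow h.pos.le (norm_nonneg _)]
  exact Real.rpow_le_rpow (h.diam_pos _).le (h.deriv_lower _ x hx) hs

/-- The exponent of bounded partition functions is the similarity dimension. Below it the pressure
is positive, since `Diam(X_I)` decays exponentially in `|I|`. -/
theorem similarityDim_eq (h : Φ.IsQuasiSelfSimilar X C) (hX : Φ.IsAttractor X) {s K : ℝ}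
    (hs : 0 < s) (hK : 1 ≤ K)
    (hZ : ∀ n, Φ.partitionSum X s n ≤ K ∧ 1 ≤ K * Φ.partitionSum X s n) :
    Φ.similarityDim X = s := by
  have : Nonempty X := hX.1.to_subtype
  have hC := h.pos
  have hbdd : ∀ (t : ℝ), 0 ≤ t → ∀ n, BddAbove (Set.range fun x : X => Φ.derivSum t n x) :=
    fun t ht n => ⟨_, by rintro _ ⟨x, rfl⟩; exact h.derivSum_le ht n x.2⟩
  have hbddb : ∀ (t : ℝ) n, BddBelow (Set.range fun x : X => Φ.derivSum t n x) :=
    fun t n => ⟨0, by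
      rintro _ ⟨x, rfl⟩
      exact Finset.sum_nonneg fun _ _ => Real.rpow_nonneg (norm_nonneg _) _⟩
  have hCs := Real.rpow_pos_of_pos hC s
  have hlow : ∀ n, ∀ x : X, (C ^ s * K)⁻¹ ≤ Φ.derivSum s n x := fun n x => by
    have h1 := h.partitionSum_le_derivSum hs.le n x.2
    have h2 := (hZ n).2
    rw [inv_le_iff_one_le_mul₀ (by positivity)]
    nlinarith
  have hup : ∀ n, ∀ x : X, Φ.derivSum s n x ≤ C ^ s * K := fun n x =>
    (h.derivSum_le hs.le n x.2).trans (mul_le_mul_of_nonneg_left (hZ n).1 hCs.le)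
  have hpos : 0 < (C ^ s * K)⁻¹ := by positivity
  let x₀ : X := Classical.arbitrary X
  refine IsLeast.csInf_eq ⟨⟨hs.le, ?_, ?_⟩, ?_⟩
  · exact tendsto_inv_mul_log_of_bounded hpos (fun n => le_ciInf (hlow n))
      fun n => (ciInf_le (hbddb s n) x₀).trans (hup n x₀)
  · exact tendsto_inv_mul_log_of_bounded hpos
      (fun n => (hlow n x₀).trans (le_ciSup (hbdd s hs.le n) x₀)) fun n => ciSup_le (hup n)
  · rintro t ⟨ht0, ht, -⟩
    by_contra! hts
    obtain ⟨ρ, h0, h1, hρ⟩ := hX.exists_uniform_cylDiam_le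
    have hΔ := h.diam_pos []
    have hCt := Real.rpow_pos_of_pos hC t
    set c := (C ^ t * K * Φ.cylDiam X [] ^ (s - t))⁻¹ with hc
    have hcpos : 0 < c := by positivity
    have hle : ∀ n, c * ((ρ ^ (s - t))⁻¹) ^ n ≤ ⨅ x : X, Φ.derivSum t n x := by
      refine fun n => le_ciInf fun x => ?_
      have e1 := h.partitionSum_le_derivSum ht0 n x.2
      have e2 := (hZ n).2
      have e3 : Φ.partitionSum X s n ≤
          ((ρ ^ (s - t)) ^ n * Φ.cylDiam X [] ^ (s - t)) * Φ.partitionSum X t n := by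
        rw [partitionSum, partitionSum, ← wordSum_mul_left]
        refine wordSum_le fun I hI => ?_
        have : Φ.cylDiam X I ^ s = Φ.cylDiam X I ^ (s - t) * Φ.cylDiam X I ^ t := by
          rw [← Real.rpow_add (h.diam_pos I), sub_add_cancel]
        rw [this]
        refine mul_le_mul_of_nonneg_right ?_ (Real.rpow_nonneg (h.diam_pos I).le _)
        have e4 := hρ I
        rw [hI] at e4
        refine (Real.rpow_le_rpow (h.diam_pos I).le e4 (by linarith)).trans_eq ?_
        rw [Real.mul_rpow (by positivity) hΔ.le, ← Real.rpow_natCast, ← Real.rpow_mul h0.le,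
          ← Real.rpow_natCast, ← Real.rpow_mul h0.le, mul_comm (n : ℝ)]
      rw [hc, inv_pow, ← mul_inv, inv_le_iff_one_le_mul₀ (by positivity)]
      have e5 : 0 ≤ (ρ ^ (s - t)) ^ n * Φ.cylDiam X [] ^ (s - t) := by positivity
      calc (1 : ℝ) ≤ K * Φ.partitionSum X s n := e2
        _ ≤ K * (((ρ ^ (s - t)) ^ n * Φ.cylDiam X [] ^ (s - t)) *
              (C ^ t * Φ.derivSum t n x)) := by
            refine mul_le_mul_of_nonneg_left (e3.trans ?_) (by linarith)
            exact mul_le_mul_of_nonneg_left e1 e5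
        _ = _ := by ring
    have hlogpos : 0 < Real.log ((ρ ^ (s - t))⁻¹) := by
      refine Real.log_pos ((one_lt_inv₀ (by positivity)).2 ?_)
      exact Real.rpow_lt_one h0.le h1 (by linarith)
    have hlim : Tendsto (fun n : ℕ => (1 / (n : ℝ)) * Real.log c + Real.log ((ρ ^ (s - t))⁻¹))
        atTop (𝓝 (Real.log ((ρ ^ (s - t))⁻¹))) := by
      simpa using (tendsto_one_div_atTop_nhds_zero_nat.mul_const (Real.log c)).add_const
        (Real.log ((ρ ^ (s - t))⁻¹))
    refine absurd (le_of_tendsto_of_tendsto hlim ht ?_) (not_le.2 hlogpos)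
    filter_upwards [eventually_gt_atTop 0] with n hn
    have hn' : (0 : ℝ) < n := by exact_mod_cast hn
    have e6 := Real.log_le_log (by positivity) (hle n)
    rw [Real.log_mul hcpos.ne' (by positivity), Real.log_pow] at e6
    calc _ = (1 / (n : ℝ)) * (Real.log c + n * Real.log ((ρ ^ (s - t))⁻¹)) := by
            field_simp
      _ ≤ _ := mul_le_mul_of_nonneg_left e6 (by positivity)

end partitionSum

end IsQuasiSelfSimilar

/-! ### The Hausdorff measure of the attractor is positive and finite -/

/-- The consequence of the separation conditions used for the mass distribution principle: up to
the constants `M` and `B`, a set `U` of diameter at most `u` is met only by extensions of at most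
`M` words whose cylinders have diameter at most `B * u`. Only extensions that are long enough in
terms of `U` are considered. -/
def HasFiniteClustering (Φ : IteratedFunctionSystem d D) (X : Set (EuclideanSpace ℝ (Fin d)))
    (M : ℕ) (B : ℝ) : Prop :=
  ∀ (U : Set (EuclideanSpace ℝ (Fin d))) (u : ℝ), 0 < u →
    (∀ x ∈ U, ∀ y ∈ U, dist x y ≤ u) →
    ∃ F : Finset (List D), F.card ≤ M ∧ (∀ I ∈ F, Φ.cylDiam X I ≤ B * u) ∧
      ∃ n₀ : ℕ, ∀ J : List D, n₀ ≤ J.length → (Φ.cylinder X J ∩ U).Nonempty →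
        ∃ I ∈ F, I <+: J

theorem cylDiam_nonneg (Φ : IteratedFunctionSystem d D) (X : Set (EuclideanSpace ℝ (Fin d)))
    (I : List D) : 0 ≤ Φ.cylDiam X I :=
  Metric.diam_nonneg

theorem IsAttractor.ediam_cylinder {Φ : IteratedFunctionSystem d D}
    {X : Set (EuclideanSpace ℝ (Fin d))} (hX : Φ.IsAttractor X) (I : List D) :
    Metric.ediam (Φ.cylinder X I) = ENNReal.ofReal (Φ.cylDiam X I) :=
  (ENNReal.ofReal_toReal (hX.isCompact_cylinder I).isBounded.ediam_ne_top).symm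

theorem IsAttractor.hausdorffMeasure_ne_top [Fintype D] {Φ : IteratedFunctionSystem d D}
    {X : Set (EuclideanSpace ℝ (Fin d))} (hX : Φ.IsAttractor X) {s K : ℝ} (hs : 0 ≤ s)
    (hZ : ∀ n, Φ.partitionSum X s n ≤ K) : μH[s] X ≠ ⊤ := by
  obtain ⟨ρ, h0, h1, hρ⟩ := hX.exists_uniform_cylDiam_le
  have hr : Tendsto (fun n : ℕ => ENNReal.ofReal (ρ ^ n * Φ.cylDiam X [])) atTop (𝓝 0) := by
    rw [← ENNReal.ofReal_zero]
    refine ENNReal.tendsto_ofReal ?_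
    simpa using (tendsto_pow_atTop_nhds_zero_of_lt_one h0.le h1).mul_const (Φ.cylDiam X [])
  have key := Measure.hausdorffMeasure_le_liminf_sum s X (l := atTop)
    (ι := fun n : ℕ => Fin n → D) _ hr
    (fun n I => Φ.cylinder X (List.ofFn I))
    (Eventually.of_forall fun n I => by
      rw [hX.ediam_cylinder]
      refine ENNReal.ofReal_le_ofReal ?_
      simpa using hρ (List.ofFn I))
    (Eventually.of_forall fun n => (hX.eq_iUnion_cylinder n).subset)
  refine ne_top_of_le_ne_top (ENNReal.ofReal_ne_top (r := K)) (key.trans ?_)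
  refine (liminf_le_liminf (Eventually.of_forall fun n => ?_)).trans
    (liminf_const (ENNReal.ofReal K) (f := atTop (α := ℕ))).le
  simp only [hX.ediam_cylinder]
  refine le_trans (le_of_eq ?_) (ENNReal.ofReal_le_ofReal (hZ n))
  rw [partitionSum, wordSum, ENNReal.ofReal_sum_of_nonneg
    fun I _ => Real.rpow_nonneg (cylDiam_nonneg _ _ _) _]
  exact Finset.sum_congr rfl fun I _ => ENNReal.ofReal_rpow_of_nonneg (cylDiam_nonneg _ _ _) hs

namespace IsQuasiSelfSimilar

variable [Fintype D] {Φ : IteratedFunctionSystem d D} {X : Set (EuclideanSpace ℝ (Fin d))} {C : ℝ}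

open Classical in
/-- The combinatorial core of the mass distribution principle: the `s`-th powers of the diameters
in a finite cover have a sum bounded below. Each covering set is replaced by the cylinders of its
cluster, and the `s`-sum over the words extending `I` is comparable with `Diam(X_I)^s`. -/
theorem exists_le_sum_of_cover (h : Φ.IsQuasiSelfSimilar X C) (hX : Φ.IsAttractor X) {s K : ℝ}
    (hs : 0 ≤ s) (hK : 1 ≤ K)
    (hZ : ∀ n, Φ.partitionSum X s n ≤ K ∧ 1 ≤ K * Φ.partitionSum X s n)
    {M : ℕ} {B : ℝ} (hB : 0 < B) (hsep : Φ.HasFiniteClustering X M B) :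
    ∃ A : ℝ, 0 < A ∧ ∀ (T : Finset ℕ) (U : ℕ → Set (EuclideanSpace ℝ (Fin d))) (u : ℕ → ℝ),
      (∀ k, 0 < u k) → (∀ k, ∀ x ∈ U k, ∀ y ∈ U k, dist x y ≤ u k) → (X ⊆ ⋃ k ∈ T, U k) →
      1 ≤ A * ∑ k ∈ T, u k ^ s := by
  have hC := h.pos
  have hK0 : 0 < K := by linarith
  refine ⟨K * ((M + 1) * (C ^ s * B ^ s * K)), by positivity, fun T U u hu hU hcov => ?_⟩
  choose F hFM hFu n₀ hF using fun k => hsep (U k) (u k) (hu k) (hU k)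
  set N := T.sup fun k => n₀ k + (F k).sup List.length with hN
  have hNn : ∀ k ∈ T, n₀ k ≤ N := fun k hk =>
    (Nat.le_add_right _ _).trans (Finset.le_sup (f := fun k => n₀ k + (F k).sup List.length) hk)
  have hNI : ∀ k ∈ T, ∀ I ∈ F k, I.length ≤ N := fun k hk I hI =>
    ((Finset.le_sup (f := List.length) hI).trans (Nat.le_add_left _ _)).trans
      (Finset.le_sup (f := fun k => n₀ k + (F k).sup List.length) hk)
  have hle : Φ.partitionSum X s N ≤
      ∑ k ∈ T, ∑ I ∈ F k, wordSum N fun J => if I <+: J then Φ.cylDiam X J ^ s else 0 := by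
    have hswap : ∑ k ∈ T, ∑ I ∈ F k, wordSum N (fun J =>
        if I <+: J then Φ.cylDiam X J ^ s else 0) = wordSum N fun J =>
          ∑ k ∈ T, ∑ I ∈ F k, if I <+: J then Φ.cylDiam X J ^ s else 0 := by
      unfold wordSum
      rw [Finset.sum_comm]
      refine Finset.sum_congr rfl fun k _ => ?_
      rw [Finset.sum_comm]
    rw [hswap]
    refine wordSum_le fun J hJ => ?_
    have hnn : ∀ I : List D, 0 ≤ if I <+: J then Φ.cylDiam X J ^ s else 0 := fun I => by
      split_ifs
      exacts [Real.rpow_nonneg Metric.diam_nonneg _, le_rfl]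
    obtain ⟨x, hx⟩ := hX.cylinder_nonempty J
    obtain ⟨k, hk, hxk⟩ := Set.mem_iUnion₂.1 (hcov (hX.cylinder_subset J hx))
    obtain ⟨I, hI, hIJ⟩ := hF k J (hJ ▸ hNn k hk) ⟨x, hx, hxk⟩
    calc Φ.cylDiam X J ^ s = if I <+: J then Φ.cylDiam X J ^ s else 0 := by rw [if_pos hIJ]
      _ ≤ ∑ I ∈ F k, if I <+: J then Φ.cylDiam X J ^ s else 0 :=
          Finset.single_le_sum (f := fun I => if I <+: J then Φ.cylDiam X J ^ s else 0)
            (fun I _ => hnn I) hI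
      _ ≤ _ := Finset.single_le_sum
          (f := fun k => ∑ I ∈ F k, if I <+: J then Φ.cylDiam X J ^ s else 0)
          (fun k _ => Finset.sum_nonneg fun I _ => hnn I) hk
  have hone : ∀ k ∈ T, ∀ I ∈ F k,
      (wordSum N fun J => if I <+: J then Φ.cylDiam X J ^ s else 0) ≤
        C ^ s * B ^ s * K * u k ^ s := by
    intro k hk I hI
    rw [wordSum_eq_of_prefix (hNI k hk I hI) fun J _ hJ => if_neg hJ]
    calc (wordSum (N - I.length) fun P =>
          if I <+: I ++ P then Φ.cylDiam X (I ++ P) ^ s else 0)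
        ≤ wordSum (N - I.length) fun P => C ^ s * Φ.cylDiam X I ^ s * Φ.cylDiam X P ^ s := by
          refine wordSum_le fun P _ => ?_
          rw [if_pos (List.prefix_append _ _), ← Real.mul_rpow hC.le (h.diam_pos _).le,
            ← Real.mul_rpow (mul_nonneg hC.le (h.diam_pos _).le) (h.diam_pos _).le]
          exact Real.rpow_le_rpow (h.diam_pos _).le (h.diam_append_le hX I P) hs
      _ = C ^ s * Φ.cylDiam X I ^ s * Φ.partitionSum X s (N - I.length) := by
          rw [wordSum_mul_left, partitionSum]
      _ ≤ C ^ s * (B ^ s * u k ^ s) * K := by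
          refine mul_le_mul (mul_le_mul_of_nonneg_left ?_ (by positivity)) (hZ _).1
            (h.partitionSum_pos hX s _).le ?_
          · rw [← Real.mul_rpow hB.le (hu k).le]
            exact Real.rpow_le_rpow (h.diam_pos _).le (hFu k I hI) hs
          · have := hu k
            positivity
      _ = _ := by ring
  calc (1 : ℝ) ≤ K * Φ.partitionSum X s N := (hZ N).2
    _ ≤ K * ∑ k ∈ T, (M + 1) * (C ^ s * B ^ s * K * u k ^ s) := by
        refine mul_le_mul_of_nonneg_left (hle.trans (Finset.sum_le_sum fun k hk => ?_)) hK0.le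
        refine (Finset.sum_le_sum (hone k hk)).trans ?_
        rw [Finset.sum_const, nsmul_eq_mul]
        have := hu k
        refine mul_le_mul_of_nonneg_right ?_ (by positivity)
        have : ((F k).card : ℝ) ≤ M := by exact_mod_cast hFM k
        linarith
    _ = _ := by
        rw [Finset.mul_sum, Finset.mul_sum]
        exact Finset.sum_congr rfl fun k _ => by ring

theorem hausdorffMeasure_ne_zero (h : Φ.IsQuasiSelfSimilar X C) (hX : Φ.IsAttractor X) {s K : ℝ}
    (hs : 0 < s) (hK : 1 ≤ K)
    (hZ : ∀ n, Φ.partitionSum X s n ≤ K ∧ 1 ≤ K * Φ.partitionSum X s n)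
    {M : ℕ} {B : ℝ} (hB : 0 < B) (hsep : Φ.HasFiniteClustering X M B) : μH[s] X ≠ 0 := by
  obtain ⟨A, hA, hcover⟩ := h.exists_le_sum_of_cover hX hs.le hK hZ hB hsep
  intro h0
  set ε : ℝ := 1 / (4 * A) with hε
  have hεpos : 0 < ε := by positivity
  rw [Measure.hausdorffMeasure_apply] at h0
  have h1 : (⨅ (t : ℕ → Set (EuclideanSpace ℝ (Fin d))) (_ : X ⊆ ⋃ n, t n)
      (_ : ∀ n, Metric.ediam (t n) ≤ 1), ∑' n, ⨆ _ : (t n).Nonempty, Metric.ediam (t n) ^ s) <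
        ENNReal.ofReal ε := by
    refine lt_of_le_of_lt ?_ (ENNReal.ofReal_pos.2 hεpos)
    rw [← h0]
    exact le_iSup₂ (f := fun (r : ℝ≥0∞) (_ : 0 < r) =>
      ⨅ (t : ℕ → Set (EuclideanSpace ℝ (Fin d))) (_ : X ⊆ ⋃ n, t n)
      (_ : ∀ n, Metric.ediam (t n) ≤ r), ∑' n, ⨆ _ : (t n).Nonempty, Metric.ediam (t n) ^ s)
      1 one_pos
  simp only [iInf_lt_iff] at h1
  obtain ⟨t, ht, hd, hsum⟩ := h1
  have htop : ∀ n, Metric.ediam (t n) ≠ ⊤ := fun n => ne_top_of_le_ne_top ENNReal.one_ne_top (hd n)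
  set v : ℕ → ℝ := fun n => Metric.diam (t n) with hv
  have hv0 : ∀ n, 0 ≤ v n := fun n => Metric.diam_nonneg
  have hvle : ∀ n, ENNReal.ofReal (v n ^ s) ≤ ⨆ _ : (t n).Nonempty, Metric.ediam (t n) ^ s := by
    intro n
    rcases (t n).eq_empty_or_nonempty with he | hne
    · simp [hv, he, hs.ne']
    · rw [iSup_pos hne, ← ENNReal.ofReal_rpow_of_nonneg (hv0 n) hs.le,
        show ENNReal.ofReal (v n) = Metric.ediam (t n) from ENNReal.ofReal_toReal (htop n)]
  have hT : ∀ T : Finset ℕ, ∑ n ∈ T, v n ^ s < ε := by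
    intro T
    rw [← ENNReal.ofReal_lt_ofReal_iff hεpos,
      ENNReal.ofReal_sum_of_nonneg fun n _ => Real.rpow_nonneg (hv0 n) _]
    refine lt_of_le_of_lt ((Finset.sum_le_sum fun n _ => hvle n).trans ?_) hsum
    exact ENNReal.sum_le_tsum T
  -- the covering sets are enlarged to open sets at a cost of at most `ε` in total
  have hδ : ∀ n, ∃ δ : ℝ, 0 < δ ∧ (v n + 2 * δ) ^ s < v n ^ s + ε * (1 / 2) ^ (n + 1) := by
    intro n
    have hc : Continuous fun δ : ℝ => (v n + 2 * δ) ^ s :=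
      (continuous_const.add (continuous_const.mul continuous_id)).rpow_const
        fun _ => Or.inr hs.le
    have h2 := (hc.tendsto 0).eventually_lt_const
      (show (v n + 2 * 0) ^ s < v n ^ s + ε * (1 / 2) ^ (n + 1) by
        rw [mul_zero, add_zero]
        have : 0 < ε * (1 / 2) ^ (n + 1) := by positivity
        linarith)
    obtain ⟨δ, h3, h4⟩ := ((h2.filter_mono nhdsWithin_le_nhds).and
      (self_mem_nhdsWithin (a := (0 : ℝ)) (s := Set.Ioi 0))).exists
    exact ⟨δ, h4, h3⟩
  choose δ hδ0 hδ using hδ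
  have hcov : X ⊆ ⋃ n, Metric.thickening (δ n) (t n) :=
    ht.trans (Set.iUnion_mono fun n => Metric.self_subset_thickening (hδ0 n) _)
  obtain ⟨T, hTcov⟩ := hX.2.1.elim_finite_subcover _ (fun n => Metric.isOpen_thickening) hcov
  have hfin := hcover T (fun n => Metric.thickening (δ n) (t n)) (fun n => v n + 2 * δ n)
    (fun n => by have := hv0 n; have := hδ0 n; linarith) (fun n x hx y hy => by
      obtain ⟨a, ha, hxa⟩ := Metric.mem_thickening_iff.1 hx
      obtain ⟨b, hb, hyb⟩ := Metric.mem_thickening_iff.1 hy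
      have hab : dist a b ≤ v n := Metric.dist_le_diam_of_mem' (htop n) ha hb
      have := dist_triangle4 x a b y
      rw [dist_comm b y] at this
      linarith) hTcov
  have hgeo : ∑ n ∈ T, ε * (1 / 2 : ℝ) ^ (n + 1) ≤ ε := by
    have h5 : HasSum (fun n : ℕ => ε * (1 / 2 : ℝ) ^ (n + 1)) ε := by
      have := (hasSum_geometric_two.mul_left (ε / 2))
      convert! this using 1
      · ext n; rw [pow_succ]; ring
      · ring
    exact sum_le_hasSum T (fun n _ => by positivity) h5
  have hlt : ∑ n ∈ T, (v n + 2 * δ n) ^ s ≤ ε + ε := by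
    refine (Finset.sum_le_sum fun n _ => (hδ n).le).trans ?_
    rw [Finset.sum_add_distrib]
    exact add_le_add (hT T).le hgeo
  have h6 : A * ∑ n ∈ T, (v n + 2 * δ n) ^ s ≤ A * (ε + ε) :=
    mul_le_mul_of_nonneg_left hlt hA.le
  have h7 : A * (ε + ε) = 1 / 2 := by rw [hε]; field_simp; norm_num
  linarith

end IsQuasiSelfSimilar

/-! ### Shrinking targets around a coded point -/

/-- A second moment inequality for finitely many sets. With `F` the number of the sets that contain
a given point, it is the integral of `F ≤ (t / 2) 1_{F > 0} + F ^ 2 / (2 t)`. -/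
theorem sum_measureReal_le_second_moment {α ι : Type*} [MeasurableSpace α] (ν : Measure α)
    [IsFiniteMeasure ν] (T : Finset ι) (A : ι → Set α) (hA : ∀ i, MeasurableSet (A i))
    {t : ℝ} (ht : 0 < t) :
    ∑ i ∈ T, ν.real (A i) ≤ t / 2 * ν.real (⋃ i ∈ T, A i) +
      1 / (2 * t) * ∑ i ∈ T, ∑ j ∈ T, ν.real (A i ∩ A j) := by
  have hint : ∀ B : Set α, MeasurableSet B → Integrable (B.indicator (1 : α → ℝ)) ν :=
    fun B hB => (integrable_const (1 : ℝ)).indicator hB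
  have hU : MeasurableSet (⋃ i ∈ T, A i) := T.measurableSet_biUnion fun i _ => hA i
  have e1 : ∑ i ∈ T, ν.real (A i) = ∫ x, ∑ i ∈ T, (A i).indicator (1 : α → ℝ) x ∂ν := by
    rw [integral_finsetSum _ fun i _ => hint _ (hA i)]
    exact Finset.sum_congr rfl fun i _ => (integral_indicator_one (hA i)).symm
  have e2 : ∑ i ∈ T, ∑ j ∈ T, ν.real (A i ∩ A j) =
      ∫ x, ∑ i ∈ T, ∑ j ∈ T, (A i ∩ A j).indicator (1 : α → ℝ) x ∂ν := by
    rw [integral_finsetSum _ fun i _ => integrable_finsetSum _ fun j _ =>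
      hint _ ((hA i).inter (hA j))]
    refine Finset.sum_congr rfl fun i _ => ?_
    rw [integral_finsetSum _ fun j _ => hint _ ((hA i).inter (hA j))]
    exact Finset.sum_congr rfl fun j _ => (integral_indicator_one ((hA i).inter (hA j))).symm
  rw [e1, e2, ← integral_indicator_one hU, ← integral_const_mul, ← integral_const_mul,
    ← integral_add ((hint _ hU).const_mul _) ((integrable_finsetSum _ fun i _ =>
      integrable_finsetSum _ fun j _ => hint _ ((hA i).inter (hA j))).const_mul _)]
  refine integral_mono (integrable_finsetSum _ fun i _ => hint _ (hA i))
    (((hint _ hU).const_mul _).add ((integrable_finsetSum _ fun i _ =>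
      integrable_finsetSum _ fun j _ => hint _ ((hA i).inter (hA j))).const_mul _)) fun x => ?_
  have e3 : ∑ i ∈ T, ∑ j ∈ T, (A i ∩ A j).indicator (1 : α → ℝ) x =
      (∑ i ∈ T, (A i).indicator (1 : α → ℝ) x) ^ 2 := by
    rw [sq, Finset.sum_mul_sum]
    refine Finset.sum_congr rfl fun i _ => Finset.sum_congr rfl fun j _ => ?_
    rw [Set.inter_indicator_one, Pi.mul_apply]
  beta_reduce
  rw [e3]
  by_cases hx : x ∈ ⋃ i ∈ T, A i
  · rw [Set.indicator_of_mem hx, Pi.one_apply]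
    set F := ∑ i ∈ T, (A i).indicator (1 : α → ℝ) x
    have : t / 2 * 1 + 1 / (2 * t) * F ^ 2 - F = (t - F) ^ 2 / (2 * t) := by
      field_simp; ring
    have h2 : 0 ≤ (t - F) ^ 2 / (2 * t) := by positivity
    linarith
  · rw [Set.indicator_of_notMem hx, mul_zero, zero_add,
      Finset.sum_eq_zero fun i hi => Set.indicator_of_notMem
        (fun h => hx (Set.mem_biUnion hi h)) _]
    simp

/-- `ν` is a finite measure for which `φ_I` scales masses in `X` by `Diam(X_I)^s` up to the constant
`Q`, and for which distinct cylinders of equal length meet in null sets. -/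
structure IsConformalMeasure (Φ : IteratedFunctionSystem d D)
    (X : Set (EuclideanSpace ℝ (Fin d))) (s : ℝ) (ν : Measure (EuclideanSpace ℝ (Fin d)))
    (Q : ℝ) : Prop where
  finite : IsFiniteMeasure ν
  one_le : 1 ≤ Q
  pos : 0 < ν.real X
  lower : ∀ I, ∀ E ⊆ X, Φ.cylDiam X I ^ s * ν.real E ≤ Q * ν.real (Φ.wordMap I '' E)
  upper : ∀ I, ∀ E ⊆ X, ν.real (Φ.wordMap I '' E) ≤ Q * Φ.cylDiam X I ^ s * ν.real E
  null : ∀ I J : List D, I.length = J.length → I ≠ J →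
    ν (Φ.cylinder X I ∩ Φ.cylinder X J) = 0

/-- The points of `X` with a coding whose `n`-th shift starts with the word `w`. -/
def hitSet (Φ : IteratedFunctionSystem d D) (X : Set (EuclideanSpace ℝ (Fin d)))
    (n : ℕ) (w : List D) : Set (EuclideanSpace ℝ (Fin d)) :=
  ⋃ I : Fin n → D, Φ.cylinder X (List.ofFn I ++ w)

/-- The points that lie, for infinitely many `n`, in the hitting set of the first `k n` letters
of `ω` at time `n`. -/
def recurrentSet (Φ : IteratedFunctionSystem d D) (X : Set (EuclideanSpace ℝ (Fin d)))
    (ω : ℕ → D) (k : ℕ → ℕ) : Set (EuclideanSpace ℝ (Fin d)) :=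
  ⋂ N : ℕ, ⋃ n : ℕ, Φ.hitSet X (N + n) (prefixWord ω (k (N + n)))

theorem IsAttractor.measurableSet_hitSet [Finite D] {Φ : IteratedFunctionSystem d D}
    {X : Set (EuclideanSpace ℝ (Fin d))} (hX : Φ.IsAttractor X) (n : ℕ) (w : List D) :
    MeasurableSet (Φ.hitSet X n w) :=
  MeasurableSet.iUnion fun _ => hX.measurableSet_cylinder _

theorem IsAttractor.measurableSet_recurrentSet [Finite D] {Φ : IteratedFunctionSystem d D}
    {X : Set (EuclideanSpace ℝ (Fin d))} (hX : Φ.IsAttractor X) (ω : ℕ → D) (k : ℕ → ℕ) :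
    MeasurableSet (Φ.recurrentSet X ω k) :=
  MeasurableSet.iInter fun _ => MeasurableSet.iUnion fun _ => hX.measurableSet_hitSet _ _

namespace IsConformalMeasure

variable {Φ : IteratedFunctionSystem d D} {X : Set (EuclideanSpace ℝ (Fin d))} {s Q : ℝ}
  {ν : Measure (EuclideanSpace ℝ (Fin d))}

theorem measure_cylinder_le (hν : Φ.IsConformalMeasure X s ν Q) (I : List D) :
    ν.real (Φ.cylinder X I) ≤ Q * Φ.cylDiam X I ^ s * ν.real X :=
  hν.upper I X subset_rfl

theorem le_measure_cylinder (hν : Φ.IsConformalMeasure X s ν Q) (I : List D) :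
    Φ.cylDiam X I ^ s * ν.real X ≤ Q * ν.real (Φ.cylinder X I) :=
  hν.lower I X subset_rfl

theorem measure_append_le (hν : Φ.IsConformalMeasure X s ν Q) (hX : Φ.IsAttractor X)
    (I J : List D) :
    ν.real (Φ.cylinder X (I ++ J)) ≤
      Q ^ 2 / ν.real X * ν.real (Φ.cylinder X I) * ν.real (Φ.cylinder X J) := by
  have h1 := hν.upper I _ (hX.cylinder_subset J)
  rw [← cylinder_append] at h1
  refine h1.trans (mul_le_mul_of_nonneg_right ?_ measureReal_nonneg)
  have h2 := hν.le_measure_cylinder I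
  have h3 := hν.pos
  have h4 := hν.one_le
  rw [div_mul_eq_mul_div, le_div_iff₀ h3, sq, mul_assoc, mul_assoc]
  exact mul_le_mul_of_nonneg_left h2 (by linarith)

theorem measure_mul_le (hν : Φ.IsConformalMeasure X s ν Q) (hX : Φ.IsAttractor X)
    (I J : List D) :
    ν.real (Φ.cylinder X I) * ν.real (Φ.cylinder X J) ≤
      Q ^ 2 * ν.real X * ν.real (Φ.cylinder X (I ++ J)) := by
  have h1 := hν.lower I _ (hX.cylinder_subset J)
  rw [← cylinder_append] at h1
  have h2 := hν.measure_cylinder_le I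
  have h3 := hν.pos
  have h4 := hν.one_le
  calc _ ≤ Q * Φ.cylDiam X I ^ s * ν.real X * ν.real (Φ.cylinder X J) :=
        mul_le_mul_of_nonneg_right h2 measureReal_nonneg
    _ = Q * ν.real X * (Φ.cylDiam X I ^ s * ν.real (Φ.cylinder X J)) := by ring
    _ ≤ Q * ν.real X * (Q * ν.real (Φ.cylinder X (I ++ J))) :=
        mul_le_mul_of_nonneg_left h1 (by positivity)
    _ = _ := by ring

theorem measure_biUnion_cylinder (hν : Φ.IsConformalMeasure X s ν Q) (hX : Φ.IsAttractor X)
    (n : ℕ) (T : Finset (Fin n → D)) :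
    ν.real (⋃ I ∈ T, Φ.cylinder X (List.ofFn I)) =
      ∑ I ∈ T, ν.real (Φ.cylinder X (List.ofFn I)) := by
  have := hν.finite
  rw [measureReal_def, measure_biUnion_finset₀
    (fun I _ J _ hIJ => hν.null _ _ (by simp) fun h => hIJ (List.ofFn_injective h))
    (fun I _ => (hX.measurableSet_cylinder _).nullMeasurableSet),
    ENNReal.toReal_sum fun I _ => measure_ne_top _ _]
  rfl

section

variable [Fintype D]

theorem wordSum_measure (hν : Φ.IsConformalMeasure X s ν Q) (hX : Φ.IsAttractor X) (n : ℕ) :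
    wordSum n (fun I => ν.real (Φ.cylinder X I)) = ν.real X := by
  rw [wordSum, ← hν.measure_biUnion_cylinder hX n Finset.univ]
  congr 1
  conv_rhs => rw [hX.eq_iUnion_cylinder n]
  simp

/-- At most a fixed multiple of the expected proportion of a cylinder `X_A` with `|A| ≤ n` is hit
at time `n`. -/
theorem wordSum_inter_le (hν : Φ.IsConformalMeasure X s ν Q) (hX : Φ.IsAttractor X)
    {n : ℕ} {A : List D} (hA : A.length ≤ n) (w : List D) :
    (wordSum n fun I => ν.real (Φ.cylinder X A ∩ Φ.cylinder X (I ++ w))) ≤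
      Q ^ 4 / ν.real X * ν.real (Φ.cylinder X A) * ν.real (Φ.cylinder X w) := by
  have := hν.finite
  have h3 := hν.pos
  have h4 := hν.one_le
  rw [wordSum_eq_of_prefix hA]
  · have hb : ∀ P : List D, ν.real (Φ.cylinder X A ∩ Φ.cylinder X (A ++ P ++ w)) ≤
        (Q ^ 4 / ν.real X ^ 2 * ν.real (Φ.cylinder X A) * ν.real (Φ.cylinder X w)) *
          ν.real (Φ.cylinder X P) := fun P => by
      calc _ ≤ ν.real (Φ.cylinder X (A ++ P ++ w)) := measureReal_mono Set.inter_subset_right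
        _ ≤ Q ^ 2 / ν.real X * ν.real (Φ.cylinder X (A ++ P)) * ν.real (Φ.cylinder X w) :=
            hν.measure_append_le hX _ _
        _ ≤ Q ^ 2 / ν.real X * (Q ^ 2 / ν.real X * ν.real (Φ.cylinder X A) *
              ν.real (Φ.cylinder X P)) * ν.real (Φ.cylinder X w) := by
            refine mul_le_mul_of_nonneg_right (mul_le_mul_of_nonneg_left
              (hν.measure_append_le hX _ _) (by positivity)) measureReal_nonneg
        _ = _ := by ring
    refine (wordSum_le fun P _ => hb P).trans_eq ?_
    rw [wordSum_mul_left, hν.wordSum_measure hX]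
    field_simp
  · intro I hI hAI
    have hle : Φ.cylinder X A ∩ Φ.cylinder X (I ++ w) ⊆
        Φ.cylinder X A ∩ Φ.cylinder X (I.take A.length) :=
      Set.inter_subset_inter_right _
        (hX.cylinder_subset_of_prefix ((List.take_prefix _ _).trans (List.prefix_append _ _)))
    have hnull := hν.null A (I.take A.length) (by simp [hI, hA])
      fun h => hAI (h ▸ List.take_prefix _ _)
    rw [measureReal_def, measure_mono_null hle hnull, ENNReal.toReal_zero]

/-- Quasi-independence of the hitting times `m ≤ n`. If the target of time `m` is read before time
`n`, the two events are nearly independent. Otherwise the letters between `m` and `n` are the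
first letters of `ω`, which accounts for the second term. -/
theorem wordSum_wordSum_inter_le (hν : Φ.IsConformalMeasure X s ν Q) (hX : Φ.IsAttractor X)
    (ω : ℕ → D) (k : ℕ → ℕ) {m n : ℕ} (hmn : m ≤ n) :
    (wordSum m fun I => wordSum n fun J =>
      ν.real (Φ.cylinder X (I ++ prefixWord ω (k m)) ∩ Φ.cylinder X (J ++ prefixWord ω (k n)))) ≤
      Q ^ 6 / ν.real X * (ν.real (Φ.cylinder X (prefixWord ω (k m))) +
        ν.real (Φ.cylinder X (prefixWord ω (n - m)))) *
          ν.real (Φ.cylinder X (prefixWord ω (k n))) := by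
  have := hν.finite
  have h3 := hν.pos
  have h4 := hν.one_le
  -- either the target of time `m` or the part of it read before time `n`
  have key : ∀ j : ℕ, m + j ≤ n → j ≤ k m →
      (wordSum m fun I => wordSum n fun J =>
        ν.real (Φ.cylinder X (I ++ prefixWord ω (k m)) ∩
          Φ.cylinder X (J ++ prefixWord ω (k n)))) ≤
      Q ^ 6 / ν.real X * ν.real (Φ.cylinder X (prefixWord ω j)) *
        ν.real (Φ.cylinder X (prefixWord ω (k n))) := by
    intro j hj hjk
    calc _ ≤ wordSum m fun I => Q ^ 4 / ν.real X * (Q ^ 2 / ν.real X *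
            ν.real (Φ.cylinder X I) * ν.real (Φ.cylinder X (prefixWord ω j))) *
            ν.real (Φ.cylinder X (prefixWord ω (k n))) := by
          refine wordSum_le fun I hI => ?_
          refine le_trans (wordSum_le fun J _ => ?_) ((hν.wordSum_inter_le hX
            (A := I ++ prefixWord ω j) (by simpa [hI] using hj) (prefixWord ω (k n))).trans ?_)
          · refine measureReal_mono (Set.inter_subset_inter_left _
              (hX.cylinder_subset_of_prefix ?_))
            exact (List.prefix_append_right_inj _).2 (prefixWord_prefix ω hjk)
          · exact mul_le_mul_of_nonneg_right (mul_le_mul_of_nonneg_left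
              (hν.measure_append_le hX _ _) (by positivity)) measureReal_nonneg
      _ = wordSum m fun I => (Q ^ 6 / ν.real X ^ 2 * ν.real (Φ.cylinder X (prefixWord ω j)) *
            ν.real (Φ.cylinder X (prefixWord ω (k n)))) * ν.real (Φ.cylinder X I) :=
          wordSum_congr fun I _ => by ring
      _ = _ := by
          rw [wordSum_mul_left, hν.wordSum_measure hX]
          field_simp
  have hnn : 0 ≤ Q ^ 6 / ν.real X := by positivity
  rw [mul_add, add_mul]
  rcases le_total (k m) (n - m) with hle | hle
  · refine (key (k m) (by omega) le_rfl).trans (le_add_of_nonneg_right ?_)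
    positivity
  · refine (key (n - m) (by omega) hle).trans (le_add_of_nonneg_left ?_)
    positivity

theorem exists_summable_bound (hν : Φ.IsConformalMeasure X s ν Q) (hX : Φ.IsAttractor X)
    (hs : 0 < s) : ∃ b : ℕ → ℝ, Summable b ∧ (∀ n, 0 ≤ b n) ∧
      ∀ I : List D, ν.real (Φ.cylinder X I) ≤ b I.length := by
  obtain ⟨ρ, h0, h1, hρ⟩ := hX.exists_uniform_cylDiam_le
  have h3 := hν.pos
  have h4 := hν.one_le
  have hΔ := Φ.cylDiam_nonneg X []
  refine ⟨fun n => Q * Φ.cylDiam X [] ^ s * ν.real X * (ρ ^ s) ^ n,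
    (summable_geometric_of_lt_one (by positivity) (Real.rpow_lt_one h0.le h1 hs)).mul_left _,
    fun n => by positivity, fun I => (hν.measure_cylinder_le I).trans ?_⟩
  have h5 : Φ.cylDiam X I ^ s ≤ (ρ ^ s) ^ I.length * Φ.cylDiam X [] ^ s := by
    refine (Real.rpow_le_rpow (Φ.cylDiam_nonneg X I) (hρ I) hs.le).trans_eq ?_
    rw [Real.mul_rpow (by positivity) hΔ, ← Real.rpow_natCast, ← Real.rpow_mul h0.le,
      ← Real.rpow_natCast, ← Real.rpow_mul h0.le, mul_comm s]
  calc Q * Φ.cylDiam X I ^ s * ν.real X ≤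
      Q * ((ρ ^ s) ^ I.length * Φ.cylDiam X [] ^ s) * ν.real X := by gcongr
    _ = _ := by ring

end

end IsConformalMeasure

/-- A part of the recurrent set in the cylinder `X_J` is the image under `φ_J` of a recurrent set
with shifted targets. -/
theorem IsAttractor.image_recurrentSet_subset {Φ : IteratedFunctionSystem d D}
    {X : Set (EuclideanSpace ℝ (Fin d))} (hX : Φ.IsAttractor X) (ω : ℕ → D) (k : ℕ → ℕ)
    (J : List D) :
    Φ.wordMap J '' Φ.recurrentSet X ω (fun n => k (J.length + n)) ⊆
      Φ.recurrentSet X ω k ∩ Φ.cylinder X J := by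
  rintro _ ⟨x, hx, rfl⟩
  have hxn : ∀ N, ∃ n, ∃ I : Fin (N + n) → D,
      x ∈ Φ.cylinder X (List.ofFn I ++ prefixWord ω (k (J.length + (N + n)))) := fun N => by
    simpa only [recurrentSet, hitSet, Set.mem_iInter, Set.mem_iUnion] using Set.mem_iInter.1 hx N
  constructor
  · refine Set.mem_iInter.2 fun N => Set.mem_iUnion.2 ?_
    obtain ⟨n, I, hI⟩ := hxn N
    refine ⟨J.length + n, ?_⟩
    have hlen : (J ++ List.ofFn I).length = N + (J.length + n) := by simp; omega
    obtain ⟨I', hI'⟩ := exists_ofFn_of_length hlen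
    refine Set.mem_iUnion_of_mem I' ?_
    rw [hI', List.append_assoc, cylinder_append, show N + (J.length + n) = J.length + (N + n) by
      omega]
    exact ⟨x, hI, rfl⟩
  · obtain ⟨n, I, hI⟩ := hxn 0
    exact ⟨x, hX.cylinder_subset _ hI, rfl⟩

namespace IsConformalMeasure

variable [Fintype D] {Φ : IteratedFunctionSystem d D} {X : Set (EuclideanSpace ℝ (Fin d))}
  {s Q : ℝ} {ν : Measure (EuclideanSpace ℝ (Fin d))}

/-- Once the expected number of hits is at least `1`, the probability of a hit is bounded below,
uniformly in the coding and in the targets. -/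
theorem exists_le_measure_biUnion_hitSet (hν : Φ.IsConformalMeasure X s ν Q)
    (hX : Φ.IsAttractor X) (hs : 0 < s) :
    ∃ c : ℝ, 0 < c ∧ ∀ (ω : ℕ → D) (k : ℕ → ℕ) (T : Finset ℕ),
      1 ≤ ∑ n ∈ T, ν.real (Φ.cylinder X (prefixWord ω (k n))) →
      c ≤ ν.real (⋃ n ∈ T, Φ.hitSet X n (prefixWord ω (k n))) := by
  have := hν.finite
  have h3 := hν.pos
  have h4 := hν.one_le
  obtain ⟨b, hbs, hb0, hb⟩ := hν.exists_summable_bound hX hs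
  set R := Q ^ 6 / ν.real X with hR
  have hRpos : 0 < R := by positivity
  set B := ∑' n, b n with hB
  have hB0 : 0 ≤ B := tsum_nonneg hb0
  refine ⟨1 / (2 * R * Q ^ 4 * (1 + B)), by positivity, fun ω k T hT => ?_⟩
  set a : ℕ → ℝ := fun n => ν.real (Φ.cylinder X (prefixWord ω (k n))) with ha
  have ha0 : ∀ n, 0 ≤ a n := fun n => measureReal_nonneg
  set S := ∑ n ∈ T, a n with hS
  set e : ℕ → ℕ → ℝ := fun m n => wordSum m fun I => wordSum n fun J =>
    ν.real (Φ.cylinder X (I ++ prefixWord ω (k m)) ∩ Φ.cylinder X (J ++ prefixWord ω (k n)))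
    with he
  have hesymm : ∀ m n, e m n = e n m := fun m n => by
    simp only [he, wordSum]
    rw [Finset.sum_comm]
    simp only [Set.inter_comm]
  let g : ℕ → ℕ → ℝ := fun m n => if m ≤ n then R * (a m + b (n - m)) * a n else 0
  have hg0 : ∀ m n, 0 ≤ g m n := fun m n => by
    simp only [g]
    split_ifs
    · exact mul_nonneg (mul_nonneg hRpos.le (add_nonneg (ha0 m) (hb0 _))) (ha0 n)
    · exact le_rfl
  have heg' : ∀ m n, m ≤ n → e m n ≤ g m n := fun m n hmn => by
    simp only [g, if_pos hmn]
    refine (hν.wordSum_wordSum_inter_le hX ω k hmn).trans ?_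
    refine mul_le_mul_of_nonneg_right (mul_le_mul_of_nonneg_left ?_ hRpos.le) (ha0 n)
    exact add_le_add le_rfl (by simpa using hb (prefixWord ω (n - m)))
  have heg : ∀ m n, e m n ≤ g m n + g n m := fun m n => by
    rcases le_total m n with hmn | hmn
    · exact (heg' m n hmn).trans (le_add_of_nonneg_right (hg0 _ _))
    · rw [hesymm]
      exact (heg' n m hmn).trans (le_add_of_nonneg_left (hg0 _ _))
  have hgsum : ∀ n, ∑ m ∈ T, g m n ≤ R * (S + B) * a n := fun n => by
    simp only [g]
    rw [← Finset.sum_filter, ← Finset.sum_mul, ← Finset.mul_sum, Finset.sum_add_distrib]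
    refine mul_le_mul_of_nonneg_right (mul_le_mul_of_nonneg_left (add_le_add ?_ ?_) hRpos.le)
      (ha0 n)
    · exact Finset.sum_le_sum_of_subset_of_nonneg (Finset.filter_subset _ _) fun i _ _ => ha0 i
    · rw [← Finset.sum_image (f := b) (g := fun m => n - m)]
      · exact hbs.sum_le_tsum _ fun i _ => hb0 i
      · intro x hx y hy hxy
        have hx' := (Finset.mem_filter.1 hx).2
        have hy' := (Finset.mem_filter.1 hy).2
        simp only at hxy
        omega
  have hdouble : ∑ m ∈ T, ∑ n ∈ T, e m n ≤ 2 * (R * (S + B) * S) := by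
    calc ∑ m ∈ T, ∑ n ∈ T, e m n ≤ ∑ m ∈ T, ∑ n ∈ T, (g m n + g n m) :=
          Finset.sum_le_sum fun m _ => Finset.sum_le_sum fun n _ => heg m n
      _ = 2 * ∑ n ∈ T, ∑ m ∈ T, g m n := by
          simp only [Finset.sum_add_distrib]
          rw [Finset.sum_comm, two_mul]
      _ ≤ 2 * ∑ n ∈ T, R * (S + B) * a n :=
          mul_le_mul_of_nonneg_left (Finset.sum_le_sum fun n _ => hgsum n) (by norm_num)
      _ = _ := by rw [← Finset.mul_sum]
  have hsingle : S ≤ Q ^ 2 * ∑ n ∈ T, wordSum n fun I =>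
      ν.real (Φ.cylinder X (I ++ prefixWord ω (k n))) := by
    rw [Finset.mul_sum]
    refine Finset.sum_le_sum fun n _ => ?_
    have h5 : ν.real X * a n ≤ Q ^ 2 * ν.real X * wordSum n fun I =>
        ν.real (Φ.cylinder X (I ++ prefixWord ω (k n))) := by
      conv_lhs => rw [← hν.wordSum_measure hX n]
      rw [← wordSum_mul_right, ← wordSum_mul_left]
      exact wordSum_le fun I _ => hν.measure_mul_le hX I _
    refine le_of_mul_le_mul_left (h5.trans_eq ?_) h3
    ring
  have hSpos : 0 < S := by linarith
  have ht : 0 < 2 * R * Q ^ 2 * (1 + B) * S := by positivity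
  have key := sum_measureReal_le_second_moment ν
    (T.sigma fun n => (Finset.univ : Finset (Fin n → D)))
    (fun p : Σ n : ℕ, Fin n → D =>
      Φ.cylinder X (List.ofFn p.2 ++ prefixWord ω (k p.1)))
    (fun p => hX.measurableSet_cylinder _) ht
  simp only [Finset.sum_sigma] at key
  have hU : (⋃ p ∈ T.sigma fun n => (Finset.univ : Finset (Fin n → D)),
      Φ.cylinder X (List.ofFn p.2 ++ prefixWord ω (k p.1))) =
        ⋃ n ∈ T, Φ.hitSet X n (prefixWord ω (k n)) := by
    ext x
    simp only [Set.mem_iUnion, Finset.mem_sigma, Finset.mem_univ, and_true, hitSet, exists_prop,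
      Sigma.exists]
    exact ⟨fun ⟨n, I, hn, h⟩ => ⟨n, hn, I, h⟩, fun ⟨n, hn, I, h⟩ => ⟨n, I, hn, h⟩⟩
  rw [hU] at key
  set u := ν.real (⋃ n ∈ T, Φ.hitSet X n (prefixWord ω (k n)))
  have hdouble' : ∑ m ∈ T, ∑ I : Fin m → D, ∑ n ∈ T, ∑ J : Fin n → D,
      ν.real (Φ.cylinder X (List.ofFn I ++ prefixWord ω (k m)) ∩
        Φ.cylinder X (List.ofFn J ++ prefixWord ω (k n))) ≤ 2 * (R * (1 + B) * S ^ 2) := by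
    have h6 : ∑ m ∈ T, ∑ I : Fin m → D, ∑ n ∈ T, ∑ J : Fin n → D,
        ν.real (Φ.cylinder X (List.ofFn I ++ prefixWord ω (k m)) ∩
          Φ.cylinder X (List.ofFn J ++ prefixWord ω (k n))) = ∑ m ∈ T, ∑ n ∈ T, e m n := by
      refine Finset.sum_congr rfl fun m _ => ?_
      rw [Finset.sum_comm]
      rfl
    rw [h6]
    refine hdouble.trans ?_
    have : (S + B) * S ≤ (1 + B) * S ^ 2 := by nlinarith [mul_nonneg hB0 hSpos.le]
    nlinarith
  have hsingle' : S / Q ^ 2 ≤ ∑ n ∈ T, ∑ I : Fin n → D,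
      ν.real (Φ.cylinder X (List.ofFn I ++ prefixWord ω (k n))) := by
    rw [div_le_iff₀' (by positivity)]
    exact hsingle
  have hfin : S / Q ^ 2 ≤ 2 * R * Q ^ 2 * (1 + B) * S / 2 * u +
      1 / (2 * (2 * R * Q ^ 2 * (1 + B) * S)) * (2 * (R * (1 + B) * S ^ 2)) :=
    hsingle'.trans (key.trans (add_le_add le_rfl
      (mul_le_mul_of_nonneg_left hdouble' (by positivity))))
  have e7 : 1 / (2 * (2 * R * Q ^ 2 * (1 + B) * S)) * (2 * (R * (1 + B) * S ^ 2)) =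
      S / Q ^ 2 / 2 := by
    field_simp
  rw [e7] at hfin
  rw [div_le_iff₀ (by positivity)]
  have e8 : S / Q ^ 2 / 2 ≤ S / Q ^ 2 / 2 * (u * (2 * R * Q ^ 4 * (1 + B))) := by
    have : S / Q ^ 2 / 2 * (u * (2 * R * Q ^ 4 * (1 + B))) =
        2 * R * Q ^ 2 * (1 + B) * S / 2 * u := by
      field_simp
    rw [this]
    linarith
  exact le_of_mul_le_mul_left (by rwa [mul_one]) (by positivity : 0 < S / Q ^ 2 / 2)

theorem exists_le_measure_recurrentSet (hν : Φ.IsConformalMeasure X s ν Q)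
    (hX : Φ.IsAttractor X) (hs : 0 < s) :
    ∃ c : ℝ, 0 < c ∧ ∀ (ω : ℕ → D) (k : ℕ → ℕ),
      ¬ (Summable fun n => ν.real (Φ.cylinder X (prefixWord ω (k n)))) →
      c ≤ ν.real (Φ.recurrentSet X ω k) := by
  have := hν.finite
  obtain ⟨c, hc, hcov⟩ := hν.exists_le_measure_biUnion_hitSet hX hs
  refine ⟨c, hc, fun ω k hdiv => ?_⟩
  set a : ℕ → ℝ := fun n => ν.real (Φ.cylinder X (prefixWord ω (k n))) with ha
  have hstep : ∀ N, c ≤ ν.real (⋃ n : ℕ, Φ.hitSet X (N + n) (prefixWord ω (k (N + n)))) := by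
    intro N
    have h1 : ¬ Summable fun n => a (n + N) := fun h => hdiv ((summable_nat_add_iff N).1 h)
    have h2 := (not_summable_iff_tendsto_nat_atTop_of_nonneg
      (fun n => (measureReal_nonneg : 0 ≤ a (n + N)))).1 h1
    obtain ⟨N', hN'⟩ := (h2.eventually_ge_atTop 1).exists
    have h3 := hcov ω k ((Finset.range N').image fun n => n + N) (by
      rwa [Finset.sum_image fun x _ y _ h => by simpa using h])
    refine h3.trans (measureReal_mono ?_)
    intro x hx
    obtain ⟨n, hn, hxn⟩ := Set.mem_iUnion₂.1 hx
    obtain ⟨m, -, rfl⟩ := Finset.mem_image.1 hn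
    rw [add_comm m N] at hxn
    exact Set.mem_iUnion_of_mem m hxn
  have hanti : Antitone fun N : ℕ =>
      ⋃ n : ℕ, Φ.hitSet X (N + n) (prefixWord ω (k (N + n))) := by
    intro N M hNM x hx
    obtain ⟨n, hn⟩ := Set.mem_iUnion.1 hx
    obtain ⟨l, rfl⟩ := Nat.exists_eq_add_of_le hNM
    exact Set.mem_iUnion_of_mem (l + n) (by rwa [← add_assoc])
  have hlim := tendsto_measure_iInter_atTop (μ := ν)
    (s := fun N : ℕ => ⋃ n : ℕ, Φ.hitSet X (N + n) (prefixWord ω (k (N + n))))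
    (fun N => (MeasurableSet.iUnion fun _ => hX.measurableSet_hitSet _ _).nullMeasurableSet)
    hanti ⟨0, measure_ne_top _ _⟩
  exact ge_of_tendsto' ((ENNReal.tendsto_toReal (measure_ne_top _ _)).comp hlim) hstep

theorem exists_le_measure_recurrentSet_inter (hν : Φ.IsConformalMeasure X s ν Q)
    (hX : Φ.IsAttractor X) (hs : 0 < s) :
    ∃ c : ℝ, 0 < c ∧ ∀ (ω : ℕ → D) (k : ℕ → ℕ),
      ¬ (Summable fun n => ν.real (Φ.cylinder X (prefixWord ω (k n)))) → ∀ J : List D,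
      c * ν.real (Φ.cylinder X J) ≤ ν.real (Φ.recurrentSet X ω k ∩ Φ.cylinder X J) := by
  have := hν.finite
  have h3 := hν.pos
  have h4 := hν.one_le
  obtain ⟨c, hc, hrec⟩ := hν.exists_le_measure_recurrentSet hX hs
  refine ⟨c / (Q ^ 2 * ν.real X), by positivity, fun ω k hdiv J => ?_⟩
  have h1 : ¬ (Summable fun n => ν.real (Φ.cylinder X (prefixWord ω (k (J.length + n))))) := by
    intro h
    refine hdiv ((summable_nat_add_iff J.length).1 ?_)
    simpa only [add_comm] using h
  have h2 := hrec ω _ h1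
  have hsub : Φ.recurrentSet X ω (fun n => k (J.length + n)) ⊆ X := by
    intro x hx
    obtain ⟨n, hn⟩ := Set.mem_iUnion.1 (Set.mem_iInter.1 hx 0)
    obtain ⟨I, hI⟩ := Set.mem_iUnion.1 hn
    exact hX.cylinder_subset _ hI
  have h5 := hν.lower J _ hsub
  have h6 := measureReal_mono (μ := ν) (hX.image_recurrentSet_subset ω k J)
  have h7 := hν.measure_cylinder_le J
  have h8 : 0 ≤ Φ.cylDiam X J ^ s := Real.rpow_nonneg (Φ.cylDiam_nonneg X J) _
  calc c / (Q ^ 2 * ν.real X) * ν.real (Φ.cylinder X J)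
      ≤ c / (Q ^ 2 * ν.real X) * (Q * Φ.cylDiam X J ^ s * ν.real X) :=
        mul_le_mul_of_nonneg_left h7 (by positivity)
    _ = (Φ.cylDiam X J ^ s * c) / Q := by field_simp
    _ ≤ (Q * ν.real (Φ.recurrentSet X ω k ∩ Φ.cylinder X J)) / Q := by
        refine div_le_div_of_nonneg_right ?_ (by linarith)
        exact (mul_le_mul_of_nonneg_left h2 h8).trans (h5.trans
          (mul_le_mul_of_nonneg_left h6 (by linarith)))
    _ = _ := by field_simp

/-- A set that occupies at least a fixed proportion of every cylinder has full measure. A compact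
subset of its complement is covered by the cylinders of level `n` that it meets. These lie in a
small neighbourhood and each has a fixed proportion outside the compact set. -/
theorem measure_diff_eq_zero_of_cylinder (hν : Φ.IsConformalMeasure X s ν Q)
    (hX : Φ.IsAttractor X) {W : Set (EuclideanSpace ℝ (Fin d))} (hW : MeasurableSet W)
    {c : ℝ} (hc : 0 < c)
    (hWc : ∀ J : List D, c * ν.real (Φ.cylinder X J) ≤ ν.real (W ∩ Φ.cylinder X J)) :
    ν (X \ W) = 0 := by
  classical
  have := hν.finite
  by_contra hne
  obtain ⟨L, hLsub, hL, hLpos⟩ := (hX.2.1.measurableSet.diff hW).exists_lt_isCompact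
    (pos_iff_ne_zero.2 hne)
  have hLr : 0 < ν.real L := ENNReal.toReal_pos hLpos.ne' (measure_ne_top _ _)
  obtain ⟨ρ, h0, h1, hρ⟩ := hX.exists_uniform_cylDiam_le
  have hΔ := Φ.cylDiam_nonneg X []
  have hc1 : c ≤ 1 := by
    have h2 := (hWc []).trans (measureReal_mono Set.inter_subset_right)
    rw [cylinder_nil] at h2
    have := hν.pos
    nlinarith
  have hstep : ∀ n : ℕ, ν.real L ≤
      (1 - c) * ν.real (Metric.cthickening (ρ ^ n * Φ.cylDiam X []) L) := by
    intro n
    set T : Finset (Fin n → D) :=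
      Finset.univ.filter fun I => (Φ.cylinder X (List.ofFn I) ∩ L).Nonempty with hT
    have hcov : L ⊆ ⋃ I ∈ T, (Φ.cylinder X (List.ofFn I) \ W) := by
      intro x hx
      have hxX := hLsub hx
      have hx2 : x ∈ ⋃ I : Fin n → D, Φ.cylinder X (List.ofFn I) :=
        hX.eq_iUnion_cylinder n ▸ hxX.1
      obtain ⟨I, hI⟩ := Set.mem_iUnion.1 hx2
      refine Set.mem_biUnion (x := I) ?_ ⟨hI, hxX.2⟩
      simp only [hT, Finset.coe_filter, Finset.mem_univ, true_and, Set.mem_ofPred_eq]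
      exact ⟨x, hI, hx⟩
    have hpiece : ∀ I : List D, ν.real (Φ.cylinder X I \ W) ≤
        (1 - c) * ν.real (Φ.cylinder X I) := fun I => by
      have h3 := measureReal_inter_add_sdiff (μ := ν) (s := Φ.cylinder X I) hW
      have h4 := hWc I
      rw [Set.inter_comm] at h4
      linarith
    have hsub : (⋃ I ∈ T, Φ.cylinder X (List.ofFn I)) ⊆
        Metric.cthickening (ρ ^ n * Φ.cylDiam X []) L := by
      intro y hy
      obtain ⟨I, hI, hyI⟩ := Set.mem_iUnion₂.1 hy
      obtain ⟨x, hxI, hxL⟩ := (Finset.mem_filter.1 hI).2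
      refine Metric.mem_cthickening_of_dist_le y x _ L hxL ?_
      refine (hX.dist_le_diam_cylinder _ hyI hxI).trans ?_
      have h2 := hρ (List.ofFn I)
      rwa [List.length_ofFn] at h2
    calc ν.real L ≤ ν.real (⋃ I ∈ T, (Φ.cylinder X (List.ofFn I) \ W)) :=
          measureReal_mono hcov (measure_ne_top _ _)
      _ ≤ ∑ I ∈ T, ν.real (Φ.cylinder X (List.ofFn I) \ W) := measureReal_biUnion_finset_le _ _
      _ ≤ ∑ I ∈ T, (1 - c) * ν.real (Φ.cylinder X (List.ofFn I)) :=
          Finset.sum_le_sum fun I _ => hpiece _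
      _ = (1 - c) * ν.real (⋃ I ∈ T, Φ.cylinder X (List.ofFn I)) := by
          rw [← Finset.mul_sum, hν.measure_biUnion_cylinder hX]
      _ ≤ _ := mul_le_mul_of_nonneg_left (measureReal_mono hsub) (by linarith)
  have hr : Tendsto (fun n : ℕ => ρ ^ n * Φ.cylDiam X []) atTop (𝓝 0) := by
    simpa using (tendsto_pow_atTop_nhds_zero_of_lt_one h0.le h1).mul_const (Φ.cylDiam X [])
  have hlim := ((ENNReal.tendsto_toReal (measure_ne_top ν L)).comp
    ((tendsto_measure_cthickening_of_isCompact (μ := ν) hL).comp hr)).const_mul (1 - c)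
  have hfin : ν.real L ≤ (1 - c) * ν.real L := ge_of_tendsto' hlim hstep
  nlinarith

theorem measure_diff_recurrentSet (hν : Φ.IsConformalMeasure X s ν Q)
    (hX : Φ.IsAttractor X) (hs : 0 < s) (ω : ℕ → D) (k : ℕ → ℕ)
    (hdiv : ¬ (Summable fun n => ν.real (Φ.cylinder X (prefixWord ω (k n))))) :
    ν (X \ Φ.recurrentSet X ω k) = 0 := by
  obtain ⟨c, hc, hrec⟩ := hν.exists_le_measure_recurrentSet_inter hX hs
  exact hν.measure_diff_eq_zero_of_cylinder hX (hX.measurableSet_recurrentSet ω k) hc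
    (hrec ω k hdiv)

end IsConformalMeasure

/-! ### The divergence part for quasi-self-similar sets -/

theorem IsQuasiSelfSimilar.isConformalMeasure {Φ : IteratedFunctionSystem d D}
    {X : Set (EuclideanSpace ℝ (Fin d))} {C s : ℝ} (h : Φ.IsQuasiSelfSimilar X C)
    (hX : Φ.IsAttractor X) (hs : 0 ≤ s) (h0 : μH[s] X ≠ 0) (htop : μH[s] X ≠ ⊤)
    (hnull : ∀ I J : List D, I.length = J.length → I ≠ J →
      μH[s] (Φ.cylinder X I ∩ Φ.cylinder X J) = 0) :
    Φ.IsConformalMeasure X s (μH[s].restrict X) (C ^ s) := by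
  have hC := h.pos
  have hfin : ∀ E ⊆ X, μH[s] E ≠ ⊤ := fun E hE => ne_top_of_le_ne_top htop (measure_mono hE)
  have himg : ∀ I : List D, ∀ E ⊆ X, Φ.wordMap I '' E ⊆ X := fun I E hE =>
    (Set.image_mono hE).trans (hX.cylinder_subset I)
  have hreal : ∀ E ⊆ X, (μH[s].restrict X).real E = (μH[s] E).toReal := fun E hE => by
    rw [measureReal_def, Measure.restrict_eq_self _ hE]
  refine ⟨⟨by rw [Measure.restrict_apply_univ]; exact htop.lt_top⟩,
    Real.one_le_rpow h.one_le hs, ?_, fun I E hE => ?_, fun I E hE => ?_, fun I J hIJ hne => ?_⟩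
  · rw [hreal X subset_rfl]
    exact ENNReal.toReal_pos h0 htop
  · -- `E` is the image of `φ_I(E)` under the inverse map, which is Lipschitz
    have hd := h.diam_pos I
    have hinv : ∀ x ∈ X, Function.invFunOn (Φ.wordMap I) X (Φ.wordMap I x) = x := fun x hx =>
      (h.injOn_wordMap I).leftInvOn_invFunOn hx
    have hlip : LipschitzOnWith (C / Φ.cylDiam X I).toNNReal
        (Function.invFunOn (Φ.wordMap I) X) (Φ.wordMap I '' E) := by
      refine LipschitzOnWith.of_dist_le_mul ?_
      rintro _ ⟨x, hx, rfl⟩ _ ⟨y, hy, rfl⟩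
      rw [hinv x (hE hx), hinv y (hE hy), Real.coe_toNNReal _ (by positivity),
        div_mul_eq_mul_div, le_div_iff₀ hd, mul_comm]
      exact h.lower I x (hE hx) y (hE hy)
    have key := hlip.hausdorffMeasure_image_le hs
    have himage : Function.invFunOn (Φ.wordMap I) X '' (Φ.wordMap I '' E) = E := by
      rw [Set.image_image]
      exact (Set.image_congr fun x hx => hinv x (hE hx)).trans (Set.image_id' E)
    rw [himage] at key
    have key2 := ENNReal.toReal_mono (ENNReal.mul_ne_top
      (ENNReal.rpow_ne_top_of_nonneg hs ENNReal.coe_ne_top) (hfin _ (himg I E hE))) key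
    rw [ENNReal.toReal_mul, ← ENNReal.toReal_rpow, ENNReal.coe_toReal,
      Real.coe_toNNReal _ (by positivity), Real.div_rpow hC.le hd.le, div_mul_eq_mul_div,
      le_div_iff₀ (Real.rpow_pos_of_pos hd s), mul_comm] at key2
    rwa [hreal E hE, hreal _ (himg I E hE)]
  · have hd := h.diam_pos I
    have hlip : LipschitzOnWith (C * Φ.cylDiam X I).toNNReal (Φ.wordMap I) E := by
      refine LipschitzOnWith.of_dist_le_mul fun x hx y hy => ?_
      rw [Real.coe_toNNReal _ (by positivity)]
      exact h.upper I x (hE hx) y (hE hy)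
    have key2 := ENNReal.toReal_mono (ENNReal.mul_ne_top
      (ENNReal.rpow_ne_top_of_nonneg hs ENNReal.coe_ne_top) (hfin _ hE))
      (hlip.hausdorffMeasure_image_le hs)
    rw [ENNReal.toReal_mul, ← ENNReal.toReal_rpow, ENNReal.coe_toReal,
      Real.coe_toNNReal _ (by positivity), Real.mul_rpow hC.le hd.le] at key2
    rwa [hreal E hE, hreal _ (himg I E hE)]
  · rw [Measure.restrict_eq_self _ (Set.inter_subset_left.trans (hX.cylinder_subset I))]
    exact hnull I J hIJ hne

/-- Capping the radii at `1` does not affect divergence. -/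
theorem summable_rpow_of_summable_min {u : ℕ → ℝ} (hu : ∀ n, 0 ≤ u n) {s : ℝ}
    (h : Summable fun n => min (u n) 1 ^ s) : Summable fun n => u n ^ s := by
  refine Summable.of_norm_bounded_eventually_nat h ?_
  filter_upwards [h.tendsto_atTop_zero.eventually_lt_const zero_lt_one] with n hn
  have h1 : u n ≤ 1 := by
    by_contra! hlt
    rw [min_eq_right hlt.le, Real.one_rpow] at hn
    exact lt_irrefl _ hn
  rw [min_eq_left h1, Real.norm_of_nonneg (Real.rpow_nonneg (hu n) _)]

namespace IsQuasiSelfSimilar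

variable {Φ : IteratedFunctionSystem d D} {X : Set (EuclideanSpace ℝ (Fin d))} {C : ℝ}

/-- Along a coding the cylinders shrink at a bounded rate, so any radius `u ≤ 1` is comparable
with the diameter of the first cylinder that is small enough. -/
theorem exists_prefix_comparable [Fintype D] (h : Φ.IsQuasiSelfSimilar X C) (hX : Φ.IsAttractor X)
    (ω : ℕ → D) : ∃ B : ℝ, 0 < B ∧ ∀ u : ℝ, 0 < u → ∃ k : ℕ,
      C * Φ.cylDiam X (prefixWord ω k) ≤ u ∧ min u 1 ≤ B * Φ.cylDiam X (prefixWord ω k) := by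
  classical
  have hC := h.pos
  have := hX.nonempty_alphabet
  obtain ⟨i₀, hi₀⟩ := Finite.exists_min fun i : D => Φ.cylDiam X [i]
  set δ := Φ.cylDiam X [i₀] with hδ
  have hδ0 : 0 < δ := h.diam_pos _
  have hΔ := h.diam_pos []
  obtain ⟨ρ, h0, h1, hρ⟩ := hX.exists_uniform_cylDiam_le
  refine ⟨max (1 / Φ.cylDiam X []) (C ^ 2 / δ), lt_max_of_lt_left (by positivity),
    fun u hu => ?_⟩
  have hex : ∃ k : ℕ, C * Φ.cylDiam X (prefixWord ω k) ≤ u := by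
    have ht : Tendsto (fun n : ℕ => C * (ρ ^ n * Φ.cylDiam X [])) atTop (𝓝 0) := by
      simpa using ((tendsto_pow_atTop_nhds_zero_of_lt_one h0.le h1).mul_const
        (Φ.cylDiam X [])).const_mul C
    obtain ⟨k, hk⟩ := (ht.eventually_lt_const hu).exists
    refine ⟨k, le_trans (mul_le_mul_of_nonneg_left ?_ hC.le) hk.le⟩
    simpa using hρ (prefixWord ω k)
  refine ⟨Nat.find hex, Nat.find_spec hex, ?_⟩
  have hpos := h.diam_pos (prefixWord ω (Nat.find hex))
  rcases hk : Nat.find hex with _ | j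
  · refine (min_le_right _ _).trans ?_
    rw [show prefixWord ω 0 = [] from rfl]
    calc (1 : ℝ) = 1 / Φ.cylDiam X [] * Φ.cylDiam X [] := by field_simp
      _ ≤ _ := mul_le_mul_of_nonneg_right (le_max_left _ _) hΔ.le
  · have hj : u < C * Φ.cylDiam X (prefixWord ω j) :=
      not_le.1 (Nat.find_min hex (by omega))
    have h2 := h.diam_mul_le hX (prefixWord ω j) [ω j]
    rw [← prefixWord_succ] at h2
    have h3 : Φ.cylDiam X (prefixWord ω j) * δ ≤ C * Φ.cylDiam X (prefixWord ω (j + 1)) :=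
      (mul_le_mul_of_nonneg_left (hi₀ _) (h.diam_pos _).le).trans h2
    rw [hk] at hpos
    calc min u 1 ≤ C * Φ.cylDiam X (prefixWord ω j) := (min_le_left _ _).trans hj.le
      _ = C / δ * (Φ.cylDiam X (prefixWord ω j) * δ) := by field_simp
      _ ≤ C / δ * (C * Φ.cylDiam X (prefixWord ω (j + 1))) :=
          mul_le_mul_of_nonneg_left h3 (by positivity)
      _ = C ^ 2 / δ * Φ.cylDiam X (prefixWord ω (j + 1)) := by ring
      _ ≤ _ := mul_le_mul_of_nonneg_right (le_max_right _ _) hpos.le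

/-- The ball of radius `Diam(X_I) θ(n)` around `φ_I(z)` contains the cylinder of `I` followed by
the first `k n` letters of a coding of `z`. -/
theorem recurrentSet_subset_limsupSet (h : Φ.IsQuasiSelfSimilar X C) (hX : Φ.IsAttractor X)
    {z : EuclideanSpace ℝ (Fin d)} {ω : ℕ → D} (hω : ∀ k, z ∈ Φ.cylinder X (prefixWord ω k))
    {θ : ℕ → ℝ≥0} {k : ℕ → ℕ}
    (hk : ∀ n, 1 ≤ n → C * Φ.cylDiam X (prefixWord ω (k n)) ≤ θ n) :
    Φ.recurrentSet X ω k ⊆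
      Φ.limsupSet X (fun I => Metric.diam (Φ.cylinder X I) * θ I.length) z := by
  intro x hx
  have hxn : ∀ N, ∃ n, ∃ I : Fin (N + n) → D,
      x ∈ Φ.cylinder X (List.ofFn I ++ prefixWord ω (k (N + n))) := fun N => by
    simpa only [hitSet, Set.mem_iUnion] using Set.mem_iInter.1 hx N
  refine ⟨?_, fun hfin => ?_⟩
  · obtain ⟨n, I, hI⟩ := hxn 0
    exact hX.cylinder_subset _ hI
  · obtain ⟨N, hN⟩ := (hfin.image List.length).bddAbove
    obtain ⟨n, I, hI⟩ := hxn (N + 1)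
    have hlen : (List.ofFn I).length = N + 1 + n := by simp
    have hmem := hN ⟨List.ofFn I, ⟨?_, ?_⟩, rfl⟩
    · omega
    · rw [Ne, ← List.length_eq_zero_iff]
      omega
    · rw [Metric.mem_closedBall]
      beta_reduce
      rw [hlen]
      refine (hX.dist_le_diam_cylinder _ hI (y := Φ.wordMap (List.ofFn I) z) ?_).trans ?_
      · rw [cylinder_append]
        exact ⟨z, hω _, rfl⟩
      · refine (h.diam_append_le hX _ _).trans ?_
        rw [mul_comm C, mul_assoc]
        exact mul_le_mul_of_nonneg_left (hk _ (by omega)) (h.diam_pos _).le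

theorem measure_diff_limsupSet [Fintype D] (h : Φ.IsQuasiSelfSimilar X C) (hX : Φ.IsAttractor X)
    {s Q : ℝ}
    (hs : 0 < s) (hν : Φ.IsConformalMeasure X s (μH[s].restrict X) Q)
    {z : EuclideanSpace ℝ (Fin d)} (hz : z ∈ X) {θ : ℕ → ℝ≥0} (hθ : ∀ n, 1 ≤ n → 0 < θ n)
    (hdiv : ¬ Summable fun n : ℕ => (θ (n + 1) : ℝ) ^ s) :
    μH[s] (X \ Φ.limsupSet X (fun I => Metric.diam (Φ.cylinder X I) * θ I.length) z) = 0 := by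
  obtain ⟨ω, hω⟩ := hX.exists_coding hz
  obtain ⟨B, hB, hcomp⟩ := h.exists_prefix_comparable hX ω
  have hex : ∀ n : ℕ, ∃ k : ℕ, 1 ≤ n → C * Φ.cylDiam X (prefixWord ω k) ≤ θ n ∧
      min (θ n : ℝ) 1 ≤ B * Φ.cylDiam X (prefixWord ω k) := fun n => by
    rcases Nat.eq_zero_or_pos n with rfl | hn
    · exact ⟨0, fun h => absurd h (by norm_num)⟩
    · obtain ⟨k, hk⟩ := hcomp (θ n) (by exact_mod_cast hθ n hn)
      exact ⟨k, fun _ => hk⟩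
  choose k hk using hex
  set ν := μH[s].restrict X with hνdef
  have h3 := hν.pos
  have h4 := hν.one_le
  have hdiv' : ¬ Summable fun n => ν.real (Φ.cylinder X (prefixWord ω (k n))) := by
    intro hsum
    refine hdiv (summable_rpow_of_summable_min (fun n => (θ (n + 1)).2) ?_)
    refine Summable.of_nonneg_of_le
      (fun n => Real.rpow_nonneg (le_min (θ (n + 1)).2 zero_le_one) _) (fun n => ?_)
      (((summable_nat_add_iff 1).2 hsum).mul_left (B ^ s * Q / ν.real X))
    have h5 := (hk (n + 1) (by omega)).2
    have h6 := hν.le_measure_cylinder (prefixWord ω (k (n + 1)))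
    calc min (θ (n + 1) : ℝ) 1 ^ s
        ≤ (B * Φ.cylDiam X (prefixWord ω (k (n + 1)))) ^ s :=
          Real.rpow_le_rpow (le_min (θ (n + 1)).2 zero_le_one) h5 hs.le
      _ = B ^ s / ν.real X * (Φ.cylDiam X (prefixWord ω (k (n + 1))) ^ s * ν.real X) := by
          rw [Real.mul_rpow hB.le (h.diam_pos _).le]
          field_simp
      _ ≤ B ^ s / ν.real X * (Q * ν.real (Φ.cylinder X (prefixWord ω (k (n + 1))))) :=
          mul_le_mul_of_nonneg_left h6 (by positivity)
      _ = _ := by ring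
  have hrec := hν.measure_diff_recurrentSet hX hs ω k hdiv'
  rw [hνdef, Measure.restrict_eq_self _ Set.sdiff_subset] at hrec
  exact measure_mono_null (Set.sdiff_subset_sdiff_right
    (h.recurrentSet_subset_limsupSet hX hω fun n hn => (hk n hn).1)) hrec

/-- With bounded partition functions, divergence of the series in the theorem is divergence of
`∑ θ(n) ^ s`. -/
theorem not_summable_of_not_seriesConverges [Fintype D] (h : Φ.IsQuasiSelfSimilar X C) {s K : ℝ}
    (hZ : ∀ n, Φ.partitionSum X s n ≤ K) {θ : ℕ → ℝ≥0}
    (hdiv : ¬ SeriesConverges (fun I => Metric.diam (Φ.cylinder X I) * θ I.length) s) :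
    ¬ Summable fun n : ℕ => (θ (n + 1) : ℝ) ^ s := by
  intro hsum
  refine hdiv (Summable.of_nonneg_of_le (fun n => ?_) (fun n => ?_) (hsum.mul_left K))
  · exact Finset.sum_nonneg fun I _ =>
      Real.rpow_nonneg (mul_nonneg Metric.diam_nonneg (θ _).2) _
  · have : levelSum (fun I => Metric.diam (Φ.cylinder X I) * θ I.length) s (n + 1) =
        Φ.partitionSum X s (n + 1) * (θ (n + 1) : ℝ) ^ s := by
      rw [levelSum_eq_wordSum, partitionSum, ← wordSum_mul_right]
      refine wordSum_congr fun I hI => ?_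
      rw [hI]
      exact Real.mul_rpow (h.diam_pos I).le (θ (n + 1)).2
    rw [this]
    exact mul_le_mul_of_nonneg_right (hZ _) (Real.rpow_nonneg (θ (n + 1)).2 _)

/-- The divergence part for quasi-self-similar sets whose cylinders do not cluster and have null
overlaps. Here both dimensions are the exponent of the partition function, whence `t = 1`. -/
theorem divergence_part [Fintype D] (h : Φ.IsQuasiSelfSimilar X C) (hX : Φ.IsAttractor X) {M : ℕ}
    {B : ℝ}
    (hB : 0 < B) (hsep : Φ.HasFiniteClustering X M B)
    (hnull : ∀ s K : ℝ, 0 < s → (∀ n, Φ.partitionSum X s n ≤ K ∧ 1 ≤ K * Φ.partitionSum X s n) →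
      μH[s] X ≠ ⊤ → ∀ I J : List D, I.length = J.length → I ≠ J →
        μH[s] (Φ.cylinder X I ∩ Φ.cylinder X J) = 0) :
    Φ.IsApproximationRegular X ∧
      ∀ z ∈ X, ∀ θ : ℕ → ℝ≥0, AntitoneOn θ (Set.Ici 1) →
        ¬ SeriesConverges (fun I => Metric.diam (Φ.cylinder X I) * θ I.length)
            (hausdorffDim X) →
        μH[hausdorffDim X]
          (X \ Φ.limsupSet X (fun I => Metric.diam (Φ.cylinder X I) * θ I.length) z) = 0 := by
  obtain ⟨s, hs, K, hK, hZ⟩ := h.exists_exponent hX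
  have hne := h.hausdorffMeasure_ne_zero hX hs hK hZ hB hsep
  have htop := hX.hausdorffMeasure_ne_top hs.le fun n => (hZ n).1
  have hdim : hausdorffDim X = s := by
    have h1 : dimH X = (s.toNNReal : ℝ≥0∞) :=
      dimH_of_hausdorffMeasure_ne_zero_ne_top (by rwa [Real.coe_toNNReal _ hs.le])
        (by rwa [Real.coe_toNNReal _ hs.le])
    rw [hausdorffDim, h1, ENNReal.coe_toReal, Real.coe_toNNReal _ hs.le]
  have hν := h.isConformalMeasure hX hs.le hne htop (hnull s K hs hZ htop)
  have hmain : ∀ z ∈ X, ∀ θ : ℕ → ℝ≥0, AntitoneOn θ (Set.Ici 1) →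
      ¬ SeriesConverges (fun I => Metric.diam (Φ.cylinder X I) * θ I.length) s →
      μH[s] (X \ Φ.limsupSet X (fun I => Metric.diam (Φ.cylinder X I) * θ I.length) z) = 0 := by
    intro z hz θ hθ hdiv
    have hdiv' := h.not_summable_of_not_seriesConverges (fun n => (hZ n).1) hdiv
    refine h.measure_diff_limsupSet hX hs hν hz (fun n hn => ?_) hdiv'
    by_contra hzero
    have hzero' : θ n = 0 := le_antisymm (not_lt.1 hzero) zero_le
    refine hdiv' (summable_of_ne_finset_zero (s := Finset.range n) fun m hm => ?_)
    have hm' : n ≤ m + 1 := by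
      have := Finset.mem_range.not.1 hm
      omega
    have h2 : θ (m + 1) = 0 :=
      le_antisymm ((hθ hn (Set.mem_Ici.2 (hn.trans hm')) hm').trans hzero'.le) zero_le
    rw [h2, NNReal.coe_zero, Real.zero_rpow hs.ne']
  refine ⟨fun z hz θ hθ hdiv => ?_, by rwa [hdim]⟩
  have hdimS := h.similarityDim_eq hX hs hK hZ
  have happ : Φ.approxFun X (Φ.similarityDim X / hausdorffDim X) θ =
      fun I => Metric.diam (Φ.cylinder X I) * θ I.length := by
    funext I
    rw [approxFun, hdimS, hdim, div_self hs.ne', Real.rpow_one]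
  rw [happ, hdim] at hdiv ⊢
  rw [if_pos (pos_iff_ne_zero.2 hne)]
  exact hmain z hz θ hθ hdiv

end IsQuasiSelfSimilar

/-- If `X` is a single point, every `φ_I` fixes it, and it is approximated trivially. -/
theorem IsAttractor.limsupSet_eq_of_subsingleton {Φ : IteratedFunctionSystem d D}
    {X : Set (EuclideanSpace ℝ (Fin d))} (hX : Φ.IsAttractor X) (hsub : X.Subsingleton)
    {Ψ : List D → ℝ} (hΨ : ∀ I, 0 ≤ Ψ I) {z : EuclideanSpace ℝ (Fin d)} (hz : z ∈ X) :
    Φ.limsupSet X Ψ z = X := by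
  refine Set.Subset.antisymm (fun x hx => hx.1) fun x hx => ⟨hx, fun hfin => ?_⟩
  obtain ⟨i⟩ := hX.nonempty_alphabet
  obtain ⟨N, hN⟩ := (hfin.image List.length).bddAbove
  have hmem := hN ⟨List.replicate (N + 1) i, ⟨by simp, ?_⟩, rfl⟩
  · simp at hmem
  · rw [hsub hx (hX.wordMap_mem _ hz)]
    exact Metric.mem_closedBall_self (hΨ _)

theorem IsAttractor.divergence_part_of_subsingleton [Fintype D] {Φ : IteratedFunctionSystem d D}
    {X : Set (EuclideanSpace ℝ (Fin d))} (hX : Φ.IsAttractor X) (hsub : X.Subsingleton) :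
    Φ.IsApproximationRegular X ∧
      ∀ z ∈ X, ∀ θ : ℕ → ℝ≥0, AntitoneOn θ (Set.Ici 1) →
        ¬ SeriesConverges (fun I => Metric.diam (Φ.cylinder X I) * θ I.length)
            (hausdorffDim X) →
        μH[hausdorffDim X]
          (X \ Φ.limsupSet X (fun I => Metric.diam (Φ.cylinder X I) * θ I.length) z) = 0 := by
  refine ⟨fun z hz θ _ _ => ?_, fun z hz θ _ _ => ?_⟩
  · have hW := hX.limsupSet_eq_of_subsingleton hsub
      (Ψ := Φ.approxFun X (Φ.similarityDim X / hausdorffDim X) θ)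
      (fun I => mul_nonneg (Real.rpow_nonneg Metric.diam_nonneg _) (θ _).2) hz
    rw [hW, Set.sdiff_self]
    simp
  · have hW := hX.limsupSet_eq_of_subsingleton hsub
      (Ψ := fun I => Metric.diam (Φ.cylinder X I) * θ I.length)
      (fun I => mul_nonneg Metric.diam_nonneg (θ _).2) hz
    rw [hW, Set.sdiff_self]
    simp

/-! ### Similarities with the open set condition -/

theorem exists_common_prefix {I J : List D} (h1 : ¬ I <+: J) (h2 : ¬ J <+: I) :
    ∃ (K : List D) (i j : D) (I' J' : List D), i ≠ j ∧ I = K ++ i :: I' ∧ J = K ++ j :: J' := by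
  classical
  induction I generalizing J with
  | nil => exact absurd List.nil_prefix h1
  | cons i I ih =>
    cases J with
    | nil => exact absurd List.nil_prefix h2
    | cons j J =>
      by_cases hij : i = j
      · subst hij
        rw [List.cons_prefix_cons] at h1 h2
        obtain ⟨K, i', j', I', J', hne, hI, hJ⟩ :=
          ih (J := J) (fun h => h1 ⟨rfl, h⟩) fun h => h2 ⟨rfl, h⟩
        exact ⟨i :: K, i', j', I', J', hne, by simp [hI], by simp [hJ]⟩
      · exact ⟨[], i, j, I, J, hij, rfl, rfl⟩

/-- A map of a Euclidean space that multiplies all distances by `c > 0` is affine, with linear part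
`c` times a linear isometry. -/
theorem exists_linearIsometry_of_dist_eq {f : EuclideanSpace ℝ (Fin d) → EuclideanSpace ℝ (Fin d)}
    {c : ℝ} (hc : 0 < c) (hf : ∀ x y, dist (f x) (f y) = c * dist x y) :
    ∃ L : EuclideanSpace ℝ (Fin d) →ₗᵢ[ℝ] EuclideanSpace ℝ (Fin d),
      ∀ x, f x = f 0 + c • L x := by
  have hg : Isometry fun x => c⁻¹ • f x := Isometry.of_dist_eq fun x y => by
    rw [dist_smul₀, hf, Real.norm_of_nonneg (by positivity), inv_mul_cancel_left₀ hc.ne']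
  refine ⟨hg.affineIsometryOfStrictConvexSpace.linearIsometry, fun x => ?_⟩
  have h := hg.affineIsometryOfStrictConvexSpace.map_vadd 0 x
  simp only [vadd_eq_add, add_zero, Isometry.coe_affineIsometryOfStrictConvexSpace] at h
  have h2 := congrArg (fun v => c • v) h
  simp only [smul_add, smul_inv_smul₀ hc.ne'] at h2
  rw [h2, add_comm]

theorem surjective_of_dist_eq {f : EuclideanSpace ℝ (Fin d) → EuclideanSpace ℝ (Fin d)}
    {c : ℝ} (hc : 0 < c) (hf : ∀ x y, dist (f x) (f y) = c * dist x y) :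
    Function.Surjective f := by
  obtain ⟨L, hL⟩ := exists_linearIsometry_of_dist_eq hc hf
  intro y
  obtain ⟨x, hx⟩ := (LinearMap.injective_iff_surjective (f := L.toLinearMap)).1 L.injective
    (c⁻¹ • (y - f 0))
  refine ⟨x, ?_⟩
  rw [hL, show L x = c⁻¹ • (y - f 0) from hx, smul_inv_smul₀ hc.ne', add_sub_cancel]

theorem norm_fderiv_of_dist_eq [Nontrivial (EuclideanSpace ℝ (Fin d))]
    {f : EuclideanSpace ℝ (Fin d) → EuclideanSpace ℝ (Fin d)}
    {c : ℝ} (hc : 0 < c) (hf : ∀ x y, dist (f x) (f y) = c * dist x y)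
    (x : EuclideanSpace ℝ (Fin d)) : ‖fderiv ℝ f x‖ = c := by
  obtain ⟨L, hL⟩ := exists_linearIsometry_of_dist_eq hc hf
  have hd : HasFDerivAt f (c • L.toContinuousLinearMap) x := by
    have h1 : HasFDerivAt (fun x => f 0 + c • L.toContinuousLinearMap x)
        (c • L.toContinuousLinearMap) x :=
      ((L.toContinuousLinearMap.hasFDerivAt (x := x)).const_smul c).const_add (f 0)
    exact h1.congr_of_eventuallyEq (Eventually.of_forall fun y => hL y)
  rw [hd.fderiv, norm_smul, L.norm_toContinuousLinearMap, mul_one, Real.norm_of_nonneg hc.le]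

theorem diam_image_of_dist_eq {α : Type*} [PseudoMetricSpace α] {f : α → α}
    {c : ℝ} (hc : 0 < c) (hf : ∀ x y, dist (f x) (f y) = c * dist x y) {S : Set α}
    (hS : Bornology.IsBounded S) : Metric.diam (f '' S) = c * Metric.diam S := by
  have hlip : LipschitzWith c.toNNReal f := LipschitzWith.of_dist_le_mul fun x y => by
    rw [hf, Real.coe_toNNReal _ hc.le]
  refine le_antisymm ?_ ?_
  · refine Metric.diam_le_of_forall_dist_le (mul_nonneg hc.le Metric.diam_nonneg) ?_
    rintro _ ⟨x, hx, rfl⟩ _ ⟨y, hy, rfl⟩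
    rw [hf]
    exact mul_le_mul_of_nonneg_left (Metric.dist_le_diam_of_mem hS hx hy) hc.le
  · rw [← le_div_iff₀' hc]
    refine Metric.diam_le_of_forall_dist_le (div_nonneg Metric.diam_nonneg hc.le)
      fun x hx y hy => ?_
    rw [le_div_iff₀' hc, ← hf]
    exact Metric.dist_le_diam_of_mem (hlip.isBounded_image hS)
      (Set.mem_image_of_mem f hx) (Set.mem_image_of_mem f hy)

/-- Every `φ_i` multiplies all distances in `ℝ^d` by the number `r i` in `(0, 1)`. -/
def HasRatios (Φ : IteratedFunctionSystem d D) (r : D → ℝ) : Prop :=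
  ∀ i, 0 < r i ∧ r i < 1 ∧ ∀ x y, dist (Φ.map i x) (Φ.map i y) = r i * dist x y

/-- The contraction ratio `r_{i₁} ⋯ r_{iₙ}` of `φ_I`. -/
def wordRatio (r : D → ℝ) (I : List D) : ℝ := (I.map r).prod

theorem wordRatio_append (r : D → ℝ) (I J : List D) :
    wordRatio r (I ++ J) = wordRatio r I * wordRatio r J := by
  simp [wordRatio]

namespace HasRatios

variable {Φ : IteratedFunctionSystem d D} {X : Set (EuclideanSpace ℝ (Fin d))} {r : D → ℝ}

theorem wordRatio_pos (hr : Φ.HasRatios r) (I : List D) : 0 < wordRatio r I := by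
  refine List.prod_pos fun a ha => ?_
  obtain ⟨i, -, rfl⟩ := List.mem_map.1 ha
  exact (hr i).1

theorem dist_wordMap (hr : Φ.HasRatios r) (I : List D) (x y : EuclideanSpace ℝ (Fin d)) :
    dist (Φ.wordMap I x) (Φ.wordMap I y) = wordRatio r I * dist x y := by
  induction I with
  | nil => simp [wordRatio]
  | cons i I ih =>
    rw [wordMap_cons, Function.comp_apply, Function.comp_apply, (hr i).2.2, ih, ← mul_assoc]
    rfl

theorem cylDiam_eq (hr : Φ.HasRatios r) (hX : Φ.IsAttractor X) (I : List D) :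
    Φ.cylDiam X I = wordRatio r I * Metric.diam X :=
  diam_image_of_dist_eq (hr.wordRatio_pos I) (hr.dist_wordMap I) hX.2.1.isBounded

theorem isQuasiSelfSimilar (hr : Φ.HasRatios r) (hX : Φ.IsAttractor X)
    (hnt : X.Nontrivial) :
    Φ.IsQuasiSelfSimilar X (max 1 (max (Metric.diam X) (Metric.diam X)⁻¹)) := by
  have hΔ : 0 < Metric.diam X := Metric.diam_pos hnt hX.2.1.isBounded
  have : Nontrivial (EuclideanSpace ℝ (Fin d)) := let ⟨x, _, y, _, h⟩ := hnt; ⟨x, y, h⟩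
  set Δ := Metric.diam X
  set C := max 1 (max Δ Δ⁻¹) with hC
  have hC0 : 1 ≤ C := le_max_left _ _
  have hC1 : Δ ≤ C := le_max_of_le_right (le_max_left _ _)
  have hC2 : 1 ≤ C * Δ := by
    rw [← inv_mul_cancel₀ hΔ.ne']
    exact mul_le_mul_of_nonneg_right (le_max_of_le_right (le_max_right _ _)) hΔ.le
  refine ⟨hC0, fun I => ?_, fun I x _ y _ => ?_, fun I x _ y _ => ?_, fun I x _ => ?_,
    fun I x _ => ?_⟩
  all_goals have hp := hr.wordRatio_pos I
  all_goals rw [hr.cylDiam_eq hX]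
  · positivity
  · rw [hr.dist_wordMap, mul_comm _ Δ, mul_assoc]
    exact mul_le_mul_of_nonneg_right hC1 (by positivity)
  · rw [hr.dist_wordMap]
    calc wordRatio r I * dist x y = 1 * (wordRatio r I * dist x y) := (one_mul _).symm
      _ ≤ C * Δ * (wordRatio r I * dist x y) := mul_le_mul_of_nonneg_right hC2 (by positivity)
      _ = _ := by ring
  · rw [norm_fderiv_of_dist_eq hp (hr.dist_wordMap I), mul_comm]
    exact mul_le_mul_of_nonneg_right hC1 hp.le
  · rw [norm_fderiv_of_dist_eq hp (hr.dist_wordMap I)]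
    calc wordRatio r I = 1 * wordRatio r I := (one_mul _).symm
      _ ≤ C * Δ * wordRatio r I := mul_le_mul_of_nonneg_right hC2 hp.le
      _ = _ := by ring

section null

variable [Fintype D]

theorem wordSum_wordRatio_rpow (hr : Φ.HasRatios r) (s : ℝ) (n : ℕ) :
    wordSum n (fun I => wordRatio r I ^ s) = (∑ i, r i ^ s) ^ n := by
  induction n with
  | zero => simp [wordRatio]
  | succ n ih =>
    rw [wordSum_add, pow_succ, ← ih, ← wordSum_mul_right]
    refine wordSum_congr fun I _ => ?_
    simp only [wordRatio_append, Real.mul_rpow (hr.wordRatio_pos _).le (hr.wordRatio_pos _).le,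
      wordSum_mul_left]
    congr 1
    simp [wordSum, wordRatio, Fintype.sum_equiv (Equiv.funUnique (Fin 1) D)
      (fun I : Fin 1 → D => r (I 0) ^ s) (fun i => r i ^ s)]

/-- If the partition functions are bounded from above and below, then `s` solves the Moran
equation. -/
theorem sum_rpow_eq_one (hr : Φ.HasRatios r) (hX : Φ.IsAttractor X) {s K : ℝ}
    (hZ : ∀ n, Φ.partitionSum X s n ≤ K ∧ 1 ≤ K * Φ.partitionSum X s n) :
    ∑ i, r i ^ s = 1 := by
  set p := ∑ i, r i ^ s with hp
  have hp0 : 0 ≤ p := Finset.sum_nonneg fun i _ => Real.rpow_nonneg (hr i).1.le _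
  have hZp : ∀ n, Φ.partitionSum X s n = p ^ n * Metric.diam X ^ s := fun n => by
    rw [← hr.wordSum_wordRatio_rpow, partitionSum, ← wordSum_mul_right]
    refine wordSum_congr fun I _ => ?_
    rw [hr.cylDiam_eq hX, Real.mul_rpow (hr.wordRatio_pos I).le Metric.diam_nonneg]
  have hΔ : 0 < Metric.diam X ^ s := by
    refine lt_of_le_of_ne (Real.rpow_nonneg Metric.diam_nonneg _) fun h => ?_
    have := (hZ 0).2
    rw [hZp, ← h, mul_zero, mul_zero] at this
    linarith
  rcases lt_trichotomy p 1 with h | h | h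
  · have ht : Tendsto (fun n => K * (p ^ n * Metric.diam X ^ s)) atTop (𝓝 0) := by
      simpa using ((tendsto_pow_atTop_nhds_zero_of_lt_one hp0 h).mul_const
        (Metric.diam X ^ s)).const_mul K
    have := ge_of_tendsto' ht fun n => hZp n ▸ (hZ n).2
    linarith
  · exact h
  · have ht : Tendsto (fun n => p ^ n * Metric.diam X ^ s) atTop atTop :=
      (tendsto_pow_atTop_atTop_of_one_lt h).atTop_mul_const hΔ
    obtain ⟨n, hn⟩ := (ht.eventually_gt_atTop K).exists
    exact absurd (hZp n ▸ (hZ n).1) (not_le.2 hn)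

/-- By the Moran equation the measures of the cylinders of level `n` add up to the measure of their
union, so their overlaps are null. -/
theorem hausdorffMeasure_inter_eq_zero (hr : Φ.HasRatios r) (hX : Φ.IsAttractor X) {s : ℝ}
    (hs : 0 < s) (hsum : ∑ i, r i ^ s = 1) (htop : μH[s] X ≠ ⊤) {I J : List D}
    (hIJ : I.length = J.length) (hne : I ≠ J) :
    μH[s] (Φ.cylinder X I ∩ Φ.cylinder X J) = 0 := by
  classical
  obtain ⟨n, hn⟩ : ∃ n, J.length = n := ⟨_, rfl⟩
  obtain ⟨I', hI'⟩ := exists_ofFn_of_length (hIJ.trans hn)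
  obtain ⟨J', hJ'⟩ := exists_ofFn_of_length hn
  have hfin : ∀ E ⊆ X, μH[s] E ≠ ⊤ := fun E hE => ne_top_of_le_ne_top htop (measure_mono hE)
  have hle : ∀ K : List D, (μH[s] (Φ.cylinder X K)).toReal ≤
      wordRatio r K ^ s * (μH[s] X).toReal := fun K => by
    have hlip : LipschitzOnWith (wordRatio r K).toNNReal (Φ.wordMap K) X :=
      LipschitzOnWith.of_dist_le_mul fun x _ y _ => by
        rw [hr.dist_wordMap, Real.coe_toNNReal _ (hr.wordRatio_pos K).le]
    have := ENNReal.toReal_mono (ENNReal.mul_ne_top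
      (ENNReal.rpow_ne_top_of_nonneg hs.le ENNReal.coe_ne_top) htop)
      (hlip.hausdorffMeasure_image_le hs.le)
    rwa [ENNReal.toReal_mul, ← ENNReal.toReal_rpow, ENNReal.coe_toReal,
      Real.coe_toNNReal _ (hr.wordRatio_pos K).le] at this
  set N := Φ.cylinder X I ∩ Φ.cylinder X J with hN
  have hNX : N ⊆ X := Set.inter_subset_left.trans (hX.cylinder_subset I)
  have hcov : X ⊆ (Φ.cylinder X I \ N) ∪
      ⋃ K ∈ Finset.univ.erase I', Φ.cylinder X (List.ofFn K) := by
    intro x hx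
    by_cases hxJ : x ∈ Φ.cylinder X J
    · refine Or.inr (Set.mem_biUnion (x := J') ?_ (hJ' ▸ hxJ))
      simp only [Finset.coe_erase, Finset.coe_univ, Set.mem_sdiff, Set.mem_univ, true_and,
        Set.mem_singleton_iff]
      rintro rfl
      exact hne (hI'.symm.trans hJ')
    · have hx2 : x ∈ ⋃ K : Fin n → D, Φ.cylinder X (List.ofFn K) := hX.eq_iUnion_cylinder n ▸ hx
      obtain ⟨K, hK⟩ := Set.mem_iUnion.1 hx2
      by_cases hKI : K = I'
      · subst hKI
        exact Or.inl ⟨hI' ▸ hK, fun h => hxJ h.2⟩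
      · exact Or.inr (Set.mem_biUnion (x := K) (by simpa using hKI) hK)
  have h1 : (μH[s] X).toReal ≤ (μH[s] (Φ.cylinder X I \ N)).toReal +
      ∑ K ∈ Finset.univ.erase I', (μH[s] (Φ.cylinder X (List.ofFn K))).toReal := by
    rw [← ENNReal.toReal_sum fun K _ => hfin _ (hX.cylinder_subset _), ← ENNReal.toReal_add
      (hfin _ (Set.sdiff_subset.trans (hX.cylinder_subset I)))
      (ENNReal.sum_ne_top.2 fun K _ => hfin _ (hX.cylinder_subset _))]
    refine ENNReal.toReal_mono (ENNReal.add_ne_top.2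
      ⟨hfin _ (Set.sdiff_subset.trans (hX.cylinder_subset I)),
        ENNReal.sum_ne_top.2 fun K _ => hfin _ (hX.cylinder_subset _)⟩) ?_
    exact (measure_mono hcov).trans ((measure_union_le _ _).trans
      (add_le_add le_rfl (measure_biUnion_finset_le _ _)))
  have h2 : (μH[s] (Φ.cylinder X I \ N)).toReal =
      (μH[s] (Φ.cylinder X I)).toReal - (μH[s] N).toReal := by
    rw [measure_sdiff Set.inter_subset_left
      ((hX.measurableSet_cylinder I).inter (hX.measurableSet_cylinder J)).nullMeasurableSet
      (hfin N hNX), ENNReal.toReal_sub_of_le (measure_mono Set.inter_subset_left)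
      (hfin _ (hX.cylinder_subset I))]
  have h3 : ∑ K : Fin n → D, (μH[s] (Φ.cylinder X (List.ofFn K))).toReal ≤ (μH[s] X).toReal := by
    refine (Finset.sum_le_sum fun K _ => hle _).trans_eq ?_
    have h4 := hr.wordSum_wordRatio_rpow s n
    rw [hsum, one_pow, wordSum] at h4
    rw [← Finset.sum_mul, h4, one_mul]
  rw [← Finset.add_sum_erase _ _ (Finset.mem_univ I'), hI'] at h3
  have h5 : (μH[s] N).toReal ≤ 0 := by linarith
  exact ((ENNReal.toReal_eq_zero_iff _).1 (le_antisymm h5 ENNReal.toReal_nonneg)).resolve_right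
    (hfin N hNX)

end null

end HasRatios

namespace HasRatios

variable {Φ : IteratedFunctionSystem d D} {X : Set (EuclideanSpace ℝ (Fin d))} {r : D → ℝ}

theorem injective_wordMap (hr : Φ.HasRatios r) (I : List D) :
    Function.Injective (Φ.wordMap I) := by
  intro x y hxy
  have h := hr.dist_wordMap I x y
  rw [hxy, dist_self] at h
  exact dist_le_zero.1 (nonpos_of_mul_nonpos_right h.symm.le (hr.wordRatio_pos I))

theorem disjoint_image_of_incomparable (hr : Φ.HasRatios r) {O : Set (EuclideanSpace ℝ (Fin d))}
    (hO : ∀ i, Φ.map i '' O ⊆ O)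
    (hdisj : ∀ i j, i ≠ j → Disjoint (Φ.map i '' O) (Φ.map j '' O)) {I J : List D}
    (h1 : ¬ I <+: J) (h2 : ¬ J <+: I) :
    Disjoint (Φ.wordMap I '' O) (Φ.wordMap J '' O) := by
  have hmaps : ∀ K : List D, Set.MapsTo (Φ.wordMap K) O O := fun K => by
    induction K with
    | nil => exact Set.mapsTo_id O
    | cons i K ih => exact fun x hx => hO i ⟨_, ih hx, rfl⟩
  obtain ⟨K, i, j, I', J', hij, rfl, rfl⟩ := exists_common_prefix h1 h2
  rw [Set.disjoint_left]
  rintro _ ⟨x, hx, rfl⟩ ⟨y, hy, hxy⟩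
  simp only [wordMap_append, Function.comp_apply] at hxy
  have h3 := hr.injective_wordMap K hxy
  exact Set.disjoint_left.1 (hdisj i j hij) ⟨_, hmaps I' hx, rfl⟩ ⟨_, hmaps J' hy, h3⟩

theorem wordRatio_le_pow (hr : Φ.HasRatios r) {ρ : ℝ} (hρ : ∀ i, r i ≤ ρ) (I : List D) :
    wordRatio r I ≤ ρ ^ I.length := by
  induction I with
  | nil => simp [wordRatio]
  | cons i I ih =>
    rw [show wordRatio r (i :: I) = r i * wordRatio r I from rfl, List.length_cons, pow_succ']
    exact mul_le_mul (hρ i) ih (hr.wordRatio_pos I).le ((hr i).1.le.trans (hρ i))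

/-- The words of the Moran cut set at scale `u` whose cylinders meet `U`: the ratio of such a word
is at most `u`, and those of its proper prefixes are larger than `u`. -/
def cutSet (Φ : IteratedFunctionSystem d D) (X : Set (EuclideanSpace ℝ (Fin d))) (r : D → ℝ)
    (U : Set (EuclideanSpace ℝ (Fin d))) (u : ℝ) : Set (List D) :=
  {I | wordRatio r I ≤ u ∧ (∀ P, P <+: I → P ≠ I → u < wordRatio r P) ∧
    (Φ.cylinder X I ∩ U).Nonempty}

/-- Under the open set condition a bounded number of words of the cut set meet a set of
diameter `u`: the images of a point of the open set under the corresponding maps lie in a ball of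
radius comparable with `u` and are separated by a distance comparable with `u`. -/
theorem hasFiniteClustering [Fintype D] (hr : Φ.HasRatios r) (hX : Φ.IsAttractor X)
    (hO : Φ.OpenSetCondition) :
    ∃ (M : ℕ) (B : ℝ), 0 < B ∧ Φ.HasFiniteClustering X M B := by
  classical
  have := hX.nonempty_alphabet
  obtain ⟨O, hOo, ⟨a, ha⟩, hOmaps, hOdisj⟩ := hO
  obtain ⟨ρ₀, hρ₀, hball⟩ := Metric.isOpen_iff.1 hOo a ha
  obtain ⟨i₀, hi₀⟩ := Finite.exists_min r
  obtain ⟨i₁, hi₁⟩ := Finite.exists_max r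
  obtain ⟨x₀, hx₀⟩ := hX.1
  set R := dist a x₀ + Metric.diam X with hR
  have haR : ∀ y ∈ X, dist a y ≤ R := fun y hy => (dist_triangle a x₀ y).trans
    (add_le_add le_rfl (Metric.dist_le_diam_of_mem hX.2.1.isBounded hx₀ hy))
  have hσ : 0 < r i₀ * ρ₀ := mul_pos (hr i₀).1 hρ₀
  obtain ⟨t, htfin, ht⟩ := Metric.totallyBounded_iff.1
    (isCompact_closedBall (0 : EuclideanSpace ℝ (Fin d)) (1 + R)).totallyBounded
    (r i₀ * ρ₀ / 2) (by linarith)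
  refine ⟨max 1 htfin.toFinset.card, Metric.diam X + 1,
    add_pos_of_nonneg_of_pos Metric.diam_nonneg one_pos, fun U u hu hU => ?_⟩
  rcases le_or_gt 1 u with hu1 | hu1
  · refine ⟨{[]}, by simp, fun I hI => ?_, 0, fun J _ _ => ⟨[], by simp, List.nil_prefix⟩⟩
    rw [Finset.mem_singleton.1 hI, hr.cylDiam_eq hX]
    have : (0 : ℝ) ≤ Metric.diam X := Metric.diam_nonneg
    simp only [wordRatio, List.map_nil, List.prod_nil, one_mul]
    nlinarith
  obtain ⟨n₀, hn₀⟩ := exists_pow_lt_of_lt_one hu (hr i₁).2.1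
  have hlong : ∀ I : List D, n₀ ≤ I.length → wordRatio r I ≤ u := fun I hI =>
    (hr.wordRatio_le_pow hi₁ I).trans ((pow_le_pow_of_le_one (hr i₁).1.le (hr i₁).2.1.le hI).trans
      hn₀.le)
  have hcutfin : (cutSet Φ X r U u).Finite := by
    refine (List.finite_length_le D n₀).subset fun I hI => ?_
    by_contra! hlt
    have hlt' : n₀ < I.length := not_le.1 hlt
    refine absurd (hI.2.1 (I.take n₀) (List.take_prefix _ _) fun h => ?_)
      (not_lt.2 (hlong _ (by simp; omega)))
    have := congrArg List.length h
    simp at this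
    omega
  refine ⟨hcutfin.toFinset, le_max_of_le_right ?_, fun I hI => ?_, n₀, fun J hJ hJU => ?_⟩
  · -- distinct words of the cut set give points at distance at least `r i₀ * ρ₀ * u`
    have hsepd : ∀ I ∈ cutSet Φ X r U u, ∀ J ∈ cutSet Φ X r U u, I ≠ J →
        r i₀ * ρ₀ * u ≤ dist (Φ.wordMap I a) (Φ.wordMap J a) := by
      intro I hI J hJ hne
      have hdis := hr.disjoint_image_of_incomparable hOmaps hOdisj
        (fun h => absurd (hJ.2.1 I h hne) (not_lt.2 hI.1))
        (fun h => absurd (hI.2.1 J h hne.symm) (not_lt.2 hJ.1))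
      have hratio : r i₀ * u ≤ wordRatio r I := by
        rcases List.eq_nil_or_concat I with rfl | ⟨P, i, rfl⟩
        · have := hI.1
          simp only [wordRatio, List.map_nil, List.prod_nil] at this
          linarith
        · have h1 := hI.2.1 P (by simp) (by simp)
          rw [List.concat_eq_append, wordRatio_append, mul_comm]
          refine mul_le_mul h1.le ?_ (hr i₀).1.le (hr.wordRatio_pos P).le
          simpa [wordRatio] using hi₀ i
      by_contra! hlt
      obtain ⟨x, hx⟩ := surjective_of_dist_eq (hr.wordRatio_pos I) (hr.dist_wordMap I)
        (Φ.wordMap J a)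
      have hxa : dist x a < ρ₀ := by
        have h2 := hr.dist_wordMap I a x
        rw [hx] at h2
        rw [dist_comm]
        have h3 : wordRatio r I * dist a x < wordRatio r I * ρ₀ := by
          rw [← h2]
          refine hlt.trans_le ?_
          calc r i₀ * ρ₀ * u = r i₀ * u * ρ₀ := by ring
            _ ≤ _ := mul_le_mul_of_nonneg_right hratio hρ₀.le
        exact lt_of_mul_lt_mul_left h3 (hr.wordRatio_pos I).le
      exact Set.disjoint_left.1 hdis ⟨x, hball hxa, rfl⟩ (hx ▸ ⟨a, ha, rfl⟩)
    rcases U.eq_empty_or_nonempty with rfl | ⟨x₁, hx₁⟩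
    · have : hcutfin.toFinset = ∅ := by
        ext I
        simp [cutSet]
      simp [this]
    let q : List D → EuclideanSpace ℝ (Fin d) := fun I => u⁻¹ • (Φ.wordMap I a - x₁)
    have hq : ∀ I ∈ cutSet Φ X r U u, ∃ y ∈ t, dist (q I) y < r i₀ * ρ₀ / 2 := by
      intro I hI
      have hmem : q I ∈ Metric.closedBall (0 : EuclideanSpace ℝ (Fin d)) (1 + R) := by
        obtain ⟨_, ⟨y, hy, rfl⟩, hyU⟩ := hI.2.2
        rw [mem_closedBall_zero_iff, norm_smul, Real.norm_of_nonneg (by positivity),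
          ← dist_eq_norm, inv_mul_le_iff₀ hu]
        calc dist (Φ.wordMap I a) x₁
            ≤ dist (Φ.wordMap I a) (Φ.wordMap I y) + dist (Φ.wordMap I y) x₁ :=
              dist_triangle _ _ _
          _ ≤ u * R + u := by
              refine add_le_add ?_ (hU _ hyU _ hx₁)
              rw [hr.dist_wordMap]
              exact mul_le_mul hI.1 (haR y hy) dist_nonneg hu.le
          _ = _ := by ring
      obtain ⟨y, hy, hyq⟩ := Set.mem_iUnion₂.1 (ht hmem)
      exact ⟨y, hy, hyq⟩
    choose! f hft hf using hq
    refine Finset.card_le_card_of_injOn f (fun I hI => ?_) fun I hI J hJ hIJ => ?_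
    · exact htfin.mem_toFinset.2 (hft I (hcutfin.mem_toFinset.1 hI))
    · have hI' := hcutfin.mem_toFinset.1 hI
      have hJ' := hcutfin.mem_toFinset.1 hJ
      by_contra hne
      have h1 := hsepd I hI' J hJ' hne
      have h2 : dist (q I) (q J) = u⁻¹ * dist (Φ.wordMap I a) (Φ.wordMap J a) := by
        rw [dist_smul₀, Real.norm_of_nonneg (by positivity), dist_sub_right]
      have h3 : dist (q I) (q J) < r i₀ * ρ₀ := by
        have h4 := hf I hI'
        have h5 := hf J hJ'
        rw [← hIJ, dist_comm] at h5
        have := dist_triangle (q I) (f I) (q J)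
        linarith
      rw [h2, inv_mul_lt_iff₀ hu] at h3
      linarith
  · rw [hr.cylDiam_eq hX]
    have h1 := (hcutfin.mem_toFinset.1 hI).1
    have h2 : (0 : ℝ) ≤ Metric.diam X := Metric.diam_nonneg
    nlinarith
  · have hex : ∃ m, wordRatio r (J.take m) ≤ u := ⟨J.length, by simpa using hlong J hJ⟩
    refine ⟨J.take (Nat.find hex), hcutfin.mem_toFinset.2 ⟨Nat.find_spec hex, fun P hP hPne => ?_,
      ?_⟩, List.take_prefix _ _⟩
    · have hPlen : P.length < Nat.find hex := by
        refine lt_of_le_of_ne (hP.length_le.trans (by simp)) fun h => hPne (hP.eq_of_length_le ?_)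
        rw [h]
        simp
      have h1 := Nat.find_min hex hPlen
      rw [← List.prefix_iff_eq_take.1 (hP.trans (List.take_prefix _ _))] at h1
      exact not_le.1 h1
    · exact hJU.mono (Set.inter_subset_inter_left _
        (hX.cylinder_subset_of_prefix (List.take_prefix _ _)))

theorem divergence_part [Fintype D] (hr : Φ.HasRatios r) (hX : Φ.IsAttractor X)
    (hnt : X.Nontrivial) (hO : Φ.OpenSetCondition) :
    Φ.IsApproximationRegular X ∧
      ∀ z ∈ X, ∀ θ : ℕ → ℝ≥0, AntitoneOn θ (Set.Ici 1) →
        ¬ SeriesConverges (fun I => Metric.diam (Φ.cylinder X I) * θ I.length)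
            (hausdorffDim X) →
        μH[hausdorffDim X]
          (X \ Φ.limsupSet X (fun I => Metric.diam (Φ.cylinder X I) * θ I.length) z) = 0 := by
  obtain ⟨M, B, hB, hsep⟩ := hr.hasFiniteClustering hX hO
  exact (hr.isQuasiSelfSimilar hX hnt).divergence_part hX hB hsep fun s K hs hZ htop I J hIJ hne =>
    hr.hausdorffMeasure_inter_eq_zero hX hs (hr.sum_rpow_eq_one hX hZ) htop hIJ hne

end HasRatios

/-! ### Strong separation -/

theorem IsQuasiSelfSimilar.disjoint_cylinder_of_incomparable {Φ : IteratedFunctionSystem d D}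
    {X : Set (EuclideanSpace ℝ (Fin d))} {C : ℝ} (h : Φ.IsQuasiSelfSimilar X C)
    (hX : Φ.IsAttractor X) (hsep : Φ.StrongSeparation X) {I J : List D}
    (h1 : ¬ I <+: J) (h2 : ¬ J <+: I) : Disjoint (Φ.cylinder X I) (Φ.cylinder X J) := by
  obtain ⟨K, i, j, I', J', hij, rfl, rfl⟩ := exists_common_prefix h1 h2
  rw [Set.disjoint_left]
  rintro _ ⟨x, hx, rfl⟩ ⟨y, hy, hxy⟩
  simp only [wordMap_append, Function.comp_apply] at hxy
  have h3 := h.injOn_wordMap K (hX.wordMap_mem (j :: J') hy) (hX.wordMap_mem (i :: I') hx) hxy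
  exact Set.disjoint_left.1 (hsep i j hij) ⟨_, hX.wordMap_mem I' hx, rfl⟩
    ⟨_, hX.wordMap_mem J' hy, h3⟩

theorem IsAttractor.exists_separation [Finite D] {Φ : IteratedFunctionSystem d D}
    {X : Set (EuclideanSpace ℝ (Fin d))} (hX : Φ.IsAttractor X) (hsep : Φ.StrongSeparation X) :
    ∃ δ : ℝ, 0 < δ ∧ ∀ i j, i ≠ j → ∀ x ∈ Φ.map i '' X, ∀ y ∈ Φ.map j '' X, δ ≤ dist x y := by
  have := hX.nonempty_alphabet
  have hex : ∀ p : D × D, ∃ δ : ℝ, 0 < δ ∧ (p.1 ≠ p.2 →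
      ∀ x ∈ Φ.map p.1 '' X, ∀ y ∈ Φ.map p.2 '' X, δ ≤ dist x y) := by
    rintro ⟨i, j⟩
    by_cases hij : i = j
    · exact ⟨1, one_pos, fun h => absurd hij h⟩
    · have hc : ∀ i, IsCompact (Φ.map i '' X) := fun i => by
        simpa [cylinder, wordMap_cons] using hX.isCompact_cylinder [i]
      obtain ⟨δ, hδ, hdis⟩ := (hsep i j hij).exists_thickenings (hc i) (hc j).isClosed
      refine ⟨δ, hδ, fun _ x hx y hy => ?_⟩
      by_contra! hlt
      exact Set.disjoint_left.1 hdis (Metric.self_subset_thickening hδ _ hx)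
        (Metric.mem_thickening_iff.2 ⟨y, hy, hlt⟩)
  choose δ hδ0 hδ using hex
  obtain ⟨p, hp⟩ := Finite.exists_min δ
  exact ⟨δ p, hδ0 p, fun i j hij x hx y hy => (hp (i, j)).trans (hδ (i, j) hij x hx y hy)⟩

/-- Under strong separation, a set `U` of diameter at most `u` is met only by extensions of a
single word, the shortest prefix whose cylinder is small enough compared with `u`. -/
theorem IsQuasiSelfSimilar.hasFiniteClustering [Fintype D] {Φ : IteratedFunctionSystem d D}
    {X : Set (EuclideanSpace ℝ (Fin d))} {C : ℝ} (h : Φ.IsQuasiSelfSimilar X C)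
    (hX : Φ.IsAttractor X) (hsep : Φ.StrongSeparation X) :
    ∃ B : ℝ, 0 < B ∧ Φ.HasFiniteClustering X 1 B := by
  classical
  obtain ⟨δ, hδ, hdist⟩ := hX.exists_separation hsep
  obtain ⟨ρ, h0, h1, hρ⟩ := hX.exists_uniform_cylDiam_le
  have hC := h.pos
  have hΔ := h.diam_pos []
  -- cylinders branching inside `X_K` are at distance at least `Diam(X_K) * δ / C`
  have hbranch : ∀ (K : List D) (i j : D) (I J : List D), i ≠ j →
      ∀ x ∈ Φ.cylinder X (K ++ i :: I), ∀ y ∈ Φ.cylinder X (K ++ j :: J),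
        Φ.cylDiam X K * δ ≤ C * dist x y := by
    rintro K i j I J hij _ ⟨x, hx, rfl⟩ _ ⟨y, hy, rfl⟩
    simp only [wordMap_append, Function.comp_apply]
    refine le_trans ?_ (h.lower K _ (hX.wordMap_mem _ hx) _ (hX.wordMap_mem _ hy))
    exact mul_le_mul_of_nonneg_left (hdist i j hij _ ⟨_, hX.wordMap_mem I hx, rfl⟩ _
      ⟨_, hX.wordMap_mem J hy, rfl⟩) (h.diam_pos K).le
  refine ⟨C / δ, by positivity, fun U u hu hU => ?_⟩
  have ht : Tendsto (fun n : ℕ => ρ ^ n * Φ.cylDiam X []) atTop (𝓝 0) := by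
    simpa using (tendsto_pow_atTop_nhds_zero_of_lt_one h0.le h1).mul_const (Φ.cylDiam X [])
  obtain ⟨n₀, hn₀⟩ := (ht.eventually_lt_const (show 0 < C / δ * u by positivity)).exists
  by_cases hex : ∃ J₀ : List D, n₀ ≤ J₀.length ∧ (Φ.cylinder X J₀ ∩ U).Nonempty
  · obtain ⟨J₀, hJ₀, x, hxJ, hxU⟩ := hex
    have hm : ∃ m, Φ.cylDiam X (J₀.take m) ≤ C / δ * u := by
      refine ⟨n₀, ((hρ _).trans_eq ?_).trans hn₀.le⟩
      rw [List.length_take, min_eq_left hJ₀]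
    refine ⟨{J₀.take (Nat.find hm)}, by simp, fun I hI => ?_, n₀, fun J hJ ⟨y, hyJ, hyU⟩ =>
      ⟨_, Finset.mem_singleton_self _, ?_⟩⟩
    · rw [Finset.mem_singleton.1 hI]
      exact Nat.find_spec hm
    · by_contra hpre
      have hmin : ∀ K : List D, K.length < Nat.find hm → K <+: J₀ →
          C / δ * u < Φ.cylDiam X K := fun K hK hKJ => by
        have h2 := Nat.find_min hm hK
        rw [← List.prefix_iff_eq_take.1 hKJ] at h2
        exact not_le.1 h2
      have hfind : Nat.find hm ≤ n₀ := Nat.find_min' hm (by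
        refine ((hρ _).trans_eq ?_).trans hn₀.le
        rw [List.length_take, min_eq_left hJ₀])
      have hlen : (J₀.take (Nat.find hm)).length = Nat.find hm := by
        rw [List.length_take]; omega
      have hpre2 : ¬ J <+: J₀.take (Nat.find hm) := fun h3 => by
        have h4 := h3.length_le
        exact hpre (h3.eq_of_length (by omega) ▸ List.prefix_rfl)
      obtain ⟨K, i, j, I', J', hij, hI, hJeq⟩ := exists_common_prefix hpre hpre2
      have hxK : x ∈ Φ.cylinder X (K ++ i :: I') :=
        hI ▸ hX.cylinder_subset_of_prefix (List.take_prefix _ _) hxJ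
      have h5 := hbranch K i j I' J' hij x hxK y (hJeq ▸ hyJ)
      have h6 := hmin K (by rw [← hlen, hI]; simp)
        ((List.prefix_append K (i :: I')).trans (hI ▸ List.take_prefix _ _))
      have h7 := hU x hxU y hyU
      rw [div_mul_eq_mul_div, div_lt_iff₀ hδ] at h6
      have h8 := mul_le_mul_of_nonneg_left h7 hC.le
      linarith
  · exact ⟨∅, by simp, by simp, n₀, fun J hJ hJU => absurd ⟨J, hJ, hJU⟩ hex⟩

theorem IsQuasiSelfSimilar.divergence_part_of_strongSeparation [Fintype D]
    {Φ : IteratedFunctionSystem d D} {X : Set (EuclideanSpace ℝ (Fin d))} {C : ℝ}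
    (h : Φ.IsQuasiSelfSimilar X C) (hX : Φ.IsAttractor X) (hsep : Φ.StrongSeparation X) :
    Φ.IsApproximationRegular X ∧
      ∀ z ∈ X, ∀ θ : ℕ → ℝ≥0, AntitoneOn θ (Set.Ici 1) →
        ¬ SeriesConverges (fun I => Metric.diam (Φ.cylinder X I) * θ I.length)
            (hausdorffDim X) →
        μH[hausdorffDim X]
          (X \ Φ.limsupSet X (fun I => Metric.diam (Φ.cylinder X I) * θ I.length) z) = 0 := by
  obtain ⟨B, hB, hclus⟩ := h.hasFiniteClustering hX hsep
  refine h.divergence_part hX hB hclus fun s K _ _ _ I J hIJ hne => ?_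
  rw [(h.disjoint_cylinder_of_incomparable hX hsep (fun h1 => hne (h1.eq_of_length hIJ))
    fun h1 => hne (h1.eq_of_length hIJ.symm).symm).inter_eq, measure_empty]

/-! ### Conformal systems -/

/-- A quantitative surjectivity statement. A point `q` close to `f x` is attained at a minimum of
`y ↦ |f(y) - q| + c |y - x|`: elsewhere moving `y` in the direction `f'(y)⁻¹(q - f(y))` decreases
the first term faster than the second term can grow. -/
theorem exists_eq_of_le_norm_fderiv {f : EuclideanSpace ℝ (Fin d) → EuclideanSpace ℝ (Fin d)}
    {x q : EuclideanSpace ℝ (Fin d)} {ε l c : ℝ} (hε : 0 ≤ ε) (hc : 0 < c) (hcl : c < l)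
    (hd : ∀ y ∈ Metric.closedBall x ε, DifferentiableAt ℝ f y)
    (hl : ∀ y ∈ Metric.closedBall x ε, ∀ v, l * ‖v‖ ≤ ‖fderiv ℝ f y v‖)
    (hq : dist q (f x) < c * ε) :
    ∃ y ∈ Metric.closedBall x ε, f y = q ∧ c * dist y x ≤ dist q (f x) := by
  have hcont : ContinuousOn (fun y => dist (f y) q + c * dist y x) (Metric.closedBall x ε) := by
    have hf : ContinuousOn f (Metric.closedBall x ε) := fun y hy =>
      (hd y hy).continuousAt.continuousWithinAt
    fun_prop
  obtain ⟨y, hy, hmin⟩ := (isCompact_closedBall x ε).exists_isMinOn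
    ⟨x, Metric.mem_closedBall_self hε⟩ hcont
  have hmin' : ∀ w ∈ Metric.closedBall x ε,
      dist (f y) q + c * dist y x ≤ dist (f w) q + c * dist w x := fun w hw => hmin hw
  have h0 := hmin' x (Metric.mem_closedBall_self hε)
  rw [dist_self, mul_zero, add_zero, dist_comm (f x) q] at h0
  refine ⟨y, hy, ?_, by linarith [dist_nonneg (x := f y) (y := q)]⟩
  by_contra hne
  have hl0 : 0 < l := hc.trans hcl
  set η := dist (f y) q with hη
  have hηpos : 0 < η := dist_pos.2 hne
  have hyint : dist y x < ε := by
    have : c * dist y x < c * ε := by linarith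
    exact lt_of_mul_lt_mul_left this hc.le
  have hinj : Function.Injective (fderiv ℝ f y) := by
    refine (injective_iff_map_eq_zero _).2 fun v hv => ?_
    have := hl y hy v
    rw [hv, norm_zero] at this
    exact norm_le_zero_iff.1 (nonpos_of_mul_nonpos_right this hl0)
  obtain ⟨v, hv⟩ := (LinearMap.injective_iff_surjective
    (f := (fderiv ℝ f y).toLinearMap)).1 hinj (q - f y)
  have hv' : fderiv ℝ f y v = q - f y := hv
  have hvn : l * ‖v‖ ≤ η := by
    have := hl y hy v
    rwa [hv', ← dist_eq_norm, dist_comm] at this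
  set κ := η * (1 - c / l) / 2 with hκ
  have hcl1 : c / l < 1 := (div_lt_one hl0).2 hcl
  have hκpos : 0 < κ := by
    have : 0 < 1 - c / l := by linarith
    positivity
  have hline : HasDerivAt (fun t : ℝ => f (y + t • v)) (q - f y) 0 := by
    have h1 : HasDerivAt (fun t : ℝ => y + t • v) v 0 := by
      simpa using ((hasDerivAt_id (0 : ℝ)).smul_const v).const_add y
    have h2 : HasFDerivAt f (fderiv ℝ f y) (y + (0 : ℝ) • v) := by
      rw [zero_smul, add_zero]
      exact (hd y hy).hasFDerivAt
    have h3 := h2.comp_hasDerivAt (0 : ℝ) h1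
    rwa [hv'] at h3
  have hlo := (hasDerivAt_iff_isLittleO.1 hline).def hκpos
  have hin : ∀ᶠ t : ℝ in 𝓝 0, dist (y + t • v) x < ε := by
    have hct : Continuous fun t : ℝ => dist (y + t • v) x := by fun_prop
    exact hct.continuousAt.eventually_lt_const (by simpa using hyint)
  obtain ⟨t, ⟨ht1, ht2, ht3⟩, ht0⟩ := (((hlo.and (hin.and
    (eventually_lt_nhds (zero_lt_one (α := ℝ))))).filter_mono nhdsWithin_le_nhds).and
      (self_mem_nhdsWithin (a := (0 : ℝ)) (s := Set.Ioi 0))).exists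
  have ht0' : 0 < t := ht0
  simp only [zero_smul, add_zero, sub_zero, Real.norm_of_nonneg ht0'.le] at ht1
  have h4 := hmin' (y + t • v) (Metric.mem_closedBall.2 ht2.le)
  have h5 : dist (f (y + t • v)) q ≤ κ * t + (1 - t) * η := by
    have e : f (y + t • v) - q = (f (y + t • v) - f y - t • (q - f y)) + (1 - t) • (f y - q) := by
      module
    rw [dist_eq_norm, e]
    refine (norm_add_le _ _).trans (add_le_add ht1 ?_)
    rw [norm_smul, Real.norm_of_nonneg (by linarith), ← dist_eq_norm]
  have h6 : dist (y + t • v) x ≤ dist y x + t * ‖v‖ := by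
    refine (dist_triangle _ y _).trans ?_
    rw [dist_eq_norm (y + t • v) y, add_sub_cancel_left, norm_smul, Real.norm_of_nonneg ht0'.le,
      add_comm]
  have h7 : c * ‖v‖ ≤ η * (c / l) := by
    rw [mul_div_assoc', le_div_iff₀ hl0]
    nlinarith
  have h8 : η * (c / l) = η - 2 * κ := by rw [hκ]; ring
  have h9 : c * dist (y + t • v) x ≤ c * dist y x + t * (η - 2 * κ) := by
    have := mul_le_mul_of_nonneg_left h6 hc.le
    have := mul_le_mul_of_nonneg_left (h7.trans_eq h8) ht0'.le
    nlinarith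
  nlinarith [mul_pos ht0' hκpos]

/-- The maps `φ_i` are conformal on a common neighbourhood `N`, which they map into itself. The
Hölder condition on `|φ_i'|` is recorded in multiplicative form. -/
structure IsConformalOn (Φ : IteratedFunctionSystem d D) (N : Set (EuclideanSpace ℝ (Fin d)))
    (ρ a : ℝ) (H α : D → ℝ) : Prop where
  ratio_pos : 0 < ρ
  ratio_lt_one : ρ < 1
  a_pos : 0 < a
  a_le_one : a ≤ 1
  H_nonneg : ∀ i, 0 ≤ H i
  α_pos : ∀ i, 0 < α i
  mapsTo_nhd : ∀ i, Set.MapsTo (Φ.map i) N N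
  injOn : ∀ i, Set.InjOn (Φ.map i) N
  differentiableAt : ∀ i, ∀ x ∈ N, DifferentiableAt ℝ (Φ.map i) x
  norm_fderiv_apply : ∀ i, ∀ x ∈ N, ∀ v, ‖fderiv ℝ (Φ.map i) x v‖ = ‖fderiv ℝ (Φ.map i) x‖ * ‖v‖
  dist_le : ∀ i, ∀ x ∈ N, ∀ y ∈ N, dist (Φ.map i x) (Φ.map i y) ≤ ρ * dist x y
  le_norm_fderiv : ∀ i, ∀ x ∈ N, a ≤ ‖fderiv ℝ (Φ.map i) x‖
  distortion : ∀ i, ∀ x ∈ N, ∀ y ∈ N,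
    ‖fderiv ℝ (Φ.map i) x‖ ≤ Real.exp (H i * dist x y ^ α i) * ‖fderiv ℝ (Φ.map i) y‖

/-- A thin neighbourhood of the attractor is mapped into itself, although the domain of
conformality need not be. -/
theorem IsConformal.exists_isConformalOn [Finite D] {Φ : IteratedFunctionSystem d D}
    {X : Set (EuclideanSpace ℝ (Fin d))} (hΦ : Φ.IsConformal) (hX : Φ.IsAttractor X) :
    ∃ (ε ρ a : ℝ) (H α : D → ℝ), 0 < ε ∧
      Φ.IsConformalOn (Metric.thickening ε X) ρ a H α := by
  have := hX.nonempty_alphabet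
  obtain ⟨-, V, hVo, -, hVdom, hV⟩ := hΦ
  have hXV : X ⊆ V := hX.2.2.1.trans hVdom
  obtain ⟨ε, hε, hεV⟩ := hX.2.1.exists_thickening_subset_open hVo hXV
  choose hinj hC1 hconf hcontr hbd hhol using hV
  choose r hr0 hr1 hr using hcontr
  choose a b ha hb hab using hbd
  choose α c hα hc hhol using hhol
  obtain ⟨i₁, hi₁⟩ := Finite.exists_max r
  obtain ⟨i₀, hi₀⟩ := Finite.exists_min a
  obtain ⟨x₀, hx₀⟩ := hX.1
  refine ⟨ε, r i₁, a i₀, fun i => c i / a i₀, α, hε, hr0 _, hr1 _, ha _, ?_,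
    fun i => div_nonneg (hc i).le (ha _).le, hα,
    fun i x hx => ?_, fun i => (hinj i).mono hεV, fun i x hx => ?_,
    fun i x hx => hconf i x (hεV hx),
    fun i x hx y hy => ?_, fun i x hx => (hi₀ i).trans (hab i x (hεV hx)).1, fun i x hx y hy => ?_⟩
  · have h := hab i₀ x₀ (hXV hx₀)
    linarith [hb i₀, h.1.trans h.2]
  · obtain ⟨p, hp, hxp⟩ := Metric.mem_thickening_iff.1 hx
    refine Metric.mem_thickening_iff.2 ⟨Φ.map i p, hX.map_mem i hp, ?_⟩
    have h1 := hr i x (hεV hx) p (hXV hp)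
    nlinarith [hr1 i, dist_nonneg (x := x) (y := p)]
  · exact ((hC1 i).contDiffAt (hVo.mem_nhds (hεV hx))).differentiableAt one_ne_zero
  · exact (hr i x (hεV hx) y (hεV hy)).trans (mul_le_mul_of_nonneg_right (hi₁ i) dist_nonneg)
  · have h1 := le_of_abs_le (hhol i x (hεV hx) y (hεV hy))
    have h2 : a i₀ ≤ ‖fderiv ℝ (Φ.map i) y‖ := (hi₀ i).trans (hab i y (hεV hy)).1
    set A := ‖fderiv ℝ (Φ.map i) y‖
    have hp : 0 ≤ c i * dist x y ^ α i :=
      mul_nonneg (hc i).le (Real.rpow_nonneg dist_nonneg _)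
    have h3 : c i * dist x y ^ α i ≤ c i / a i₀ * dist x y ^ α i * A := by
      have e : c i / a i₀ * dist x y ^ α i * A = c i * dist x y ^ α i * (A / a i₀) := by ring
      rw [e]
      exact le_mul_of_one_le_right hp ((one_le_div (ha _)).2 h2)
    have h4 := Real.add_one_le_exp (c i / a i₀ * dist x y ^ α i)
    have hA : 0 ≤ A := norm_nonneg _
    nlinarith

namespace IsConformalOn

variable {Φ : IteratedFunctionSystem d D} {N : Set (EuclideanSpace ℝ (Fin d))}
  {ρ a : ℝ} {H α : D → ℝ}

theorem mapsTo_wordMap (h : Φ.IsConformalOn N ρ a H α) (I : List D) :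
    Set.MapsTo (Φ.wordMap I) N N := by
  induction I with
  | nil => exact Set.mapsTo_id N
  | cons i I ih => exact (h.mapsTo_nhd i).comp ih

theorem injOn_wordMap (h : Φ.IsConformalOn N ρ a H α) (I : List D) :
    Set.InjOn (Φ.wordMap I) N := by
  induction I with
  | nil => exact Set.injOn_id N
  | cons i I ih => exact (h.injOn i).comp ih (h.mapsTo_wordMap I)

theorem dist_wordMap_le (h : Φ.IsConformalOn N ρ a H α) (I : List D)
    {x y : EuclideanSpace ℝ (Fin d)} (hx : x ∈ N) (hy : y ∈ N) :
    dist (Φ.wordMap I x) (Φ.wordMap I y) ≤ ρ ^ I.length * dist x y := by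
  induction I with
  | nil => simp
  | cons i I ih =>
    refine (h.dist_le i _ (h.mapsTo_wordMap I hx) _ (h.mapsTo_wordMap I hy)).trans ?_
    rw [List.length_cons, pow_succ', mul_assoc]
    exact mul_le_mul_of_nonneg_left ih h.ratio_pos.le

theorem differentiableAt_wordMap (h : Φ.IsConformalOn N ρ a H α) (I : List D)
    {x : EuclideanSpace ℝ (Fin d)} (hx : x ∈ N) : DifferentiableAt ℝ (Φ.wordMap I) x := by
  induction I with
  | nil => exact differentiableAt_id
  | cons i I ih => exact (h.differentiableAt i _ (h.mapsTo_wordMap I hx)).comp x ih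

variable [Nontrivial (EuclideanSpace ℝ (Fin d))]

theorem norm_fderiv_wordMap_cons (h : Φ.IsConformalOn N ρ a H α) (i : D) (I : List D)
    {x : EuclideanSpace ℝ (Fin d)} (hx : x ∈ N)
    (hI : ∀ v, ‖fderiv ℝ (Φ.wordMap I) x v‖ = ‖fderiv ℝ (Φ.wordMap I) x‖ * ‖v‖) :
    (∀ v, ‖fderiv ℝ (Φ.wordMap (i :: I)) x v‖ = ‖fderiv ℝ (Φ.wordMap (i :: I)) x‖ * ‖v‖) ∧
    ‖fderiv ℝ (Φ.wordMap (i :: I)) x‖ =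
      ‖fderiv ℝ (Φ.map i) (Φ.wordMap I x)‖ * ‖fderiv ℝ (Φ.wordMap I) x‖ := by
  have h1 : fderiv ℝ (Φ.wordMap (i :: I)) x =
      (fderiv ℝ (Φ.map i) (Φ.wordMap I x)).comp (fderiv ℝ (Φ.wordMap I) x) :=
    fderiv_comp x (h.differentiableAt i _ (h.mapsTo_wordMap I hx))
      (h.differentiableAt_wordMap I hx)
  have h2 : ∀ v, ‖fderiv ℝ (Φ.wordMap (i :: I)) x v‖ =
      ‖fderiv ℝ (Φ.map i) (Φ.wordMap I x)‖ * ‖fderiv ℝ (Φ.wordMap I) x‖ * ‖v‖ := fun v => by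
    rw [h1, ContinuousLinearMap.comp_apply, h.norm_fderiv_apply i _ (h.mapsTo_wordMap I hx), hI,
      mul_assoc]
  have h3 := ContinuousLinearMap.homothety_norm _ h2
  exact ⟨fun v => by rw [h2, h3], h3⟩

theorem norm_fderiv_wordMap_apply (h : Φ.IsConformalOn N ρ a H α) (I : List D)
    {x : EuclideanSpace ℝ (Fin d)} (hx : x ∈ N) (v : EuclideanSpace ℝ (Fin d)) :
    ‖fderiv ℝ (Φ.wordMap I) x v‖ = ‖fderiv ℝ (Φ.wordMap I) x‖ * ‖v‖ := by
  induction I generalizing v with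
  | nil => simp [fderiv_id]
  | cons i I ih => exact (h.norm_fderiv_wordMap_cons i I hx ih).1 v

theorem norm_fderiv_cons (h : Φ.IsConformalOn N ρ a H α) (i : D) (I : List D)
    {x : EuclideanSpace ℝ (Fin d)} (hx : x ∈ N) :
    ‖fderiv ℝ (Φ.wordMap (i :: I)) x‖ =
      ‖fderiv ℝ (Φ.map i) (Φ.wordMap I x)‖ * ‖fderiv ℝ (Φ.wordMap I) x‖ :=
  (h.norm_fderiv_wordMap_cons i I hx (h.norm_fderiv_wordMap_apply I hx)).2

theorem norm_fderiv_append (h : Φ.IsConformalOn N ρ a H α) (I J : List D)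
    {x : EuclideanSpace ℝ (Fin d)} (hx : x ∈ N) :
    ‖fderiv ℝ (Φ.wordMap (I ++ J)) x‖ =
      ‖fderiv ℝ (Φ.wordMap I) (Φ.wordMap J x)‖ * ‖fderiv ℝ (Φ.wordMap J) x‖ := by
  induction I with
  | nil => simp [fderiv_id]
  | cons i I ih =>
    rw [List.cons_append, h.norm_fderiv_cons _ _ hx, ih, h.norm_fderiv_cons _ _
      (h.mapsTo_wordMap J hx), wordMap_append, Function.comp_apply, mul_assoc]

theorem pow_le_norm_fderiv (h : Φ.IsConformalOn N ρ a H α) (I : List D)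
    {x : EuclideanSpace ℝ (Fin d)} (hx : x ∈ N) :
    a ^ I.length ≤ ‖fderiv ℝ (Φ.wordMap I) x‖ := by
  induction I with
  | nil => simp [fderiv_id]
  | cons i I ih =>
    rw [h.norm_fderiv_cons _ _ hx, List.length_cons, pow_succ']
    exact mul_le_mul (h.le_norm_fderiv i _ (h.mapsTo_wordMap I hx)) ih
      (pow_nonneg h.a_pos.le _) (norm_nonneg _)

/-- Bounded distortion: along a word the distances of the two orbits decrease geometrically, so
the Hölder errors add up to a bounded amount. -/
theorem exists_bounded_distortion [Fintype D] (h : Φ.IsConformalOn N ρ a H α)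
    (hN : Bornology.IsBounded N) :
    ∃ K : ℝ, 1 ≤ K ∧ ∀ I : List D, ∀ x ∈ N, ∀ y ∈ N,
      ‖fderiv ℝ (Φ.wordMap I) x‖ ≤ K * ‖fderiv ℝ (Φ.wordMap I) y‖ := by
  have hρ := h.ratio_pos
  set Δ := Metric.diam N with hΔ
  have hΔ0 : 0 ≤ Δ := Metric.diam_nonneg
  let e : ℕ → ℝ := fun n => ∑ i, H i * Δ ^ α i * (ρ ^ α i) ^ n
  have he0 : ∀ n, 0 ≤ e n := fun n => Finset.sum_nonneg fun i _ =>
    mul_nonneg (mul_nonneg (h.H_nonneg i) (Real.rpow_nonneg hΔ0 _)) (by positivity)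
  have hes : Summable e := summable_sum fun i _ =>
    (summable_geometric_of_lt_one (by positivity)
      (Real.rpow_lt_one hρ.le h.ratio_lt_one (h.α_pos i))).mul_left _
  have key : ∀ I : List D, ∀ x ∈ N, ∀ y ∈ N, ‖fderiv ℝ (Φ.wordMap I) x‖ ≤
      Real.exp (∑ n ∈ Finset.range I.length, e n) * ‖fderiv ℝ (Φ.wordMap I) y‖ := by
    intro I x hx y hy
    induction I with
    | nil => simp [fderiv_id]
    | cons i I ih =>
      rw [h.norm_fderiv_cons _ _ hx, h.norm_fderiv_cons _ _ hy, List.length_cons,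
        Finset.sum_range_succ, Real.exp_add]
      have h1 := h.distortion i _ (h.mapsTo_wordMap I hx) _ (h.mapsTo_wordMap I hy)
      have h2 : H i * dist (Φ.wordMap I x) (Φ.wordMap I y) ^ α i ≤ e I.length := by
        have h3 : dist (Φ.wordMap I x) (Φ.wordMap I y) ≤ ρ ^ I.length * Δ :=
          (h.dist_wordMap_le I hx hy).trans (mul_le_mul_of_nonneg_left
            (Metric.dist_le_diam_of_mem hN hx hy) (by positivity))
        have h4 : dist (Φ.wordMap I x) (Φ.wordMap I y) ^ α i ≤
            Δ ^ α i * (ρ ^ α i) ^ I.length := by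
          refine (Real.rpow_le_rpow dist_nonneg h3 (h.α_pos i).le).trans_eq ?_
          rw [Real.mul_rpow (by positivity) hΔ0, ← Real.rpow_natCast, ← Real.rpow_mul hρ.le,
            ← Real.rpow_natCast, ← Real.rpow_mul hρ.le, mul_comm (α i), mul_comm]
        refine (mul_le_mul_of_nonneg_left h4 (h.H_nonneg i)).trans ?_
        rw [← mul_assoc]
        exact Finset.single_le_sum (f := fun i => H i * Δ ^ α i * (ρ ^ α i) ^ I.length)
          (fun j _ => mul_nonneg (mul_nonneg (h.H_nonneg j) (Real.rpow_nonneg hΔ0 _))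
            (by positivity)) (Finset.mem_univ i)
      have h5 := h1.trans (mul_le_mul_of_nonneg_right (Real.exp_le_exp.2 h2) (norm_nonneg _))
      calc _ ≤ (Real.exp (e I.length) * ‖fderiv ℝ (Φ.map i) (Φ.wordMap I y)‖) *
            (Real.exp (∑ n ∈ Finset.range I.length, e n) * ‖fderiv ℝ (Φ.wordMap I) y‖) :=
            mul_le_mul h5 ih (norm_nonneg _) (by positivity)
        _ = _ := by ring
  refine ⟨Real.exp (∑' n, e n), Real.one_le_exp (tsum_nonneg he0), fun I x hx y hy =>
    (key I x hx y hy).trans (mul_le_mul_of_nonneg_right (Real.exp_le_exp.2 ?_) (norm_nonneg _))⟩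
  exact hes.sum_le_tsum _ fun n _ => he0 n

end IsConformalOn

namespace IsConformalOn

variable {Φ : IteratedFunctionSystem d D} {X : Set (EuclideanSpace ℝ (Fin d))}
  {ε ρ a K : ℝ} {H α : D → ℝ} [Nontrivial (EuclideanSpace ℝ (Fin d))]

/-- On `X` the map `φ_I` multiplies distances by at most a fixed multiple of `|φ_I'|`. The mean
value inequality gives this for points that are close enough to be joined by a segment in the
neighbourhood. The last letters of `I` bring any two points that close. -/
theorem exists_dist_wordMap_le (h : Φ.IsConformalOn (Metric.thickening ε X) ρ a H α) (hε : 0 < ε)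
    (hX : Φ.IsAttractor X) (hK : 1 ≤ K)
    (hdist : ∀ I : List D, ∀ x ∈ Metric.thickening ε X, ∀ y ∈ Metric.thickening ε X,
      ‖fderiv ℝ (Φ.wordMap I) x‖ ≤ K * ‖fderiv ℝ (Φ.wordMap I) y‖) :
    ∃ C : ℝ, 0 < C ∧ ∀ I : List D, ∀ x ∈ X, ∀ y ∈ X, ∀ w ∈ X,
      dist (Φ.wordMap I x) (Φ.wordMap I y) ≤ C * ‖fderiv ℝ (Φ.wordMap I) w‖ * dist x y := by
  have hsub : X ⊆ Metric.thickening ε X := Metric.self_subset_thickening hε X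
  have hρ := h.ratio_pos
  have ha := h.a_pos
  have hnear : ∀ I : List D, ∀ x ∈ X, ∀ y ∈ X, ∀ w ∈ X, dist x y < ε →
      dist (Φ.wordMap I x) (Φ.wordMap I y) ≤ K * ‖fderiv ℝ (Φ.wordMap I) w‖ * dist x y := by
    intro I x hx y hy w hw hxy
    have hball : Metric.ball x ε ⊆ Metric.thickening ε X := Metric.ball_subset_thickening hx ε
    have := (convex_ball x ε).norm_image_sub_le_of_norm_fderiv_le (𝕜 := ℝ)
      (fun u hu => h.differentiableAt_wordMap I (hball hu))
      (fun u hu => hdist I u (hball hu) w (hsub hw))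
      (Metric.mem_ball'.2 hxy) (Metric.mem_ball_self hε)
    rwa [← dist_eq_norm, ← dist_eq_norm] at this
  have ht : Tendsto (fun n : ℕ => ρ ^ n * Metric.diam X) atTop (𝓝 0) := by
    simpa using (tendsto_pow_atTop_nhds_zero_of_lt_one hρ.le h.ratio_lt_one).mul_const
      (Metric.diam X)
  obtain ⟨p, hp⟩ := (ht.eventually_lt_const hε).exists
  refine ⟨K * (a ^ p)⁻¹, by positivity, fun I x hx y hy w hw => ?_⟩
  have hshort : ∀ J : List D, dist (Φ.wordMap J x) (Φ.wordMap J y) ≤ dist x y := fun J =>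
    (h.dist_wordMap_le J (hsub hx) (hsub hy)).trans
      (mul_le_of_le_one_left dist_nonneg (pow_le_one₀ hρ.le h.ratio_lt_one.le))
  have hone : ∀ J : List D, J.length ≤ p → 1 ≤ (a ^ p)⁻¹ * ‖fderiv ℝ (Φ.wordMap J) w‖ := by
    intro J hJ
    rw [← inv_mul_cancel₀ (pow_pos ha p).ne']
    refine mul_le_mul_of_nonneg_left ?_ (by positivity)
    exact (pow_le_pow_of_le_one ha.le h.a_le_one hJ).trans (h.pow_le_norm_fderiv J (hsub hw))
  rcases le_total I.length p with hI | hI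
  · calc _ ≤ dist x y := hshort I
      _ = 1 * 1 * dist x y := by ring
      _ ≤ K * ((a ^ p)⁻¹ * ‖fderiv ℝ (Φ.wordMap I) w‖) * dist x y :=
          mul_le_mul_of_nonneg_right (mul_le_mul hK (hone I hI) zero_le_one (by linarith))
            dist_nonneg
      _ = _ := by ring
  · obtain ⟨I', J, rfl, hJ⟩ : ∃ I' J, I = I' ++ J ∧ J.length = p :=
      ⟨I.take (I.length - p), I.drop (I.length - p), (List.take_append_drop _ _).symm, by
        simp; omega⟩
    have hclose : dist (Φ.wordMap J x) (Φ.wordMap J y) < ε := by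
      refine ((h.dist_wordMap_le J (hsub hx) (hsub hy)).trans ?_).trans_lt hp
      rw [hJ]
      exact mul_le_mul_of_nonneg_left (Metric.dist_le_diam_of_mem hX.2.1.isBounded hx hy)
        (by positivity)
    have h1 := hnear I' _ (hX.wordMap_mem J hx) _ (hX.wordMap_mem J hy) _ (hX.wordMap_mem J hw)
      hclose
    rw [wordMap_append, Function.comp_apply, Function.comp_apply, ← wordMap_append,
      h.norm_fderiv_append I' J (hsub hw)]
    set A := ‖fderiv ℝ (Φ.wordMap I') (Φ.wordMap J w)‖
    have hA : 0 ≤ A := norm_nonneg _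
    calc _ ≤ K * A * dist x y :=
          h1.trans (mul_le_mul_of_nonneg_left (hshort J) (by positivity))
      _ = K * A * 1 * dist x y := by ring
      _ ≤ K * A * ((a ^ p)⁻¹ * ‖fderiv ℝ (Φ.wordMap J) w‖) * dist x y :=
          mul_le_mul_of_nonneg_right (mul_le_mul_of_nonneg_left (hone J hJ.le) (by positivity))
            dist_nonneg
      _ = _ := by ring

/-- On `X` the map `φ_I` multiplies distances by at least a fixed fraction of `|φ_I'|`: if `φ_I(y)`
is very close to `φ_I(x)`, it is attained near `x`, and only at `y` by injectivity. -/
theorem exists_le_dist_wordMap (h : Φ.IsConformalOn (Metric.thickening ε X) ρ a H α) (hε : 0 < ε)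
    (hX : Φ.IsAttractor X) (hK : 1 ≤ K)
    (hdist : ∀ I : List D, ∀ x ∈ Metric.thickening ε X, ∀ y ∈ Metric.thickening ε X,
      ‖fderiv ℝ (Φ.wordMap I) x‖ ≤ K * ‖fderiv ℝ (Φ.wordMap I) y‖) :
    ∃ C : ℝ, 0 < C ∧ ∀ I : List D, ∀ x ∈ X, ∀ y ∈ X, ∀ w ∈ X,
      ‖fderiv ℝ (Φ.wordMap I) w‖ * dist x y ≤ C * dist (Φ.wordMap I x) (Φ.wordMap I y) := by
  have hsub : X ⊆ Metric.thickening ε X := Metric.self_subset_thickening hε X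
  have hK0 : 0 < K := by linarith
  have hΔ : 0 ≤ Metric.diam X := Metric.diam_nonneg
  refine ⟨2 * K * (1 + Metric.diam X / (ε / 2)), by positivity, fun I x hx y hy w hw => ?_⟩
  set A := ‖fderiv ℝ (Φ.wordMap I) w‖ with hA
  have hApos : 0 < A := (pow_pos h.a_pos _).trans_le (h.pow_le_norm_fderiv I (hsub hw))
  have hball : Metric.closedBall x (ε / 2) ⊆ Metric.thickening ε X :=
    (Metric.closedBall_subset_ball (by linarith)).trans (Metric.ball_subset_thickening hx ε)
  set c := A / (2 * K) with hc
  have hcpos : 0 < c := by positivity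
  have hAc : A = 2 * K * c := by rw [hc]; field_simp
  suffices hmain : c * dist x y ≤
      (1 + Metric.diam X / (ε / 2)) * dist (Φ.wordMap I x) (Φ.wordMap I y) by
    rw [hAc, mul_assoc, mul_assoc (2 * K)]
    exact mul_le_mul_of_nonneg_left hmain (by positivity)
  have hnn : 0 ≤ Metric.diam X / (ε / 2) := by positivity
  have hdnn := dist_nonneg (x := Φ.wordMap I x) (y := Φ.wordMap I y)
  rcases lt_or_ge (dist (Φ.wordMap I y) (Φ.wordMap I x)) (c * (ε / 2)) with hlt | hge
  · obtain ⟨y', hy', hyy', hle⟩ := exists_eq_of_le_norm_fderiv (l := 2 * c) (by linarith) hcpos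
      (by linarith) (fun u hu => h.differentiableAt_wordMap I (hball hu))
      (fun u hu v => by
        rw [h.norm_fderiv_wordMap_apply I (hball hu)]
        refine mul_le_mul_of_nonneg_right ?_ (norm_nonneg _)
        have h1 := hdist I w (hsub hw) u (hball hu)
        rw [← hA, hAc] at h1
        have h2 : K * (2 * c) ≤ K * ‖fderiv ℝ (Φ.wordMap I) u‖ := by linarith
        exact le_of_mul_le_mul_left h2 hK0) hlt
    have hy2 : y' = y := h.injOn_wordMap I (hball hy') (hsub hy) hyy'
    rw [hy2, dist_comm y x, dist_comm (Φ.wordMap I y)] at hle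
    nlinarith
  · have h3 : dist x y ≤ Metric.diam X := Metric.dist_le_diam_of_mem hX.2.1.isBounded hx hy
    rw [dist_comm (Φ.wordMap I y)] at hge
    calc c * dist x y ≤ c * Metric.diam X := mul_le_mul_of_nonneg_left h3 hcpos.le
      _ = Metric.diam X / (ε / 2) * (c * (ε / 2)) := by field_simp
      _ ≤ Metric.diam X / (ε / 2) * dist (Φ.wordMap I x) (Φ.wordMap I y) :=
          mul_le_mul_of_nonneg_left hge hnn
      _ ≤ _ := by nlinarith

end IsConformalOn

theorem IsConformal.exists_isQuasiSelfSimilar [Fintype D] {Φ : IteratedFunctionSystem d D}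
    {X : Set (EuclideanSpace ℝ (Fin d))} (hΦ : Φ.IsConformal) (hX : Φ.IsAttractor X)
    (hnt : X.Nontrivial) : ∃ C, Φ.IsQuasiSelfSimilar X C := by
  have : Nontrivial (EuclideanSpace ℝ (Fin d)) := let ⟨x, _, y, _, h⟩ := hnt; ⟨x, y, h⟩
  obtain ⟨ε, ρ, a, H, α, hε, h⟩ := hΦ.exists_isConformalOn hX
  have hsub : X ⊆ Metric.thickening ε X := Metric.self_subset_thickening hε X
  obtain ⟨K, hK, hdist⟩ := h.exists_bounded_distortion hX.2.1.isBounded.thickening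
  obtain ⟨C₁, hC₁, hup⟩ := h.exists_dist_wordMap_le hε hX hK hdist
  obtain ⟨C₂, hC₂, hlow⟩ := h.exists_le_dist_wordMap hε hX hK hdist
  obtain ⟨w, hw⟩ := hX.1
  set Δ := Metric.diam X with hΔdef
  have hΔ : 0 < Δ := Metric.diam_pos hnt hX.2.1.isBounded
  have hNpos : ∀ I : List D, ∀ w ∈ X, 0 < ‖fderiv ℝ (Φ.wordMap I) w‖ := fun I w hw =>
    (pow_pos h.a_pos _).trans_le (h.pow_le_norm_fderiv I (hsub hw))
  have hdiam_le : ∀ I : List D, ∀ w ∈ X,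
      Φ.cylDiam X I ≤ C₁ * Δ * ‖fderiv ℝ (Φ.wordMap I) w‖ := by
    intro I w hw
    refine Metric.diam_le_of_forall_dist_le (by positivity) ?_
    rintro _ ⟨x, hx, rfl⟩ _ ⟨y, hy, rfl⟩
    refine (hup I x hx y hy w hw).trans ?_
    rw [mul_right_comm]
    exact mul_le_mul_of_nonneg_right (mul_le_mul_of_nonneg_left
      (Metric.dist_le_diam_of_mem hX.2.1.isBounded hx hy) hC₁.le) (norm_nonneg _)
  have hle_diam : ∀ I : List D, ∀ w ∈ X,
      ‖fderiv ℝ (Φ.wordMap I) w‖ ≤ C₂ / Δ * Φ.cylDiam X I := by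
    intro I w hw
    have hN := hNpos I w hw
    rw [div_mul_eq_mul_div, le_div_iff₀ hΔ, mul_comm, ← le_div_iff₀ hN]
    refine Metric.diam_le_of_forall_dist_le
      (div_nonneg (mul_nonneg hC₂.le (Φ.cylDiam_nonneg X I)) hN.le) fun x hx y hy => ?_
    rw [le_div_iff₀ hN, mul_comm]
    exact (hlow I x hx y hy w hw).trans (mul_le_mul_of_nonneg_left
      (hX.dist_le_diam_cylinder I ⟨x, hx, rfl⟩ ⟨y, hy, rfl⟩) hC₂.le)
  set C := max 1 (max (C₁ * Δ * C₂) (max (C₁ * (C₂ / Δ)) (max (C₁ * Δ) (C₂ / Δ)))) with hCdef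
  have hCa : C₁ * Δ * C₂ ≤ C := le_max_of_le_right (le_max_left _ _)
  have hCb : C₁ * (C₂ / Δ) ≤ C := le_max_of_le_right (le_max_of_le_right (le_max_left _ _))
  have hCc : C₁ * Δ ≤ C :=
    le_max_of_le_right (le_max_of_le_right (le_max_of_le_right (le_max_left _ _)))
  have hCd : C₂ / Δ ≤ C :=
    le_max_of_le_right (le_max_of_le_right (le_max_of_le_right (le_max_right _ _)))
  refine ⟨C, le_max_left _ _, fun I => ?_, fun I x hx y hy => ?_, fun I x hx y hy => ?_,
    fun I x hx => ?_, fun I x hx => ?_⟩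
  · exact (mul_pos_iff_of_pos_left (div_pos hC₂ hΔ)).1 ((hNpos I w hw).trans_le
      (hle_diam I w hw))
  · calc Φ.cylDiam X I * dist x y ≤ C₁ * Δ * ‖fderiv ℝ (Φ.wordMap I) w‖ * dist x y :=
          mul_le_mul_of_nonneg_right (hdiam_le I w hw) dist_nonneg
      _ = C₁ * Δ * (‖fderiv ℝ (Φ.wordMap I) w‖ * dist x y) := by ring
      _ ≤ C₁ * Δ * (C₂ * dist (Φ.wordMap I x) (Φ.wordMap I y)) :=
          mul_le_mul_of_nonneg_left (hlow I x hx y hy w hw) (by positivity)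
      _ = C₁ * Δ * C₂ * dist (Φ.wordMap I x) (Φ.wordMap I y) := by ring
      _ ≤ _ := mul_le_mul_of_nonneg_right hCa dist_nonneg
  · calc _ ≤ C₁ * ‖fderiv ℝ (Φ.wordMap I) w‖ * dist x y := hup I x hx y hy w hw
      _ ≤ C₁ * (C₂ / Δ * Φ.cylDiam X I) * dist x y :=
          mul_le_mul_of_nonneg_right (mul_le_mul_of_nonneg_left (hle_diam I w hw) hC₁.le)
            dist_nonneg
      _ = C₁ * (C₂ / Δ) * Φ.cylDiam X I * dist x y := by ring
      _ ≤ _ := mul_le_mul_of_nonneg_right (mul_le_mul_of_nonneg_right hCb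
          (Φ.cylDiam_nonneg X I)) dist_nonneg
  · exact (hdiam_le I x hx).trans (mul_le_mul_of_nonneg_right hCc (norm_nonneg _))
  · exact (hle_diam I x hx).trans (mul_le_mul_of_nonneg_right hCd (Φ.cylDiam_nonneg X I))

end IteratedFunctionSystem

end

theorem mainTheorem1 {d : ℕ} {D : Type*} [Fintype D] (Φ : IteratedFunctionSystem d D)
    (X : Set (EuclideanSpace ℝ (Fin d))) (hX : Φ.IsAttractor X) :
    (∀ Ψ : List D → ℝ≥0,
      IteratedFunctionSystem.SeriesConverges (fun I => (Ψ I : ℝ))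
        (IteratedFunctionSystem.hausdorffDim X) →
      ∀ z ∈ X, μH[IteratedFunctionSystem.hausdorffDim X]
        (Φ.limsupSet X (fun I => (Ψ I : ℝ)) z) = 0) ∧
    ((Φ.IsConformal ∧ Φ.StrongSeparation X) ∨ (Φ.IsSimilarity ∧ Φ.OpenSetCondition) →
      Φ.IsApproximationRegular X ∧
      ∀ z ∈ X, ∀ θ : ℕ → ℝ≥0, AntitoneOn θ (Set.Ici 1) →
        ¬ IteratedFunctionSystem.SeriesConverges
            (fun I => Metric.diam (Φ.cylinder X I) * θ I.length)
            (IteratedFunctionSystem.hausdorffDim X) →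
        μH[IteratedFunctionSystem.hausdorffDim X]
          (X \ Φ.limsupSet X (fun I => Metric.diam (Φ.cylinder X I) * θ I.length) z) = 0) := by
  have := hX.nonempty_alphabet
  refine ⟨fun Ψ hΨ z _ => Φ.hausdorffMeasure_limsupSet_eq_zero X ENNReal.toReal_nonneg Ψ hΨ z,
    fun hΦ => ?_⟩
  rcases X.subsingleton_or_nontrivial with hsub | hnt
  · exact hX.divergence_part_of_subsingleton hsub
  rcases hΦ with ⟨hconf, hsep⟩ | ⟨hsim, hosc⟩
  · obtain ⟨C, hC⟩ := hconf.exists_isQuasiSelfSimilar hX hnt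
    exact hC.divergence_part_of_strongSeparation hX hsep
  · choose r hr0 hr1 hr using hsim
    exact IteratedFunctionSystem.HasRatios.divergence_part (r := r)
      (fun i => ⟨hr0 i, hr1 i, hr i⟩) hX hnt hosc
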